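/- Let $\mu,\gamma_N,\gamma_L>0$ and $\Omega=[-1,1]$. Let $V\in L^\infty(\Omega)$ be real valued, not a.e. zero, odd a.e. ($V(-x)=-V(x)$), and nondecreasing off a null set. For $A\ge 0$ consider $$P_t-\mu P_{xx}+\gamma_N|P|^2P-(\gamma_L-iAV(x))P=0 \quad\text{on }\Omega,\qquad P_x(t,\pm1)=0 .$$ Let $H^2_n(\Omega)=\{f\in H^2(\Omega): f'(\pm1)=0\}$. A steady state is a time-independent solution $P\in H^2_n(\Omega)$ (complex valued). The linearization at a steady state $P$ is the real-linear operator $\mathcal L Q=\mu Q''+(\gamma_L-iAV)Q-\gamma_N(2|P|^2Q+P^2\overline Q)$ on $H^2_n(\Omega)$; its eigenvalues are those of its complexification. $P$ is linearly unstable if some eigenvalue has positive real part. $P$ is linearly stable if, apart from the neutral mode $Q=iP$ generated by the phase invariance $P\mapsto e^{ic}P$, all modes decay: every nonzero eigenvalue has negative real part, and the generalized eigenspace of the eigenvalue $0$ contains only the multiples of that neutral mode. The first eigenvalue is the eigenvalue of largest real part. (a) There are $A_0>0$ and, for each $A\in[0,A_0]$, a linearly stable steady state $P_A=R_Ae^{i\theta_A}\in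 H^2_n(\Omega)$ with real $R_A,\theta_A\in H^2_n(\Omega)$, $R_A>0$ and $R_A(-x)=R_A(x)$, which is unique up to a constant phase factor: every steady state (for the same $A$) that is not linearly unstable equals $e^{ic}P_A$ for some $c\in\mathbb R$. Moreover $R_A\to(\gamma_L/\gamma_N)^{1/2}$ uniformly on $[-1,1]$ as $A\to0$. Furthermore, there is a constant $C>0$ such that every linearly unstable steady state for $A=0$ has a (real) first eigenvalue, and this eigenvalue is larger than $C$. (b) There is $A_1>0$ such that for every $A\ge A_1$ there is no nonzero steady state $P=Re^{i\theta}$ with $R=|P|\ge 0$ such that $R(-x)=R(x)$, $R$ is nonincreasing on $(-1,0)$ and $R$ is nondecreasing on $(0,1)$. -/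

import Mathlib

open Set Filter Topology MeasureTheory
open scoped ComplexConjugate

/-- Lebesgue measure on the interval `Ω = [-1, 1]`. -/
noncomputable def volΩ : Measure ℝ := volume.restrict (Icc (-1) 1)

/-- `f` is (the continuous representative of) an element of `H²(Ω)` satisfying the Neumann boundary
condition `f'(±1) = 0`, with first derivative `f₁` and second (weak) derivative `f₂ ∈ L²(Ω)`:
`f` is continuously differentiable on `[-1, 1]` and `f₁` is absolutely continuous, being the
integral of `f₂`. Only the values on `[-1, 1]` matter. -/
structure H2NeumannWith {E : Type*} [NormedAddCommGroup E] [NormedSpace ℝ E]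
    (f f₁ f₂ : ℝ → E) : Prop where
  hasDeriv : ∀ x ∈ Icc (-1 : ℝ) 1, HasDerivWithinAt f (f₁ x) (Icc (-1) 1) x
  memLp : MemLp f₂ 2 volΩ
  deriv_eq : ∀ x ∈ Icc (-1 : ℝ) 1, f₁ x = f₁ (-1) + ∫ t in (-1 : ℝ)..x, f₂ t
  left : f₁ (-1) = 0
  right : f₁ 1 = 0

/-- The space `H²ₙ(Ω)`. -/
def MemH2Neumann {E : Type*} [NormedAddCommGroup E] [NormedSpace ℝ E] (f : ℝ → E) : Prop :=
  ∃ f₁ f₂ : ℝ → E, H2NeumannWith f f₁ f₂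

/-- Admissible shear profiles: `V ∈ L^∞(Ω)` is not (a.e.) zero, is odd a.e., and is nondecreasing
off a null set. -/
structure IsShearProfile (V : ℝ → ℝ) : Prop where
  memLp : MemLp V ⊤ volΩ
  ne_zero : ¬ (V =ᵐ[volΩ] 0)
  odd : ∀ᵐ x ∂volΩ, V (-x) = -V x
  mono : ∃ s : Set ℝ, (∀ᵐ x ∂volΩ, x ∈ s) ∧ MonotoneOn V s

/-- `P ∈ H²ₙ(Ω)` is a steady state of
`P_t - μ P_xx + γN |P|² P - (γL - i A V(x)) P = 0` with Neumann boundary conditions. -/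
def IsSteadyState (μ γN γL A : ℝ) (V : ℝ → ℝ) (P : ℝ → ℂ) : Prop :=
  ∃ P₁ P₂ : ℝ → ℂ, H2NeumannWith P P₁ P₂ ∧
    ∀ᵐ x ∂volΩ, -(μ : ℂ) * P₂ x + (γN : ℂ) * (‖P x‖ : ℂ) ^ 2 * P x
      - ((γL : ℂ) - Complex.I * (A : ℂ) * (V x : ℂ)) * P x = 0

/-- The linearization at `P` is the real-linear operator
`ℒ Q = μ Q'' + (γL - i A V) Q - γN (2 |P|² Q + P² conj Q)` on `H²ₙ(Ω)`. Its complexification acts on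
pairs `(φ, ψ)`, where `ψ` stands for `conj Q` and is treated as independent of `φ = Q`.
`LinearizedMapsTo … P φ ψ f g` says that `(φ, ψ)` is in the domain `H²ₙ(Ω) × H²ₙ(Ω)` of this
complexified operator and is sent to `(f, g)`. -/
def LinearizedMapsTo (μ γN γL A : ℝ) (V : ℝ → ℝ) (P φ ψ f g : ℝ → ℂ) : Prop :=
  ∃ φ₁ φ₂ ψ₁ ψ₂ : ℝ → ℂ, H2NeumannWith φ φ₁ φ₂ ∧ H2NeumannWith ψ ψ₁ ψ₂ ∧
    (∀ᵐ x ∂volΩ, (μ : ℂ) * φ₂ x + ((γL : ℂ) - Complex.I * (A : ℂ) * (V x : ℂ)) * φ x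
      - (γN : ℂ) * (2 * (‖P x‖ : ℂ) ^ 2 * φ x + P x ^ 2 * ψ x) = f x) ∧
    (∀ᵐ x ∂volΩ, (μ : ℂ) * ψ₂ x + ((γL : ℂ) + Complex.I * (A : ℂ) * (V x : ℂ)) * ψ x
      - (γN : ℂ) * (2 * (‖P x‖ : ℂ) ^ 2 * ψ x + conj (P x) ^ 2 * φ x) = g x)

/-- `lam` is an eigenvalue of the linearization at `P`: there is a nontrivial mode with time
dependence `exp (lam * t)`. -/
def IsLinEigenvalue (μ γN γL A : ℝ) (V : ℝ → ℝ) (P : ℝ → ℂ) (lam : ℂ) : Prop :=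
  ∃ φ ψ : ℝ → ℂ, (∃ x ∈ Icc (-1 : ℝ) 1, φ x ≠ 0 ∨ ψ x ≠ 0) ∧
    LinearizedMapsTo μ γN γL A V P φ ψ (fun x => lam * φ x) (fun x => lam * ψ x)

/-- The first eigenvalue: a real eigenvalue which has the largest real part (fastest growth) among
all eigenvalues of the linearization. -/
def IsFirstEigenvalue (μ γN γL A : ℝ) (V : ℝ → ℝ) (P : ℝ → ℂ) (lam : ℝ) : Prop :=
  IsLinEigenvalue μ γN γL A V P (lam : ℂ) ∧
    ∀ z : ℂ, IsLinEigenvalue μ γN γL A V P z → z.re ≤ lam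

/-- Linear instability: some mode of the linearization grows exponentially. -/
def IsLinearlyUnstable (μ γN γL A : ℝ) (V : ℝ → ℝ) (P : ℝ → ℂ) : Prop :=
  ∃ z : ℂ, IsLinEigenvalue μ γN γL A V P z ∧ 0 < z.re

/-- Linear stability of a steady state. The equation is invariant under `P ↦ exp (i c) P`, so
`Q = i P`, i.e. a multiple of the pair `(P, -conj P)`, is always in the kernel of the linearization.
Stability means that all other modes decay: every eigenvalue other than `0` has negative real part,
and the generalized eigenspace of `0` contains nothing but this neutral phase mode. -/
def IsLinearlyStable (μ γN γL A : ℝ) (V : ℝ → ℝ) (P : ℝ → ℂ) : Prop :=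
  (∀ z : ℂ, IsLinEigenvalue μ γN γL A V P z → z ≠ 0 → z.re < 0) ∧
    ∀ (φ ψ : ℝ → ℂ) (c : ℂ),
      LinearizedMapsTo μ γN γL A V P φ ψ (fun x => c * P x) (fun x => -(c * conj (P x))) →
        ∃ d : ℂ, ∀ x ∈ Icc (-1 : ℝ) 1, φ x = d * P x ∧ ψ x = -(d * conj (P x))

/-- The function `R exp (i θ)`. -/
noncomputable def polar (R θ : ℝ → ℝ) : ℝ → ℂ :=
  fun x => (R x : ℂ) * Complex.exp (Complex.I * (θ x : ℂ))

/-! Two identities drive everything. Pairing the stationary equation with `conj P`, the real part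
loses the shear and gives the energy identity (`steady_energy`), while the imaginary part keeps only
the shear and gives the flux `Im (conj P * P')` as a primitive of `(A / μ) V |P|²` (`steady_flux`).

Strong shear. If `|P|` is largest at `-1`, with value `M`, the energy identity bounds `∫ |P'|²` by a
multiple of `M²`, so `|P| ≥ M / 2` on a layer at `-1` whose width does not depend on `A`. There `V`
is bounded above by a negative constant, so the flux has size of order `A M²` and `∫ |P'|²` is at
least a multiple of `A² M²`. This bounds `A` (`strong_shear_bound`).

No shear. A steady state is a constant phase times a real function `p`. If `p` has no zero,
integrating `p'' / p` shows that the deficit `∫ (γL - γN |P|²)` is at most zero, and the energy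
identity then forces constant modulus; if `p` has a zero, the deficit exceeds a fixed positive
constant (`norm_const_or_deficit`). The linearization is self-adjoint, and its top eigenvalue is
that of the scalar operator `μ ∂² + γL - γN |P|²`, attained in the phase direction. Testing with a
constant bounds it below by half the deficit (`exists_isFirstEigenvalue`), which gives the spectral
gap.

Weak shear, localization. Steady states that are not unstable, for shears tending to zero, converge
along a subsequence to a steady state without shear. A limit with positive deficit would have a
positive eigenvalue; positive eigenvalues persist under small perturbations
(`exists_unstable_nhds`), a contradiction. So the modulus is uniformly close to `a = sqrt (γL / γN)`
(`exists_norm_close_of_not_unstable`).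

Weak shear, existence and uniqueness. Eliminating the phase through the flux leaves a scalar
amplitude equation with a nonlocal centrifugal term. Its linearization at `a` is invertible, so the
implicit function theorem gives one solution near `a` for each small `A`
(`exists_amplitude_branch`). The equation is invariant under reflection, hence this solution is
even; evenness makes the flux vanish at both ends and the phase satisfy the Neumann conditions.
Conversely, the modulus of a nowhere vanishing steady state solves the amplitude equation and
determines the state up to a constant phase.

Weak shear, stability. Near the constant state `a`, the sum `φ + ψ` is damped at rate `2 γL`, and `φ
- ψ` is damped by diffusion once its mean is removed; the mean is removed by subtracting a multiple
of the neutral mode. Energy estimates absorb the perturbation (`damped_modes_eq_zero`,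
`exists_stable_nhds`).

Neumann problems are treated throughout as fixed-point equations for compact integral operators on
continuous functions, so only bounded operators are perturbed. -/

/-! ### Primitives on `[-1, 1]` -/

/-- `F` is a primitive on `[-1, 1]` of the integrable function `f`. -/
structure IsPrim {E : Type*} [NormedAddCommGroup E] [NormedSpace ℝ E] (F f : ℝ → E) : Prop where
  int : IntervalIntegrable f volume (-1) 1
  eq : ∀ x ∈ Icc (-1 : ℝ) 1, F x = F (-1) + ∫ t in (-1 : ℝ)..x, f t

lemma uIoc_subset_Icc {x : ℝ} (hx : x ∈ Icc (-1 : ℝ) 1) : uIoc (-1) x ⊆ Icc (-1) 1 := by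
  rw [uIoc_of_le hx.1]
  exact fun y hy => ⟨hy.1.le, hy.2.trans hx.2⟩

lemma ae_uIoc_of_ae {p : ℝ → Prop} (h : ∀ᵐ x ∂volΩ, p x) {x : ℝ} (hx : x ∈ Icc (-1 : ℝ) 1) :
    ∀ᵐ t, t ∈ uIoc (-1) x → p t := by
  rw [volΩ, ae_restrict_iff' measurableSet_Icc] at h
  filter_upwards [h] with t ht h't using ht (uIoc_subset_Icc hx h't)

lemma ae_of_forall_Icc {p : ℝ → Prop} (h : ∀ x ∈ Icc (-1 : ℝ) 1, p x) : ∀ᵐ x ∂volΩ, p x :=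
  (ae_restrict_iff' measurableSet_Icc).2 (ae_of_all _ h)

lemma ae_mem_Icc : ∀ᵐ x ∂volΩ, x ∈ Icc (-1 : ℝ) 1 := ae_of_forall_Icc fun _ h => h

section
variable {E : Type*} [NormedAddCommGroup E]

lemma intervalIntegrable_iff_integrable {f : ℝ → E} :
    IntervalIntegrable f volume (-1) 1 ↔ Integrable f volΩ := by
  rw [intervalIntegrable_iff_integrableOn_Icc_of_le (by norm_num)]
  rfl

lemma IntervalIntegrable.sub_Icc {f : ℝ → E} (h : IntervalIntegrable f volume (-1) 1) {x y : ℝ}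
    (hx : x ∈ Icc (-1 : ℝ) 1) (hy : y ∈ Icc (-1 : ℝ) 1) : IntervalIntegrable f volume x y := by
  refine h.mono_set ?_
  rw [uIcc_of_le (show (-1 : ℝ) ≤ 1 by norm_num)]
  exact uIcc_subset_Icc hx hy

lemma IntervalIntegrable.congr_volΩ {f g : ℝ → E} (h : IntervalIntegrable f volume (-1) 1)
    (hfg : f =ᵐ[volΩ] g) : IntervalIntegrable g volume (-1) 1 :=
  intervalIntegrable_iff_integrable.2 ((intervalIntegrable_iff_integrable.1 h).congr hfg)

lemma ContinuousOn.intervalIntegrable_Icc {f : ℝ → E} (h : ContinuousOn f (Icc (-1) 1)) :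
    IntervalIntegrable f volume (-1) 1 :=
  h.intervalIntegrable_of_Icc (by norm_num)

instance : IsFiniteMeasure volΩ := by unfold volΩ; infer_instance

lemma ContinuousOn.aestronglyMeasurable_volΩ {f : ℝ → E} (h : ContinuousOn f (Icc (-1) 1)) :
    AEStronglyMeasurable f volΩ :=
  h.aestronglyMeasurable measurableSet_Icc

lemma ContinuousOn.exists_bound_Icc {f : ℝ → E} (h : ContinuousOn f (Icc (-1) 1)) :
    ∃ C, 0 ≤ C ∧ ∀ x ∈ Icc (-1 : ℝ) 1, ‖f x‖ ≤ C := by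
  obtain ⟨C, hC⟩ := isCompact_Icc.exists_bound_of_continuousOn h
  exact ⟨C, (norm_nonneg _).trans (hC 0 (by simp)), hC⟩

lemma ContinuousOn.memLp_volΩ {f : ℝ → E} (h : ContinuousOn f (Icc (-1) 1)) (p : ENNReal) :
    MemLp f p volΩ := by
  obtain ⟨C, -, hC⟩ := h.exists_bound_Icc
  exact MemLp.of_bound h.aestronglyMeasurable_volΩ C (ae_of_forall_Icc hC)

variable [NormedSpace ℝ E]

lemma integral_congr_volΩ {f g : ℝ → E} (h : f =ᵐ[volΩ] g) {x : ℝ} (hx : x ∈ Icc (-1 : ℝ) 1) :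
    ∫ t in (-1 : ℝ)..x, f t = ∫ t in (-1 : ℝ)..x, g t :=
  intervalIntegral.integral_congr_ae (ae_uIoc_of_ae h hx)

lemma integral_congr_Icc {f g : ℝ → E} (h : ∀ x ∈ Icc (-1 : ℝ) 1, f x = g x) {x : ℝ}
    (hx : x ∈ Icc (-1 : ℝ) 1) : ∫ t in (-1 : ℝ)..x, f t = ∫ t in (-1 : ℝ)..x, g t :=
  integral_congr_volΩ (ae_of_forall_Icc h) hx

lemma one_mem_Icc' : (1 : ℝ) ∈ Icc (-1 : ℝ) 1 := by simp

lemma neg_one_mem_Icc' : (-1 : ℝ) ∈ Icc (-1 : ℝ) 1 := by simp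

namespace IsPrim

variable {F f G g : ℝ → E}

lemma congr (h : IsPrim F f) (hG : ∀ x ∈ Icc (-1 : ℝ) 1, G x = F x) (hg : f =ᵐ[volΩ] g) :
    IsPrim G g := by
  refine ⟨h.int.congr_volΩ hg, fun x hx => ?_⟩
  rw [hG x hx, hG _ neg_one_mem_Icc', h.eq x hx, integral_congr_volΩ hg hx]

lemma integral_eq (h : IsPrim F f) : ∫ t in (-1 : ℝ)..1, f t = F 1 - F (-1) := by
  rw [h.eq 1 one_mem_Icc']; abel

lemma integral_eq' (h : IsPrim F f) {x y : ℝ} (hx : x ∈ Icc (-1 : ℝ) 1)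
    (hy : y ∈ Icc (-1 : ℝ) 1) : ∫ t in x..y, f t = F y - F x := by
  rw [h.eq x hx, h.eq y hy, ← intervalIntegral.integral_interval_sub_left
    (h.int.sub_Icc neg_one_mem_Icc' hy) (h.int.sub_Icc neg_one_mem_Icc' hx)]
  abel

lemma const_add (h : IsPrim F f) (c : E) : IsPrim (fun x => c + F x) f :=
  ⟨h.int, fun x hx => by rw [h.eq x hx, add_assoc]⟩

lemma add (h : IsPrim F f) (h' : IsPrim G g) :
    IsPrim (fun x => F x + G x) (fun x => f x + g x) := by
  refine ⟨h.int.add h'.int, fun x hx => ?_⟩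
  rw [h.eq x hx, h'.eq x hx, intervalIntegral.integral_add (h.int.sub_Icc neg_one_mem_Icc' hx)
    (h'.int.sub_Icc neg_one_mem_Icc' hx)]
  abel

lemma map {E' : Type*} [NormedAddCommGroup E'] [NormedSpace ℝ E'] [CompleteSpace E]
    [CompleteSpace E'] (h : IsPrim F f)
    (L : E →L[ℝ] E') : IsPrim (fun x => L (F x)) (fun x => L (f x)) := by
  refine ⟨⟨L.integrable_comp h.int.1, L.integrable_comp h.int.2⟩, fun x hx => ?_⟩
  rw [h.eq x hx, map_add, L.intervalIntegral_comp_comm (h.int.sub_Icc neg_one_mem_Icc' hx)]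

lemma neg (h : IsPrim F f) : IsPrim (fun x => -F x) (fun x => -f x) := by
  refine ⟨h.int.neg, fun x hx => ?_⟩
  rw [h.eq x hx, intervalIntegral.integral_neg]
  abel

lemma sub (h : IsPrim F f) (h' : IsPrim G g) :
    IsPrim (fun x => F x - G x) (fun x => f x - g x) := by
  simpa only [sub_eq_add_neg] using h.add h'.neg

lemma of_integral (h : IntervalIntegrable f volume (-1) 1) :
    IsPrim (fun x => ∫ t in (-1 : ℝ)..x, f t) f :=
  ⟨h, fun x _ => by simp⟩

lemma of_hasDeriv [CompleteSpace E]
    (h : ∀ x ∈ Icc (-1 : ℝ) 1, HasDerivWithinAt F (f x) (Icc (-1) 1) x)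
    (hf : ContinuousOn f (Icc (-1) 1)) : IsPrim F f := by
  refine ⟨hf.intervalIntegrable_Icc, fun x hx => ?_⟩
  rw [intervalIntegral.integral_eq_sub_of_hasDeriv_right_of_le (f := F) hx.1]
  · abel
  · exact fun y hy => ((h y ⟨hy.1, hy.2.trans hx.2⟩).continuousWithinAt.mono
      (Icc_subset_Icc_right hx.2))
  · intro y hy
    have hy' : y ∈ Ioo (-1 : ℝ) 1 := ⟨hy.1, hy.2.trans_le hx.2⟩
    exact ((h y ⟨hy'.1.le, hy'.2.le⟩).hasDerivAt (Icc_mem_nhds hy'.1 hy'.2)).hasDerivWithinAt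
  · exact hf.intervalIntegrable_Icc.sub_Icc neg_one_mem_Icc' hx

lemma norm_sub_le (h : IsPrim F f) {C : ℝ} (hC : ∀ᵐ x ∂volΩ, ‖f x‖ ≤ C) {x y : ℝ}
    (hx : x ∈ Icc (-1 : ℝ) 1) (hy : y ∈ Icc (-1 : ℝ) 1) : ‖F y - F x‖ ≤ C * |y - x| := by
  rw [← h.integral_eq' hx hy]
  refine intervalIntegral.norm_integral_le_of_norm_le_const_ae ?_
  rw [volΩ, ae_restrict_iff' measurableSet_Icc] at hC
  filter_upwards [hC] with t ht h't
  exact ht (uIcc_subset_Icc hx hy (uIoc_subset_uIcc h't))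

/-- Over a disjoint family of subintervals, the increments of `F` are dominated by those of the
primitive of `‖f‖`, whose absolute continuity is known. This makes a product rule possible for
merely integrable derivatives. -/
lemma absolutelyContinuous (h : IsPrim F f) : AbsolutelyContinuousOnInterval F (-1) 1 := by
  have hn := h.int.norm.absolutelyContinuousOnInterval_intervalIntegral (c := -1) (by simp)
  refine squeeze_zero' (Eventually.of_forall fun t => by positivity) ?_ hn
  have : ∀ᶠ t in AbsolutelyContinuousOnInterval.totalLengthFilter ⊓
      𝓟 (AbsolutelyContinuousOnInterval.disjWithin (-1 : ℝ) 1),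
      t ∈ AbsolutelyContinuousOnInterval.disjWithin (-1 : ℝ) 1 :=
    mem_inf_of_right (mem_principal_self _)
  filter_upwards [this] with t ht
  refine Finset.sum_le_sum fun i hi => ?_
  have h2 := ht.1 i hi
  rw [uIcc_of_le (show (-1 : ℝ) ≤ 1 by norm_num)] at h2
  have hN := (of_integral h.int.norm).integral_eq' h2.1 h2.2
  rw [dist_comm, dist_eq_norm, ← h.integral_eq' h2.1 h2.2, dist_comm, Real.dist_eq, ← hN]
  exact intervalIntegral.norm_integral_le_abs_integral_norm

lemma continuousOn (h : IsPrim F f) : ContinuousOn F (Icc (-1) 1) := by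
  have := h.absolutelyContinuous.continuousOn
  rwa [uIcc_of_le (show (-1 : ℝ) ≤ 1 by norm_num)] at this

lemma ae_hasDerivAt [CompleteSpace E] (h : IsPrim F f) :
    ∀ᵐ x ∂volΩ, HasDerivAt F (f x) x := by
  have h1 := h.int.ae_hasDerivAt_integral
  have h2 : ∀ᵐ x ∂(volume : Measure ℝ), x ≠ -1 ∧ x ≠ 1 := by
    have := ((Set.finite_singleton (1 : ℝ)).insert (-1)).measure_zero volume
    rw [← compl_mem_ae_iff] at this
    filter_upwards [this] with x hx
    simpa [not_or] using hx
  rw [volΩ, ae_restrict_iff' measurableSet_Icc]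
  filter_upwards [h1, h2] with x hx hx2 hxI
  have h3 := (hx (by rwa [uIcc_of_le (show (-1 : ℝ) ≤ 1 by norm_num)]) (-1) (by simp)).const_add
    (F (-1))
  refine h3.congr_of_eventuallyEq ?_
  have : Icc (-1 : ℝ) 1 ∈ 𝓝 x :=
    Icc_mem_nhds (lt_of_le_of_ne hxI.1 hx2.1.symm) (lt_of_le_of_ne hxI.2 hx2.2)
  filter_upwards [this] with y hy using h.eq y hy

lemma hasDerivWithinAt [CompleteSpace E] (h : IsPrim F f) (hf : ContinuousOn f (Icc (-1) 1))
    {x : ℝ} (hx : x ∈ Icc (-1 : ℝ) 1) : HasDerivWithinAt F (f x) (Icc (-1) 1) x := by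
  -- Extending `f` by its end values gives a continuous function on the line, so the two-sided
  -- fundamental theorem applies even at `±1`.
  have h0 : ContinuousOn (IccExtend (show (-1 : ℝ) ≤ 1 by norm_num) (fun t => f t)) univ := by
    rw [continuousOn_univ]
    exact (continuousOn_iff_continuous_domRestrict.1 hf).Icc_extend'
  have hc := continuousOn_univ.1 h0
  have h1 := (intervalIntegral.integral_hasDerivAt_right (hc.intervalIntegrable (-1) x)
    hc.aestronglyMeasurable.stronglyMeasurableAtFilter hc.continuousAt).const_add (F (-1))
  rw [IccExtend_of_mem _ _ hx] at h1
  refine h1.hasDerivWithinAt.congr (fun y hy => ?_) ?_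
  all_goals
    rw [h.eq _ (by assumption)]
    congr 1
    exact integral_congr_Icc (fun z hz => by rw [IccExtend_of_mem _ _ hz]) (by assumption)

/-- An absolutely continuous function is a primitive of its almost everywhere derivative. -/
lemma of_absolutelyContinuous [CompleteSpace E] (hF : AbsolutelyContinuousOnInterval F (-1) 1)
    (hf : IntervalIntegrable f volume (-1) 1) (h : ∀ᵐ x ∂volΩ, HasDerivAt F (f x) x) :
    IsPrim F f := by
  have hp := of_integral hf
  have hac := hF.sub hp.absolutelyContinuous
  have hd : ∀ᵐ x, x ∈ uIcc (-1 : ℝ) 1 →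
      HasDerivAt (F - fun x => ∫ t in (-1 : ℝ)..x, f t) 0 x := by
    have h1 := hp.ae_hasDerivAt
    rw [volΩ, ae_restrict_iff' measurableSet_Icc] at h h1
    filter_upwards [h, h1] with x hx hx1 hxI
    rw [uIcc_of_le (show (-1 : ℝ) ≤ 1 by norm_num)] at hxI
    simpa using (hx hxI).sub (hx1 hxI)
  obtain ⟨C, hC⟩ := hac.const_of_ae_hasDerivAt_zero hd
  rw [uIcc_of_le (show (-1 : ℝ) ≤ 1 by norm_num)] at hC
  refine ⟨hf, fun x hx => ?_⟩
  have h1 := hC x hx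
  have h2 := hC (-1) neg_one_mem_Icc'
  simp only [Pi.sub_apply, intervalIntegral.integral_same, sub_zero] at h1 h2
  rw [h2, ← h1]; abel

end IsPrim
end

/-- Products of absolutely continuous functions are absolutely continuous, and the product rule
holds almost everywhere. The integrations by parts below are this lemma evaluated between `-1` and
`1`. -/
lemma IsPrim.mul {𝕜 : Type*} [RCLike 𝕜] {F f G g : ℝ → 𝕜} (hF : IsPrim F f) (hG : IsPrim G g) :
    IsPrim (fun x => F x * G x) (fun x => f x * G x + F x * g x) := by
  refine IsPrim.of_absolutelyContinuous (hF.absolutelyContinuous.smul hG.absolutelyContinuous)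
    (IntervalIntegrable.add ?_ ?_) ?_
  · exact hF.int.mul_continuousOn (by
      rw [uIcc_of_le (show (-1 : ℝ) ≤ 1 by norm_num)]; exact hG.continuousOn)
  · exact hG.int.continuousOn_mul (by
      rw [uIcc_of_le (show (-1 : ℝ) ≤ 1 by norm_num)]; exact hF.continuousOn)
  · filter_upwards [hF.ae_hasDerivAt, hG.ae_hasDerivAt] with x h1 h2
    exact h1.mul h2

lemma IsPrim.const_mul {𝕜 : Type*} [RCLike 𝕜] {F f : ℝ → 𝕜} (hF : IsPrim F f) (c : 𝕜) :
    IsPrim (fun x => c * F x) (fun x => c * f x) := by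
  refine ⟨hF.int.const_mul c, fun x hx => ?_⟩
  rw [hF.eq x hx, intervalIntegral.integral_const_mul, mul_add]

lemma IsPrim.map_conj {F f : ℝ → ℂ} (hF : IsPrim F f) :
    IsPrim (fun x => conj (F x)) (fun x => conj (f x)) :=
  hF.map (Complex.conjCLE : ℂ →L[ℝ] ℂ)

lemma IsPrim.re {F f : ℝ → ℂ} (hF : IsPrim F f) :
    IsPrim (fun x => (F x).re) (fun x => (f x).re) :=
  hF.map Complex.reCLM

lemma IsPrim.im {F f : ℝ → ℂ} (hF : IsPrim F f) :
    IsPrim (fun x => (F x).im) (fun x => (f x).im) :=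
  hF.map Complex.imCLM

/-! ### The space `H²ₙ` -/

namespace H2NeumannWith

section
variable {E : Type*} [NormedAddCommGroup E] [NormedSpace ℝ E] {f f₁ f₂ g g₁ g₂ : ℝ → E}

lemma int (h : H2NeumannWith f f₁ f₂) : IntervalIntegrable f₂ volume (-1) 1 :=
  intervalIntegrable_iff_integrable.2 (h.memLp.integrable (by norm_num))

lemma prim₁ (h : H2NeumannWith f f₁ f₂) : IsPrim f₁ f₂ := ⟨h.int, h.deriv_eq⟩

lemma cont₁ (h : H2NeumannWith f f₁ f₂) : ContinuousOn f₁ (Icc (-1) 1) := h.prim₁.continuousOn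

lemma cont (h : H2NeumannWith f f₁ f₂) : ContinuousOn f (Icc (-1) 1) :=
  fun x hx => (h.hasDeriv x hx).continuousWithinAt

lemma prim [CompleteSpace E] (h : H2NeumannWith f f₁ f₂) : IsPrim f f₁ :=
  IsPrim.of_hasDeriv h.hasDeriv h.cont₁

lemma of_prim [CompleteSpace E] (h : IsPrim f f₁) (h₁ : IsPrim f₁ f₂) (hm : MemLp f₂ 2 volΩ)
    (hl : f₁ (-1) = 0) (hr : f₁ 1 = 0) : H2NeumannWith f f₁ f₂ :=
  ⟨fun _ hx => h.hasDerivWithinAt h₁.continuousOn hx, hm, h₁.eq, hl, hr⟩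

lemma congr (h : H2NeumannWith f f₁ f₂) (hg : ∀ x ∈ Icc (-1 : ℝ) 1, g x = f x)
    (h₂ : f₂ =ᵐ[volΩ] g₂) : H2NeumannWith g f₁ g₂ := by
  refine ⟨fun x hx => (h.hasDeriv x hx).congr (fun y hy => hg y hy) (hg x hx),
    h.memLp.ae_eq h₂, fun x hx => ?_, h.left, h.right⟩
  rw [h.deriv_eq x hx, integral_congr_volΩ h₂ hx]

lemma add [CompleteSpace E] (h : H2NeumannWith f f₁ f₂) (h' : H2NeumannWith g g₁ g₂) :
    H2NeumannWith (fun x => f x + g x) (fun x => f₁ x + g₁ x) (fun x => f₂ x + g₂ x) :=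
  of_prim (h.prim.add h'.prim) (h.prim₁.add h'.prim₁) (h.memLp.add h'.memLp)
    (by simp [h.left, h'.left]) (by simp [h.right, h'.right])

lemma map {E' : Type*} [NormedAddCommGroup E'] [NormedSpace ℝ E'] [CompleteSpace E]
    [CompleteSpace E'] (h : H2NeumannWith f f₁ f₂) (L : E →L[ℝ] E') :
    H2NeumannWith (fun x => L (f x)) (fun x => L (f₁ x)) (fun x => L (f₂ x)) :=
  of_prim (h.prim.map L) (h.prim₁.map L) (L.comp_memLp' h.memLp)
    (by simp [h.left]) (by simp [h.right])

lemma sub [CompleteSpace E] (h : H2NeumannWith f f₁ f₂) (h' : H2NeumannWith g g₁ g₂) :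
    H2NeumannWith (fun x => f x - g x) (fun x => f₁ x - g₁ x) (fun x => f₂ x - g₂ x) :=
  of_prim (h.prim.sub h'.prim) (h.prim₁.sub h'.prim₁) (h.memLp.sub h'.memLp)
    (by simp [h.left, h'.left]) (by simp [h.right, h'.right])

end

variable {f f₁ f₂ g g₁ g₂ : ℝ → ℂ}

lemma const_mul (h : H2NeumannWith f f₁ f₂) (c : ℂ) :
    H2NeumannWith (fun x => c * f x) (fun x => c * f₁ x) (fun x => c * f₂ x) :=
  of_prim (h.prim.const_mul c) (h.prim₁.const_mul c) (h.memLp.const_mul c)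
    (by simp [h.left]) (by simp [h.right])

lemma map_conj (h : H2NeumannWith f f₁ f₂) :
    H2NeumannWith (fun x => conj (f x)) (fun x => conj (f₁ x)) (fun x => conj (f₂ x)) :=
  h.map (Complex.conjCLE : ℂ →L[ℝ] ℂ)

lemma ofReal {f f₁ f₂ : ℝ → ℝ} (h : H2NeumannWith f f₁ f₂) :
    H2NeumannWith (fun x => (f x : ℂ)) (fun x => (f₁ x : ℂ)) (fun x => (f₂ x : ℂ)) :=
  h.map Complex.ofRealCLM

lemma const (c : ℂ) : H2NeumannWith (fun _ => c) (fun _ => 0) (fun _ => 0) :=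
  ⟨fun _ _ => hasDerivWithinAt_const _ _ _, by simp, by simp, rfl, rfl⟩

lemma integral_eq_zero {E : Type*} [NormedAddCommGroup E] [NormedSpace ℝ E] {f f₁ f₂ : ℝ → E}
    (h : H2NeumannWith f f₁ f₂) :
    ∫ x in (-1 : ℝ)..1, f₂ x = 0 := by
  rw [h.prim₁.integral_eq, h.left, h.right, sub_zero]

end H2NeumannWith

/-! ### Elementary facts on shear profiles and steady states -/

lemma IsPrim.mono_integral {g : ℝ → ℝ} (hg : IntervalIntegrable g volume (-1) 1)
    (h0 : ∀ x ∈ Icc (-1 : ℝ) 1, 0 ≤ g x) {x y : ℝ} (hx : x ∈ Icc (-1 : ℝ) 1)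
    (hy : y ∈ Icc (-1 : ℝ) 1) (hxy : x ≤ y) :
    ∫ t in x..y, g t ≤ ∫ t in (-1 : ℝ)..1, g t := by
  refine intervalIntegral.integral_mono_interval hx.1 hxy hy.2 ?_ hg
  rw [EventuallyLE, ae_restrict_iff' measurableSet_Ioc]
  exact ae_of_all _ fun t ht => h0 t ⟨ht.1.le, ht.2⟩

/-- Cauchy–Schwarz against the constant `1`, obtained from `∫ (g - m)² ≥ 0` with `m` the mean of `g`
on `[x, y]`. -/
lemma sq_integral_le {g : ℝ → ℝ} (hg : ContinuousOn g (Icc (-1) 1)) {x y : ℝ}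
    (hx : x ∈ Icc (-1 : ℝ) 1) (hy : y ∈ Icc (-1 : ℝ) 1) (hxy : x ≤ y) :
    (∫ t in x..y, g t) ^ 2 ≤ (y - x) * ∫ t in (-1 : ℝ)..1, g t ^ 2 := by
  have hi : IntervalIntegrable g volume x y := hg.intervalIntegrable_Icc.sub_Icc hx hy
  have hi2 : IntervalIntegrable (fun t => g t ^ 2) volume x y :=
    ((hg.pow 2).intervalIntegrable_Icc).sub_Icc hx hy
  have hle : ∫ t in x..y, g t ^ 2 ≤ ∫ t in (-1 : ℝ)..1, g t ^ 2 :=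
    IsPrim.mono_integral (hg.pow 2).intervalIntegrable_Icc (fun _ _ => sq_nonneg _) hx hy hxy
  have key : ∀ m : ℝ, 0 ≤ (∫ t in x..y, g t ^ 2) - 2 * m * (∫ t in x..y, g t)
      + m ^ 2 * (y - x) := by
    intro m
    have h0 : 0 ≤ ∫ t in x..y, (g t - m) ^ 2 :=
      intervalIntegral.integral_nonneg hxy fun _ _ => sq_nonneg _
    have h1 : ∫ t in x..y, (g t - m) ^ 2 = (∫ t in x..y, g t ^ 2) - 2 * m * (∫ t in x..y, g t)
      + m ^ 2 * (y - x) := by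
      have : ∀ t, (g t - m) ^ 2 = (g t ^ 2 - 2 * m * g t) + m ^ 2 := fun t => by ring
      simp only [this]
      rw [intervalIntegral.integral_add (hi2.sub (hi.const_mul _)) intervalIntegrable_const,
        intervalIntegral.integral_sub hi2 (hi.const_mul _), intervalIntegral.integral_const_mul,
        intervalIntegral.integral_const]
      simp [mul_comm]
    linarith
  refine le_trans ?_ (mul_le_mul_of_nonneg_left hle (sub_nonneg.2 hxy))
  rcases hxy.eq_or_lt with rfl | hlt
  · simp
  · have := key ((∫ t in x..y, g t) / (y - x))
    have hpos : 0 < y - x := sub_pos.2 hlt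
    have h3 := mul_le_mul_of_nonneg_left this hpos.le
    field_simp at h3
    nlinarith

/-- Hölder continuity of exponent `1/2` in terms of the Dirichlet energy; it turns energy bounds
into pointwise ones. -/
lemma H2NeumannWith.norm_sub_sq_le {f f₁ f₂ : ℝ → ℂ} (h : H2NeumannWith f f₁ f₂) {x y : ℝ}
    (hx : x ∈ Icc (-1 : ℝ) 1) (hy : y ∈ Icc (-1 : ℝ) 1) :
    ‖f y - f x‖ ^ 2 ≤ |y - x| * ∫ t in (-1 : ℝ)..1, ‖f₁ t‖ ^ 2 := by
  wlog hxy : x ≤ y generalizing x y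
  · rw [norm_sub_rev, abs_sub_comm]
    exact this hy hx (le_of_not_ge hxy)
  rw [abs_of_nonneg (sub_nonneg.2 hxy)]
  refine le_trans ?_ (sq_integral_le h.cont₁.norm hx hy hxy)
  rw [← h.prim.integral_eq' hx hy]
  gcongr
  exact intervalIntegral.norm_integral_le_integral_norm hxy

lemma measurePreserving_neg_volΩ : MeasurePreserving (fun x : ℝ => -x) volΩ volΩ := by
  have h := (Measure.measurePreserving_neg (volume : Measure ℝ)).restrict_preimage
    (measurableSet_Icc (a := (-1 : ℝ)) (b := 1))
  have e : Neg.neg ⁻¹' Icc (-1 : ℝ) 1 = Icc (-1) 1 := by simp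
  rw [e] at h
  exact h

namespace IsShearProfile

variable {V : ℝ → ℝ}

lemma exists_bound (hV : IsShearProfile V) : ∃ C, 0 ≤ C ∧ ∀ᵐ x ∂volΩ, |V x| ≤ C := by
  refine ⟨(eLpNormEssSup V volΩ).toReal, ENNReal.toReal_nonneg, ?_⟩
  have h := hV.memLp.eLpNorm_lt_top
  rw [eLpNorm_exponent_top] at h
  filter_upwards [enorm_ae_le_eLpNormEssSup V volΩ] with x hx
  have := ENNReal.toReal_mono h.ne hx
  simpa using this

lemma ae_neg_iff {p : ℝ → Prop} (h : ∀ᵐ x ∂volΩ, p x) : ∀ᵐ x ∂volΩ, p (-x) :=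
  measurePreserving_neg_volΩ.quasiMeasurePreserving.ae h

/-- An admissible profile is bounded above by a negative constant near the left end. -/
lemma exists_neg_near_left (hV : IsShearProfile V) :
    ∃ η v₀ : ℝ, 0 < η ∧ η ≤ 1 ∧ 0 < v₀ ∧ ∀ᵐ x ∂volΩ, x ≤ -1 + η → V x ≤ -v₀ := by
  obtain ⟨s, hs, hmono⟩ := hV.mono
  -- A nonnegative profile is also nonpositive by oddness, hence zero.
  have h1 : ¬ ∀ᵐ x ∂volΩ, 0 ≤ V x := by
    intro h
    apply hV.ne_zero
    filter_upwards [h, ae_neg_iff h, hV.odd] with x h1 h2 h3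
    simp only [Pi.zero_apply]
    linarith
  have h2 : ∃ n : ℕ, ¬ ∀ᵐ x ∂volΩ, -(1 / ((n : ℝ) + 1)) ≤ V x := by
    by_contra! h
    apply h1
    filter_upwards [ae_all_iff.2 h] with x hx
    by_contra! hneg
    obtain ⟨n, hn⟩ := exists_nat_one_div_lt (neg_pos.2 hneg)
    linarith [hx n]
  obtain ⟨n, hn⟩ := h2
  -- Excluding the endpoint gives `x₀ > -1`, so that the interval on which monotonicity propagates
  -- the bound has positive length.
  have h3 : ∀ᵐ x ∂volΩ, x ≠ -1 := by
    rw [volΩ]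
    exact ae_restrict_of_ae (by
      have := (Set.finite_singleton (-1 : ℝ)).measure_zero volume
      rwa [← compl_mem_ae_iff] at this)
  obtain ⟨x₀, hx0, hx0s, hx0I, hx0n⟩ : ∃ x₀, V x₀ < -(1 / ((n : ℝ) + 1)) ∧ x₀ ∈ s ∧
      x₀ ∈ Icc (-1 : ℝ) 1 ∧ x₀ ≠ -1 := by
    by_contra! h
    apply hn
    filter_upwards [hs, h3, ae_mem_Icc] with x h4 h5 h6
    by_contra! h7
    exact h5 (h x h7 h4 h6)
  have hlt : -1 < x₀ := lt_of_le_of_ne hx0I.1 hx0n.symm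
  refine ⟨min (x₀ + 1) 1, 1 / ((n : ℝ) + 1), lt_min (by linarith) one_pos, min_le_right _ _,
    by positivity, ?_⟩
  filter_upwards [hs] with x hxs hx
  exact (hmono hxs hx0s (by linarith [min_le_left (x₀ + 1) 1])).trans hx0.le

end IsShearProfile

section steady

variable {μ γN γL A : ℝ} {V : ℝ → ℝ} {P P₁ P₂ : ℝ → ℂ}

/-- `P` solves the stationary equation almost everywhere, solved for the second derivative. -/
lemma steady_second_deriv (hμ : 0 < μ)
    (h : ∀ᵐ x ∂volΩ, -(μ : ℂ) * P₂ x + (γN : ℂ) * (‖P x‖ : ℂ) ^ 2 * P x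
      - ((γL : ℂ) - Complex.I * (A : ℂ) * (V x : ℂ)) * P x = 0) :
    ∀ᵐ x ∂volΩ, P₂ x = (((γN * ‖P x‖ ^ 2 - γL) / μ : ℝ) + Complex.I * ((A / μ * V x : ℝ) : ℂ))
      * P x := by
  filter_upwards [h] with x hx
  have hμ' : (μ : ℂ) ≠ 0 := by exact_mod_cast hμ.ne'
  push_cast
  field_simp
  linear_combination -hx

/-- Pair the equation with `conj P` and take real parts: the shear coefficient is imaginary and
drops out, and the Neumann conditions kill the boundary terms. -/
lemma steady_energy (hμ : 0 < μ) (hP : H2NeumannWith P P₁ P₂)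
    (h : ∀ᵐ x ∂volΩ, P₂ x = (((γN * ‖P x‖ ^ 2 - γL) / μ : ℝ) +
      Complex.I * ((A / μ * V x : ℝ) : ℂ)) * P x) :
    μ * ∫ x in (-1 : ℝ)..1, ‖P₁ x‖ ^ 2 =
      ∫ x in (-1 : ℝ)..1, (γL * ‖P x‖ ^ 2 - γN * ‖P x‖ ^ 4) := by
  have hp := (hP.prim₁.mul hP.prim.map_conj).re
  have h1 := hp.integral_eq
  simp only [hP.left, hP.right, zero_mul, Complex.zero_re, sub_zero] at h1
  have h2 : ∫ x in (-1 : ℝ)..1, (P₂ x * conj (P x) + P₁ x * conj (P₁ x)).re =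
      ∫ x in (-1 : ℝ)..1, (‖P₁ x‖ ^ 2 - (1 / μ) * (γL * ‖P x‖ ^ 2 - γN * ‖P x‖ ^ 4)) := by
    refine integral_congr_volΩ ?_ one_mem_Icc'
    filter_upwards [h] with x hx
    rw [hx, mul_assoc, Complex.mul_conj', Complex.mul_conj']
    have : ((((γN * ‖P x‖ ^ 2 - γL) / μ : ℝ) + Complex.I * ((A / μ * V x : ℝ) : ℂ)) *
      (‖P x‖ : ℂ) ^ 2 + (‖P₁ x‖ : ℂ) ^ 2).re = (γN * ‖P x‖ ^ 2 - γL) / μ * ‖P x‖ ^ 2 + ‖P₁ x‖ ^ 2 := by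
      rw [← Complex.ofReal_pow, ← Complex.ofReal_pow]
      simp only [Complex.add_re, Complex.mul_re, Complex.ofReal_re, Complex.ofReal_im,
        Complex.I_re, Complex.I_im, Complex.add_im, Complex.mul_im]
      ring
    rw [this]
    field_simp
    ring
  have hi : IntervalIntegrable (fun x => ‖P₁ x‖ ^ 2) volume (-1) 1 :=
    (hP.cont₁.norm.pow 2).intervalIntegrable_Icc
  rw [h2, intervalIntegral.integral_sub hi,
    intervalIntegral.integral_const_mul] at h1
  · generalize (∫ x in (-1 : ℝ)..1, (γL * ‖P x‖ ^ 2 - γN * ‖P x‖ ^ 4)) = J at h1 ⊢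
    field_simp at h1
    linarith
  · have : ContinuousOn (fun x => (1 / μ) * (γL * ‖P x‖ ^ 2 - γN * ‖P x‖ ^ 4)) (Icc (-1) 1) := by
      have := hP.cont.norm
      fun_prop
    exact this.intervalIntegrable_Icc

/-- The imaginary part of the same pairing: the real coefficient and `|P₁|²` drop out, so only the
shear feeds the flux. -/
lemma steady_flux (hP : H2NeumannWith P P₁ P₂)
    (h : ∀ᵐ x ∂volΩ, P₂ x = (((γN * ‖P x‖ ^ 2 - γL) / μ : ℝ) +
      Complex.I * ((A / μ * V x : ℝ) : ℂ)) * P x) :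
    IsPrim (fun x => (conj (P x) * P₁ x).im) (fun x => A / μ * V x * ‖P x‖ ^ 2) := by
  refine (hP.prim.map_conj.mul hP.prim₁).im.congr (fun _ _ => rfl) ?_
  filter_upwards [h] with x hx
  rw [hx, mul_left_comm, Complex.conj_mul', Complex.conj_mul', ← Complex.ofReal_pow,
    ← Complex.ofReal_pow]
  simp only [Complex.add_re, Complex.mul_re, Complex.ofReal_re, Complex.ofReal_im,
        Complex.I_re, Complex.I_im, Complex.add_im, Complex.mul_im]
  ring

end steady

/-! ### Nonexistence for strong shear -/

lemma norm_polar {R θ : ℝ → ℝ} {x : ℝ} (h : 0 ≤ R x) : ‖polar R θ x‖ = R x := by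
  rw [polar, norm_mul, mul_comm Complex.I, Complex.norm_exp_ofReal_mul_I, mul_one,
    Complex.norm_real, Real.norm_of_nonneg h]

/-- A steady state whose modulus is maximal at the left end is zero or the shear is bounded. -/
lemma strong_shear_bound {μ γN γL : ℝ} (hμ : 0 < μ) (hγN : 0 < γN) (hγL : 0 < γL)
    {V : ℝ → ℝ} {η v₀ : ℝ} (hη : 0 < η) (hη1 : η ≤ 1) (hv₀ : 0 < v₀)
    (hVi : ∀ᵐ x ∂volΩ, x ≤ -1 + η → V x ≤ -v₀) {A : ℝ} (hA : 0 ≤ A) {P : ℝ → ℂ}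
    (hP : IsSteadyState μ γN γL A V P) (hmax : ∀ x ∈ Icc (-1 : ℝ) 1, ‖P x‖ ≤ ‖P (-1)‖)
    (h0 : P (-1) ≠ 0) :
    A ^ 2 * (v₀ ^ 2 * min η (μ / (8 * γL)) ^ 3) ≤ 256 * γL * μ := by
  obtain ⟨P₁, P₂, hP, heq⟩ := hP
  replace heq := steady_second_deriv hμ heq
  set M := ‖P (-1)‖ with hM
  have hMpos : 0 < M := norm_pos_iff.2 h0
  set E := ∫ x in (-1 : ℝ)..1, ‖P₁ x‖ ^ 2 with hE
  have hEle : μ * E ≤ 2 * γL * M ^ 2 := by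
    rw [hE, steady_energy hμ hP heq]
    have : ∫ x in (-1 : ℝ)..1, (γL * ‖P x‖ ^ 2 - γN * ‖P x‖ ^ 4) ≤
        ∫ x in (-1 : ℝ)..1, γL * M ^ 2 := by
      refine intervalIntegral.integral_mono_on (by norm_num) ?_ intervalIntegrable_const ?_
      · have := hP.cont.norm
        exact ContinuousOn.intervalIntegrable_Icc (by fun_prop)
      · intro x hx
        have h1 : ‖P x‖ ^ 2 ≤ M ^ 2 := by gcongr; exact hmax x hx
        have h2 : 0 ≤ γN * ‖P x‖ ^ 4 := by positivity
        nlinarith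
    refine this.trans (le_of_eq ?_)
    rw [intervalIntegral.integral_const]
    simp only [smul_eq_mul]
    ring
  -- The layer width: `s ≤ η` keeps `V ≤ -v₀`, and `s ≤ μ / (8 * γL)` makes `s * E ≤ M² / 4`, so
  -- that the modulus cannot fall below `M / 2` in the layer.
  set s := min η (μ / (8 * γL)) with hs
  have hspos : 0 < s := lt_min hη (by positivity)
  have hs1 : s ≤ 1 := (min_le_left _ _).trans hη1
  have hsγ : s * (8 * γL) ≤ μ := (le_div_iff₀ (by positivity)).1 (min_le_right _ _)
  have hsE : s * E ≤ M ^ 2 / 4 := by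
    have hE0 : 0 ≤ E := intervalIntegral.integral_nonneg (by norm_num) fun _ _ => by positivity
    have h1 : s * (8 * γL) * E ≤ μ * E := mul_le_mul_of_nonneg_right hsγ hE0
    nlinarith
  have hmem : ∀ x, -1 ≤ x → x ≤ -1 + s → x ∈ Icc (-1 : ℝ) 1 := fun x h1 h2 => ⟨h1, by linarith⟩
  have hlow : ∀ x, -1 ≤ x → x ≤ -1 + s → M / 2 ≤ ‖P x‖ := by
    intro x h1 h2
    have h3 := hP.norm_sub_sq_le neg_one_mem_Icc' (hmem x h1 h2)
    have hE0 : 0 ≤ E := intervalIntegral.integral_nonneg (by norm_num) fun _ _ => by positivity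
    rw [abs_of_nonneg (by linarith)] at h3
    have h4 : ‖P x - P (-1)‖ ^ 2 ≤ (M / 2) ^ 2 := by
      have : (x - -1) * E ≤ s * E := mul_le_mul_of_nonneg_right (by linarith) hE0
      calc _ ≤ (x - -1) * E := h3
        _ ≤ _ := by nlinarith
    have h5 := abs_le_of_sq_le_sq h4 (by positivity)
    rw [abs_of_nonneg (norm_nonneg _)] at h5
    have h6 := norm_sub_norm_le (P (-1)) (P x)
    rw [norm_sub_rev] at h6
    linarith
  have hflux := steady_flux hP heq
  have hj : ∀ x, -1 ≤ x → x ≤ -1 + s →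
      (conj (P x) * P₁ x).im ≤ -(A / μ * v₀ * (M ^ 2 / 4) * (x + 1)) := by
    intro x h1 h2
    rw [hflux.eq x (hmem x h1 h2)]
    simp only [hP.left, mul_zero, Complex.zero_im, zero_add]
    have : ∫ t in (-1 : ℝ)..x, A / μ * V t * ‖P t‖ ^ 2 ≤
        ∫ t in (-1 : ℝ)..x, -(A / μ * v₀ * (M ^ 2 / 4)) := by
      refine intervalIntegral.integral_mono_ae_restrict h1
        (hflux.int.sub_Icc neg_one_mem_Icc' (hmem x h1 h2)) intervalIntegrable_const ?_
      have h3 := (ae_restrict_iff' measurableSet_Icc).1 hVi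
      rw [EventuallyLE, ae_restrict_iff' measurableSet_Icc]
      filter_upwards [h3] with t ht htI
      have h4 := ht ⟨htI.1, by linarith [htI.2]⟩
        (by linarith [htI.2, min_le_left η (μ / (8 * γL))])
      have h5 := hlow t htI.1 (htI.2.trans h2)
      have h6 : M ^ 2 / 4 ≤ ‖P t‖ ^ 2 := by nlinarith
      have hAμ : 0 ≤ A / μ := by positivity
      have h7 : v₀ * (M ^ 2 / 4) ≤ -V t * ‖P t‖ ^ 2 :=
        mul_le_mul (by linarith) h6 (by positivity) (by linarith)
      nlinarith [mul_le_mul_of_nonneg_left h7 hAμ]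
    refine this.trans (le_of_eq ?_)
    rw [intervalIntegral.integral_const, smul_eq_mul]
    ring
  -- Only the right half of the layer is used, where `x + 1 ≥ s / 2`; dividing the flux by the
  -- maximal modulus `M` bounds `‖P₁‖` below.
  have hP1 : ∀ x ∈ Icc (-1 + s / 2) (-1 + s), (A / μ * v₀ * (M / 8) * s) ^ 2 ≤ ‖P₁ x‖ ^ 2 := by
    intro x hx
    have h1 : -1 ≤ x := by linarith [hx.1]
    have h2 := hj x h1 hx.2
    have h3 : -(conj (P x) * P₁ x).im ≤ M * ‖P₁ x‖ := by
      calc -(conj (P x) * P₁ x).im ≤ |(conj (P x) * P₁ x).im| := neg_le_abs _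
        _ ≤ ‖conj (P x) * P₁ x‖ := Complex.abs_im_le_norm _
        _ = ‖P x‖ * ‖P₁ x‖ := by simp
        _ ≤ _ := mul_le_mul_of_nonneg_right (hmax x (hmem x h1 hx.2)) (norm_nonneg _)
    have h4 : A / μ * v₀ * (M ^ 2 / 4) * (s / 2) ≤ A / μ * v₀ * (M ^ 2 / 4) * (x + 1) :=
      mul_le_mul_of_nonneg_left (by linarith [hx.1]) (by positivity)
    have h5 : M * (A / μ * v₀ * (M / 8) * s) ≤ M * ‖P₁ x‖ := by nlinarith
    gcongr
    exact le_of_mul_le_mul_left h5 hMpos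
  -- This lower bound is quadratic in `A`, whereas the upper bound `hEle` does not involve `A`; both
  -- scale like `M²`.
  have hEge : s / 2 * (A / μ * v₀ * (M / 8) * s) ^ 2 ≤ E := by
    have hm1 : -1 + s / 2 ∈ Icc (-1 : ℝ) 1 := hmem _ (by linarith) (by linarith)
    have hm2 : -1 + s ∈ Icc (-1 : ℝ) 1 := hmem _ (by linarith) (by linarith)
    have hi : IntervalIntegrable (fun x => ‖P₁ x‖ ^ 2) volume (-1) 1 :=
      (hP.cont₁.norm.pow 2).intervalIntegrable_Icc
    refine le_trans ?_ (IsPrim.mono_integral hi (fun _ _ => by positivity) hm1 hm2 (by linarith))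
    have := intervalIntegral.integral_mono_on (by linarith)
      (intervalIntegrable_const (c := (A / μ * v₀ * (M / 8) * s) ^ 2)) (hi.sub_Icc hm1 hm2) hP1
    rw [intervalIntegral.integral_const, smul_eq_mul] at this
    refine le_trans (le_of_eq ?_) this
    ring
  have h1 := mul_le_mul_of_nonneg_left hEge hμ.le
  have h2 := h1.trans hEle
  have h3 : M ^ 2 * (A ^ 2 * (v₀ ^ 2 * s ^ 3)) ≤ M ^ 2 * (256 * γL * μ) := by
    have : μ * (s / 2 * (A / μ * v₀ * (M / 8) * s) ^ 2) =
        M ^ 2 * (A ^ 2 * (v₀ ^ 2 * s ^ 3)) / (128 * μ) := by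
      field_simp
      ring
    rw [this, div_le_iff₀ (by positivity)] at h2
    linarith
  exact le_of_mul_le_mul_left h3 (by positivity)

theorem nonexistence_strong_shear {μ γN γL : ℝ} (hμ : 0 < μ) (hγN : 0 < γN) (hγL : 0 < γL)
    {V : ℝ → ℝ} (hV : IsShearProfile V) :
    ∃ A₁ : ℝ, 0 < A₁ ∧ ∀ A : ℝ, A₁ ≤ A →
      ¬ ∃ R θ : ℝ → ℝ, IsSteadyState μ γN γL A V (polar R θ) ∧
        (∃ x ∈ Icc (-1 : ℝ) 1, R x ≠ 0) ∧
        (∀ x ∈ Icc (-1 : ℝ) 1, 0 ≤ R x) ∧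
        (∀ x ∈ Icc (-1 : ℝ) 1, R (-x) = R x) ∧
        AntitoneOn R (Ioo (-1) 0) ∧ MonotoneOn R (Ioo 0 1) := by
  obtain ⟨η, v₀, hη, hη1, hv₀, hVi⟩ := hV.exists_neg_near_left
  set k := v₀ ^ 2 * min η (μ / (8 * γL)) ^ 3 with hk
  have hkpos : 0 < k := by
    have : 0 < min η (μ / (8 * γL)) := lt_min hη (by positivity)
    positivity
  -- With `q = 256 γL μ / k`, the bound to be obtained is `A² ≤ q`, which is impossible for `A ≥ 1 +
  -- q`.
  refine ⟨1 + 256 * γL * μ / k, by positivity, fun A hA => ?_⟩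
  rintro ⟨R, θ, hP, ⟨x₀, hx₀, hR0⟩, hRnn, hReven, hanti, -⟩
  have hq : 0 < 256 * γL * μ / k := by positivity
  have hcont : ContinuousOn R (Icc (-1) 1) := by
    obtain ⟨P₁, P₂, h, -⟩ := hP
    exact h.cont.norm.congr fun x hx => (norm_polar (hRnn x hx)).symm
  -- Monotonicity is given on the open interval only; continuity carries the comparison to `-1` and
  -- to `0`.
  have hleft : ∀ x ∈ Icc (-1 : ℝ) 0, R x ≤ R (-1) := by
    have hopen : ∀ x ∈ Ioo (-1 : ℝ) 0, R x ≤ R (-1) := by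
      intro x hx
      have ht : Tendsto R (𝓝[Ioo (-1) x] (-1)) (𝓝 (R (-1))) :=
        (hcont (-1) neg_one_mem_Icc').mono fun y hy => ⟨hy.1.le, by linarith [hy.2, hx.2]⟩
      have : (𝓝[Ioo (-1) x] (-1 : ℝ)).NeBot := by
        rw [nhdsWithin_Ioo_eq_nhdsGT hx.1]; infer_instance
      refine ge_of_tendsto ht ?_
      filter_upwards [self_mem_nhdsWithin] with y hy
      exact hanti ⟨hy.1, hy.2.trans hx.2⟩ hx hy.2.le
    intro x hx
    have ht : Tendsto R (𝓝[Ioo (-1) 0] x) (𝓝 (R x)) :=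
      (hcont x ⟨hx.1, by linarith [hx.2]⟩).mono fun y hy => ⟨hy.1.le, by linarith [hy.2]⟩
    have : (𝓝[Ioo (-1) 0] x).NeBot := by
      rw [← mem_closure_iff_nhdsWithin_neBot, closure_Ioo (by norm_num)]
      exact hx
    refine le_of_tendsto ht ?_
    filter_upwards [self_mem_nhdsWithin] with y hy using hopen y hy
  have hmax : ∀ x ∈ Icc (-1 : ℝ) 1, R x ≤ R (-1) := by
    intro x hx
    rcases le_total x 0 with h | h
    · exact hleft x ⟨hx.1, h⟩
    · rw [← hReven x hx]
      exact hleft _ ⟨by linarith [hx.2], by linarith⟩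
  have hR1 : 0 < R (-1) := lt_of_lt_of_le (lt_of_le_of_ne (hRnn _ hx₀) hR0.symm) (hmax _ hx₀)
  have hb := strong_shear_bound hμ hγN hγL hη hη1 hv₀ hVi (by linarith) hP (fun x hx => by
    rw [norm_polar (hRnn x hx), norm_polar hR1.le]; exact hmax x hx) (by
    rw [← norm_pos_iff, norm_polar hR1.le]; exact hR1)
  rw [← hk] at hb
  have h1 : A ^ 2 ≤ 256 * γL * μ / k := (le_div_iff₀ hkpos).2 hb
  nlinarith

/-! ### The Neumann problem as an integral equation -/

section dint
variable {E : Type*} [NormedAddCommGroup E] [NormedSpace ℝ E]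

/-- The double primitive of `h`, normalized so that its value at `-1` is `∫ h`. -/
noncomputable def dint (h : ℝ → E) (x : ℝ) : E :=
  (∫ s in (-1 : ℝ)..x, ∫ t in (-1 : ℝ)..s, h t) + ∫ t in (-1 : ℝ)..1, h t

variable {h h' f f₁ f₂ : ℝ → E}

lemma dint_left : dint h (-1) = ∫ t in (-1 : ℝ)..1, h t := by simp [dint]

lemma dint_congr (hh : h =ᵐ[volΩ] h') {x : ℝ} (hx : x ∈ Icc (-1 : ℝ) 1) : dint h x = dint h' x := by
  rw [dint, dint, integral_congr_Icc (fun s hs => integral_congr_volΩ hh hs) hx,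
    integral_congr_volΩ hh one_mem_Icc']

lemma continuousOn_primitive (hh : IntervalIntegrable h volume (-1) 1) :
    ContinuousOn (fun s => ∫ t in (-1 : ℝ)..s, h t) (Icc (-1) 1) :=
  (IsPrim.of_integral hh).continuousOn

lemma isPrim_dint (hh : IntervalIntegrable h volume (-1) 1) :
    IsPrim (dint h) (fun s => ∫ t in (-1 : ℝ)..s, h t) :=
  ⟨(continuousOn_primitive hh).intervalIntegrable_Icc, fun x _ => by
    rw [dint_left, dint, add_comm]⟩

lemma norm_primitive_le (hh : IntervalIntegrable h volume (-1) 1) {s : ℝ}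
    (hs : s ∈ Icc (-1 : ℝ) 1) :
    ‖∫ t in (-1 : ℝ)..s, h t‖ ≤ ∫ t in (-1 : ℝ)..1, ‖h t‖ :=
  (intervalIntegral.norm_integral_le_integral_norm hs.1).trans
    (IsPrim.mono_integral hh.norm (fun _ _ => norm_nonneg _) neg_one_mem_Icc' hs hs.1)

lemma norm_dint_sub_le (hh : IntervalIntegrable h volume (-1) 1) {x y : ℝ}
    (hx : x ∈ Icc (-1 : ℝ) 1) (hy : y ∈ Icc (-1 : ℝ) 1) :
    ‖dint h y - dint h x‖ ≤ (∫ t in (-1 : ℝ)..1, ‖h t‖) * |y - x| :=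
  (isPrim_dint hh).norm_sub_le (ae_of_forall_Icc fun _ hs => norm_primitive_le hh hs) hx hy

/-- The `3` is the length `2` of the interval, for the variation from `-1`, plus `1` for the value
at `-1`. -/
lemma norm_dint_le (hh : IntervalIntegrable h volume (-1) 1) {x : ℝ} (hx : x ∈ Icc (-1 : ℝ) 1) :
    ‖dint h x‖ ≤ 3 * ∫ t in (-1 : ℝ)..1, ‖h t‖ := by
  have h1 := norm_dint_sub_le hh neg_one_mem_Icc' hx
  have h2 := norm_primitive_le hh one_mem_Icc'
  rw [← dint_left] at h2
  have h3 := norm_le_norm_add_norm_sub' (dint h x) (dint h (-1))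
  have h4 : 0 ≤ ∫ t in (-1 : ℝ)..1, ‖h t‖ :=
    intervalIntegral.integral_nonneg (by norm_num) fun _ _ => norm_nonneg _
  have h5 : |x - -1| ≤ 2 := by
    rw [abs_of_nonneg (by linarith [hx.1])]; linarith [hx.2]
  nlinarith

lemma dint_add (hh : IntervalIntegrable h volume (-1) 1)
    (hh' : IntervalIntegrable h' volume (-1) 1) {x : ℝ} (hx : x ∈ Icc (-1 : ℝ) 1) :
    dint (fun t => h t + h' t) x = dint h x + dint h' x := by
  have h1 : ∀ s ∈ Icc (-1 : ℝ) 1, ∫ t in (-1 : ℝ)..s, (h t + h' t) =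
      (∫ t in (-1 : ℝ)..s, h t) + ∫ t in (-1 : ℝ)..s, h' t := fun s hs =>
    intervalIntegral.integral_add (hh.sub_Icc neg_one_mem_Icc' hs)
      (hh'.sub_Icc neg_one_mem_Icc' hs)
  rw [dint, dint, dint, integral_congr_Icc h1 hx, h1 1 one_mem_Icc', intervalIntegral.integral_add]
  · abel
  · exact (continuousOn_primitive hh).intervalIntegrable_Icc.sub_Icc neg_one_mem_Icc' hx
  · exact (continuousOn_primitive hh').intervalIntegrable_Icc.sub_Icc neg_one_mem_Icc' hx

lemma dint_const_mul {𝕜 : Type*} [RCLike 𝕜] (c : 𝕜) (h : ℝ → 𝕜) (x : ℝ) :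
    dint (fun t => c * h t) x = c * dint h x := by
  simp only [dint, intervalIntegral.integral_const_mul, mul_add]

lemma dint_sub (hh : IntervalIntegrable h volume (-1) 1)
    (hh' : IntervalIntegrable h' volume (-1) 1) {x : ℝ} (hx : x ∈ Icc (-1 : ℝ) 1) :
    dint (fun t => h t - h' t) x = dint h x - dint h' x := by
  have : dint (fun t => h t + -h' t) x = dint h x + dint (fun t => -h' t) x :=
    dint_add hh hh'.neg hx
  have h2 : dint (fun t => -h' t) x = -dint h' x := by
    simp only [dint, intervalIntegral.integral_neg, neg_add]
  rw [sub_eq_add_neg, ← h2, ← this]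
  simp only [sub_eq_add_neg]

lemma H2NeumannWith.eq_dint [CompleteSpace E] (hf : H2NeumannWith f f₁ f₂) {x : ℝ}
    (hx : x ∈ Icc (-1 : ℝ) 1) : f x = f (-1) + dint f₂ x := by
  rw [dint, hf.integral_eq_zero, add_zero, hf.prim.eq x hx]
  congr 1
  refine integral_congr_Icc (fun s hs => ?_) hx
  rw [hf.deriv_eq s hs, hf.left, zero_add]

/-- At `x = -1` the equation says `∫ h = 0`, which is the Neumann condition at `1`; the one at `-1`
is built into the primitive. Thanks to this normalization a single fixed-point equation contains the
differential equation and both boundary conditions. -/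
lemma H2NeumannWith.of_dint [CompleteSpace E] (hm : MemLp h 2 volΩ)
    (hf : ∀ x ∈ Icc (-1 : ℝ) 1, f x = f (-1) + dint h x) :
    H2NeumannWith f (fun s => ∫ t in (-1 : ℝ)..s, h t) h := by
  have hi : IntervalIntegrable h volume (-1) 1 :=
    intervalIntegrable_iff_integrable.2 (hm.integrable (by norm_num))
  have h1 := hf (-1) neg_one_mem_Icc'
  rw [dint_left, left_eq_add] at h1
  exact of_prim (((isPrim_dint hi).const_add (f (-1))).congr hf (ae_eq_refl _))
    (IsPrim.of_integral hi) hm (by simp) h1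

end dint

/-! ### Integral operators on continuous functions -/

section ops
variable {𝕜 : Type*} [RCLike 𝕜]

/-- Continuous functions on `[-1, 1]`. -/
abbrev CI (𝕜 : Type*) [RCLike 𝕜] := C(Icc (-1 : ℝ) 1, 𝕜)

/-- The extension of a continuous function on `[-1, 1]` to the line. -/
noncomputable def CI.ext (f : CI 𝕜) : ℝ → 𝕜 :=
  IccExtend (show (-1 : ℝ) ≤ 1 by norm_num) f

/-- The restriction to `[-1, 1]` of a function that is continuous there. -/
def CI.mk (f : ℝ → 𝕜) (hf : ContinuousOn f (Icc (-1) 1)) : CI 𝕜 :=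
  ⟨(Icc (-1) 1).domRestrict f, continuousOn_iff_continuous_domRestrict.1 hf⟩

@[simp] lemma CI.mk_apply (f : ℝ → 𝕜) (hf : ContinuousOn f (Icc (-1) 1)) (x : Icc (-1 : ℝ) 1) :
    CI.mk f hf x = f x := rfl

lemma CI.ext_of_mem (f : CI 𝕜) {x : ℝ} (hx : x ∈ Icc (-1 : ℝ) 1) : f.ext x = f ⟨x, hx⟩ :=
  IccExtend_of_mem _ _ hx

@[simp] lemma CI.ext_coe (f : CI 𝕜) (x : Icc (-1 : ℝ) 1) : f.ext x = f x := f.ext_of_mem x.2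

lemma CI.ext_mk {f : ℝ → 𝕜} (hf : ContinuousOn f (Icc (-1) 1)) {x : ℝ}
    (hx : x ∈ Icc (-1 : ℝ) 1) : (CI.mk f hf).ext x = f x := by
  rw [CI.ext_of_mem _ hx, CI.mk_apply]

lemma CI.continuous_ext (f : CI 𝕜) : Continuous f.ext := f.continuous.Icc_extend'

lemma CI.norm_ext_le (f : CI 𝕜) (x : ℝ) : ‖f.ext x‖ ≤ ‖f‖ := f.norm_coe_le_norm _

lemma CI.norm_le_of_forall {f : CI 𝕜} {C : ℝ} (hC : 0 ≤ C)
    (h : ∀ x ∈ Icc (-1 : ℝ) 1, ‖f.ext x‖ ≤ C) : ‖f‖ ≤ C :=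
  (ContinuousMap.norm_le _ hC).2 fun x => by simpa using h x x.2

lemma MemLp.mul_CI {b : ℝ → 𝕜} (hb : MemLp b ⊤ volΩ) (f : CI 𝕜) :
    IntervalIntegrable (fun t => b t * f.ext t) volume (-1) 1 :=
  (intervalIntegrable_iff_integrable.2 (hb.integrable le_top)).mul_continuousOn
    f.continuous_ext.continuousOn

lemma MemLp.exists_bound {b : ℝ → 𝕜} (hb : MemLp b ⊤ volΩ) :
    ∃ C, 0 ≤ C ∧ ∀ᵐ x ∂volΩ, ‖b x‖ ≤ C := by
  refine ⟨(eLpNormEssSup b volΩ).toReal, ENNReal.toReal_nonneg, ?_⟩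
  have h := hb.eLpNorm_lt_top
  rw [eLpNorm_exponent_top] at h
  filter_upwards [enorm_ae_le_eLpNormEssSup b volΩ] with x hx
  have := ENNReal.toReal_mono h.ne hx
  simpa using this

lemma integral_norm_mul_CI_le {b : ℝ → 𝕜} {C : ℝ}
    (hC : ∀ᵐ x ∂volΩ, ‖b x‖ ≤ C) (f : CI 𝕜) :
    ∫ t in (-1 : ℝ)..1, ‖b t * f.ext t‖ ≤ 2 * C * ‖f‖ := by
  have h : ‖∫ t in (-1 : ℝ)..1, ‖b t * f.ext t‖‖ ≤ C * ‖f‖ * |1 - (-1)| := by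
    refine intervalIntegral.norm_integral_le_of_norm_le_const_ae ?_
    filter_upwards [ae_uIoc_of_ae hC one_mem_Icc'] with t ht h't
    rw [norm_norm, norm_mul]
    exact mul_le_mul (ht h't) (f.norm_ext_le t) (norm_nonneg _) ((norm_nonneg _).trans (ht h't))
  refine (Real.le_norm_self _).trans (h.trans (le_of_eq ?_))
  norm_num
  ring

open Classical in
/-- The operator `f ↦ dint (b f)` on continuous functions, for an essentially bounded `b`. -/
noncomputable def dop (b : ℝ → 𝕜) : CI 𝕜 →L[𝕜] CI 𝕜 :=
  if hb : MemLp b ⊤ volΩ then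
    LinearMap.mkContinuousOfExistsBound
      { toFun := fun f => CI.mk (dint fun t => b t * f.ext t) (isPrim_dint (MemLp.mul_CI hb f)).continuousOn
        map_add' := fun f g => by
          ext x
          have := dint_add (MemLp.mul_CI hb f) (MemLp.mul_CI hb g) x.2
          simp only [CI.mk_apply, ContinuousMap.add_apply, ← this, ← mul_add]
          rfl
        map_smul' := fun c f => by
          ext x
          simp only [CI.mk_apply, ContinuousMap.smul_apply, RingHom.id_apply, smul_eq_mul,
            ← dint_const_mul, mul_left_comm c]
          rfl }
      (by
        obtain ⟨C, hC0, hC⟩ := MemLp.exists_bound hb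
        refine ⟨3 * (2 * C), fun f => ?_⟩
        refine CI.norm_le_of_forall (by positivity) fun x hx => ?_
        rw [CI.ext_of_mem _ hx]
        refine (norm_dint_le (MemLp.mul_CI hb f) hx).trans ?_
        rw [mul_assoc 3]
        exact mul_le_mul_of_nonneg_left (integral_norm_mul_CI_le hC f) (by norm_num))
  else 0

lemma dop_apply {b : ℝ → 𝕜} (hb : MemLp b ⊤ volΩ) (f : CI 𝕜) {x : ℝ} (hx : x ∈ Icc (-1 : ℝ) 1) :
    (dop b f).ext x = dint (fun t => b t * f.ext t) x := by
  rw [dop, dif_pos hb, CI.ext_of_mem _ hx]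
  rfl

lemma CI.ext_inj {f g : CI 𝕜} (h : ∀ x ∈ Icc (-1 : ℝ) 1, f.ext x = g.ext x) : f = g := by
  refine ContinuousMap.ext fun x => ?_
  simpa using h x x.2

/-- The `6` is the `3` of `norm_dint_le` times the length of the interval. -/
lemma norm_dop_apply_le {b : ℝ → 𝕜} (hb : MemLp b ⊤ volΩ) {C : ℝ}
    (hC : ∀ᵐ x ∂volΩ, ‖b x‖ ≤ C) (hC0 : 0 ≤ C) (f : CI 𝕜) : ‖dop b f‖ ≤ 6 * C * ‖f‖ := by
  refine CI.norm_le_of_forall (by positivity) fun x hx => ?_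
  rw [dop_apply hb f hx]
  refine (norm_dint_le (MemLp.mul_CI hb f) hx).trans ?_
  linarith [integral_norm_mul_CI_le hC f]

lemma dop_sub {b b' : ℝ → 𝕜} (hb : MemLp b ⊤ volΩ) (hb' : MemLp b' ⊤ volΩ) :
    dop b - dop b' = dop (fun x => b x - b' x) := by
  refine ContinuousLinearMap.ext fun f => CI.ext_inj fun x hx => ?_
  have h1 : (dop b f - dop b' f).ext x = (dop b f).ext x - (dop b' f).ext x := rfl
  rw [sub_apply, h1, dop_apply hb f hx, dop_apply hb' f hx,
    dop_apply (b := fun x => b x - b' x) (hb.sub hb') f hx, ← dint_sub (MemLp.mul_CI hb f) (MemLp.mul_CI hb' f) hx]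
  simp only [sub_mul]

lemma smul_dop {b : ℝ → 𝕜} (hb : MemLp b ⊤ volΩ) (c : 𝕜) :
    c • dop b = dop (fun x => c * b x) := by
  refine ContinuousLinearMap.ext fun f => CI.ext_inj fun x hx => ?_
  have h1 : (c • dop b f).ext x = c * (dop b f).ext x := rfl
  rw [smul_apply, h1, dop_apply hb f hx, dop_apply (hb.const_mul c) f hx,
    ← dint_const_mul]
  simp only [mul_assoc]

lemma norm_dop_sub_le {b b' : ℝ → 𝕜} (hb : MemLp b ⊤ volΩ) (hb' : MemLp b' ⊤ volΩ) {ε : ℝ}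
    (hε : 0 ≤ ε) (h : ∀ᵐ x ∂volΩ, ‖b x - b' x‖ ≤ ε) : ‖dop b - dop b'‖ ≤ 6 * ε := by
  refine ContinuousLinearMap.opNorm_le_bound _ (by positivity) fun f => ?_
  rw [dop_sub hb hb']
  exact norm_dop_apply_le (hb.sub hb') h hε f

/-- Bounded sets of uniformly Lipschitz functions are compact. -/
lemma isCompact_lipschitz (M : ℝ) : IsCompact {f : CI 𝕜 | ‖f‖ ≤ M ∧
    ∀ x ∈ Icc (-1 : ℝ) 1, ∀ y ∈ Icc (-1 : ℝ) 1, ‖f.ext y - f.ext x‖ ≤ M * |y - x|} := by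
  let e := ContinuousMap.isometryEquivBoundedOfCompact (Icc (-1 : ℝ) 1) 𝕜
  have hcl : IsClosed {f : CI 𝕜 | ‖f‖ ≤ M ∧
      ∀ x ∈ Icc (-1 : ℝ) 1, ∀ y ∈ Icc (-1 : ℝ) 1, ‖f.ext y - f.ext x‖ ≤ M * |y - x|} := by
    have hev : ∀ x, Continuous fun f : CI 𝕜 => f.ext x := fun x =>
      ContinuousEvalConst.continuous_eval_const _
    refine (isClosed_le continuous_norm continuous_const).inter ?_
    change IsClosed {f : CI 𝕜 |
      ∀ x ∈ Icc (-1 : ℝ) 1, ∀ y ∈ Icc (-1 : ℝ) 1, ‖f.ext y - f.ext x‖ ≤ M * |y - x|}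
    simp only [ofPred_forall]
    exact isClosed_iInter fun x => isClosed_iInter fun _ => isClosed_iInter fun y =>
      isClosed_iInter fun _ => isClosed_le ((hev y).sub (hev x)).norm continuous_const
  rw [← e.symm.toHomeomorph.isCompact_preimage]
  refine BoundedContinuousFunction.arzela_ascoli₂ (Metric.closedBall (0 : 𝕜) M)
    (isCompact_closedBall 0 M) _ (hcl.preimage e.symm.continuous) ?_ ?_
  · intro f x hf
    rw [mem_closedBall_zero_iff]
    exact ((e.symm f).norm_coe_le_norm x).trans hf.1
  · refine Metric.equicontinuous_of_continuity_modulus (fun r => M * r) ?_ _ ?_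
    · have : Continuous fun r : ℝ => M * r := by fun_prop
      simpa using this.tendsto 0
    · rintro x y ⟨f, hf⟩
      have := hf.2 y y.2 x x.2
      simp only [CI.ext_coe] at this
      rw [dist_eq_norm]
      exact this

lemma isCompactOperator_dop (b : ℝ → 𝕜) : IsCompactOperator (dop b) := by
  by_cases hb : MemLp b ⊤ volΩ
  swap
  -- The default value `0` of `dop` is compact as well, so no hypothesis on `b` is needed.
  · rw [dop, dif_neg hb]
    exact isCompactOperator_zero
  obtain ⟨C, hC0, hC⟩ := MemLp.exists_bound hb
  refine (isCompactOperator_iff_image_closedBall_subset_compact (dop b : CI 𝕜 →ₗ[𝕜] CI 𝕜)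
    one_pos).2 ⟨_, isCompact_lipschitz (6 * C), ?_⟩
  rintro _ ⟨f, hf, rfl⟩
  rw [mem_closedBall_zero_iff] at hf
  refine ⟨(norm_dop_apply_le hb hC hC0 f).trans (mul_le_of_le_one_right (by positivity) hf),
    fun x hx y hy => ?_⟩
  have h1 : ((dop b : CI 𝕜 →ₗ[𝕜] CI 𝕜) f) = dop b f := rfl
  rw [h1, dop_apply hb f hx, dop_apply hb f hy]
  refine (norm_dint_sub_le (MemLp.mul_CI hb f) hx hy).trans ?_
  refine mul_le_mul_of_nonneg_right ((integral_norm_mul_CI_le hC f).trans ?_) (abs_nonneg _)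
  nlinarith

/-- The operator mapping `f` to the constant `f (-1)`. -/
noncomputable def leftConst (𝕜 : Type*) [RCLike 𝕜] : CI 𝕜 →L[𝕜] CI 𝕜 :=
  (ContinuousLinearMap.const 𝕜 (Icc (-1 : ℝ) 1)).comp
    (ContinuousMap.evalCLM 𝕜 (⟨-1, neg_one_mem_Icc'⟩ : Icc (-1 : ℝ) 1))

lemma leftConst_apply (f : CI 𝕜) (x : ℝ) : (leftConst 𝕜 f).ext x = f.ext (-1) := by
  rw [CI.ext_of_mem f neg_one_mem_Icc']
  rfl

lemma isCompactOperator_leftConst : IsCompactOperator (leftConst 𝕜) := by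
  have h : IsCompactOperator (ContinuousMap.evalCLM 𝕜 (⟨-1, neg_one_mem_Icc'⟩ : Icc (-1 : ℝ) 1) :
      CI 𝕜 →L[𝕜] 𝕜) := isCompactOperator_of_locallyCompactSpace_dom _
  exact h.clm_comp (ContinuousLinearMap.const 𝕜 (Icc (-1 : ℝ) 1))

/-- Fredholm alternative for `1 - K`. -/
lemma isUnit_one_sub_of_compact {X : Type*} [NormedAddCommGroup X] [NormedSpace 𝕜 X]
    [CompleteSpace X] {K : X →L[𝕜] X} (hK : IsCompactOperator K) (h : ∀ f, K f = f → f = 0) :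
    IsUnit (1 - K) := by
  rcases hK.hasEigenvalue_or_mem_resolventSet (one_ne_zero (α := 𝕜)) with h1 | h1
  · obtain ⟨f, hf⟩ := h1.exists_hasEigenvector
    exact absurd (h f (by simpa using hf.apply_eq_smul)) hf.2
  · simpa using spectrum.mem_resolventSet_iff.1 h1

end ops

/-! ### The first eigenvalue of a scalar Neumann problem -/

section scalar

lemma MemLp.mul_continuousOn_volΩ {𝕜 : Type*} [RCLike 𝕜] {b f : ℝ → 𝕜} (hb : MemLp b ⊤ volΩ)
    (hf : ContinuousOn f (Icc (-1) 1)) : MemLp (fun x => b x * f x) ⊤ volΩ := by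
  obtain ⟨C, hC0, hC⟩ := MemLp.exists_bound hb
  obtain ⟨C', hC0', hC'⟩ := hf.exists_bound_Icc
  refine MemLp.of_bound (hb.1.mul hf.aestronglyMeasurable_volΩ) (C * C') ?_
  filter_upwards [hC, ae_of_forall_Icc hC'] with x h1 h2
  rw [norm_mul]
  exact mul_le_mul h1 h2 (norm_nonneg _) hC0

lemma MemLp.two_of_top {E : Type*} [NormedAddCommGroup E] {f : ℝ → E} (h : MemLp f ⊤ volΩ) :
    MemLp f 2 volΩ := h.mono_exponent le_top

variable {μ : ℝ} {q : ℝ → ℝ}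

lemma continuousOn_coeff (hq : ContinuousOn q (Icc (-1) 1)) (Λ : ℝ) :
    ContinuousOn (fun x => (((Λ - q x) / μ : ℝ) : ℂ)) (Icc (-1) 1) :=
  Complex.continuous_ofReal.comp_continuousOn ((continuousOn_const.sub hq).div_const μ)

/-- The fixed points of `leftConst + dop b` solve the Neumann problem for `f'' = b f`. -/
lemma neumann_of_fixed {𝕜 : Type*} [RCLike 𝕜] {b : ℝ → 𝕜} (hb : MemLp b ⊤ volΩ) {f h : CI 𝕜}
    {k : ℝ → 𝕜} (hk : MemLp k ⊤ volΩ) (hh : ∀ x ∈ Icc (-1 : ℝ) 1, h.ext x = dint k x)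
    (hf : f = (leftConst 𝕜 + dop b) f + h) :
    H2NeumannWith f.ext (fun s => ∫ t in (-1 : ℝ)..s, (b t * f.ext t + k t))
      (fun x => b x * f.ext x + k x) := by
  have hbf := MemLp.mul_continuousOn_volΩ hb f.continuous_ext.continuousOn
  refine H2NeumannWith.of_dint (MemLp.two_of_top (hbf.add hk)) fun x hx => ?_
  have h1 : ((leftConst 𝕜 + dop b) f + h).ext x =
    ((leftConst 𝕜 f).ext x + (dop b f).ext x) + h.ext x := rfl
  conv_lhs => rw [hf]
  rw [h1, leftConst_apply, dop_apply hb f hx, hh x hx, add_assoc, ← dint_add (MemLp.mul_CI hb f)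
    (intervalIntegrable_iff_integrable.2 (hk.integrable le_top)) hx]

lemma integral_sq_le_of_bound {w g : ℝ → ℂ} (hw : ContinuousOn w (Icc (-1) 1))
    (hg : ContinuousOn g (Icc (-1) 1)) {C : ℝ} (hC : ∀ x ∈ Icc (-1 : ℝ) 1, ‖w x‖ ≤ C) :
    ∫ x in (-1 : ℝ)..1, (w x * conj (g x)).re ≤ C * ∫ x in (-1 : ℝ)..1, ‖g x‖ := by
  rw [← intervalIntegral.integral_const_mul]
  refine intervalIntegral.integral_mono_on (by norm_num) ?_ ?_ fun x hx => ?_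
  · exact ContinuousOn.intervalIntegrable_Icc (Complex.continuous_re.comp_continuousOn
      (hw.mul (Complex.continuous_conj.comp_continuousOn hg)))
  · exact (hg.norm.intervalIntegrable_Icc).const_mul C
  · refine (Complex.re_le_norm _).trans ?_
    rw [norm_mul, RCLike.norm_conj]
    exact mul_le_mul_of_nonneg_right (hC x hx) (norm_nonneg _)

/-- The quadratic form of `Λ - (μ ∂² + q)`. -/
noncomputable def shiftedForm (μ : ℝ) (q : ℝ → ℝ) (Λ : ℝ) (g g₁ w w₁ : ℝ → ℂ) : ℝ :=
  ∫ x in (-1 : ℝ)..1, ((Λ - q x) * (g x * conj (w x)).re + μ * (g₁ x * conj (w₁ x)).re)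

variable {g g₁ g₂ w w₁ w₂ : ℝ → ℂ}

lemma shiftedForm_continuousOn (hq : ContinuousOn q (Icc (-1) 1)) (Λ : ℝ)
    (hg : H2NeumannWith g g₁ g₂) (hw : H2NeumannWith w w₁ w₂) :
    ContinuousOn (fun x => (Λ - q x) * (g x * conj (w x)).re + μ * (g₁ x * conj (w₁ x)).re)
      (Icc (-1) 1) := by
  have h1 := hg.cont
  have h2 := hg.cont₁
  have h3 := hw.cont
  have h4 := hw.cont₁
  have h5 : ContinuousOn (fun x => (g x * conj (w x)).re) (Icc (-1) 1) :=
    Complex.continuous_re.comp_continuousOn (h1.mul (Complex.continuous_conj.comp_continuousOn h3))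
  have h6 : ContinuousOn (fun x => (g₁ x * conj (w₁ x)).re) (Icc (-1) 1) :=
    Complex.continuous_re.comp_continuousOn (h2.mul (Complex.continuous_conj.comp_continuousOn h4))
  fun_prop

lemma shiftedForm_self (hq : ContinuousOn q (Icc (-1) 1)) (Λ : ℝ) (hg : H2NeumannWith g g₁ g₂) :
    shiftedForm μ q Λ g g₁ g g₁ =
      Λ * (∫ x in (-1 : ℝ)..1, ‖g x‖ ^ 2) -
        ∫ x in (-1 : ℝ)..1, (q x * ‖g x‖ ^ 2 - μ * ‖g₁ x‖ ^ 2) := by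
  have h1 := hg.cont
  have h2 := hg.cont₁
  rw [shiftedForm, ← intervalIntegral.integral_const_mul, ← intervalIntegral.integral_sub]
  · refine intervalIntegral.integral_congr fun x _ => ?_
    simp only [Complex.mul_conj', ← Complex.ofReal_pow, Complex.ofReal_re]
    ring
  · exact ContinuousOn.intervalIntegrable_Icc (by fun_prop)
  · exact ContinuousOn.intervalIntegrable_Icc (by fun_prop)

lemma shiftedForm_add_smul (hq : ContinuousOn q (Icc (-1) 1)) (Λ t : ℝ)
    (hg : H2NeumannWith g g₁ g₂) (hw : H2NeumannWith w w₁ w₂) :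
    shiftedForm μ q Λ (fun x => g x + t * w x) (fun x => g₁ x + t * w₁ x)
      (fun x => g x + t * w x) (fun x => g₁ x + t * w₁ x) =
      shiftedForm μ q Λ w w₁ w w₁ * (t * t) + 2 * shiftedForm μ q Λ g g₁ w w₁ * t +
        shiftedForm μ q Λ g g₁ g g₁ := by
  have hww := (shiftedForm_continuousOn (μ := μ) hq Λ hw hw).intervalIntegrable_Icc
  have hgw := (shiftedForm_continuousOn (μ := μ) hq Λ hg hw).intervalIntegrable_Icc
  have hgg := (shiftedForm_continuousOn (μ := μ) hq Λ hg hg).intervalIntegrable_Icc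
  simp only [shiftedForm, ← intervalIntegral.integral_const_mul,
    ← intervalIntegral.integral_mul_const]
  rw [← intervalIntegral.integral_add (hww.mul_const _) ((hgw.const_mul _).mul_const _),
    ← intervalIntegral.integral_add ((hww.mul_const _).add ((hgw.const_mul _).mul_const _)) hgg]
  refine intervalIntegral.integral_congr fun x _ => ?_
  simp only [Complex.mul_re, Complex.add_re, Complex.add_im, Complex.mul_im, Complex.conj_re,
    Complex.conj_im, Complex.ofReal_re, Complex.ofReal_im]
  ring

/-- The weak form of `(Λ - (μ ∂² + q)) w = k` tested with `g`; the Neumann conditions on `w` remove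
the boundary terms. -/
lemma shiftedForm_eq_of_solves (hq : ContinuousOn q (Icc (-1) 1)) (Λ : ℝ) {k : ℝ → ℂ}
    (hg : H2NeumannWith g g₁ g₂) (hw : H2NeumannWith w w₁ w₂)
    (hk : ∀ᵐ x ∂volΩ, (μ : ℂ) * w₂ x = (Λ - q x : ℝ) * w x - k x) :
    shiftedForm μ q Λ g g₁ w w₁ = ∫ x in (-1 : ℝ)..1, (g x * conj (k x)).re := by
  have hp := (hg.prim.mul hw.prim₁.map_conj).re
  have h1 := hp.integral_eq
  simp only [hw.left, hw.right, map_zero, mul_zero, Complex.zero_re, sub_self] at h1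
  have hc := (shiftedForm_continuousOn (μ := μ) hq Λ hg hw).intervalIntegrable_Icc
  have h2 : ∫ x in (-1 : ℝ)..1, (g x * conj (k x)).re = ∫ x in (-1 : ℝ)..1,
      (((Λ - q x) * (g x * conj (w x)).re + μ * (g₁ x * conj (w₁ x)).re) -
        μ * (g₁ x * conj (w₁ x) + g x * conj (w₂ x)).re) := by
    refine integral_congr_volΩ ?_ one_mem_Icc'
    filter_upwards [hk] with x hx
    have h3 : k x = (Λ - q x : ℝ) * w x - μ * w₂ x := by rw [hx]; ring
    rw [h3]
    simp only [map_sub, map_mul, Complex.conj_ofReal, Complex.mul_re, Complex.add_re,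
      Complex.sub_re, Complex.sub_im, Complex.mul_im, Complex.ofReal_re, Complex.ofReal_im]
    ring
  rw [h2, intervalIntegral.integral_sub hc (hp.int.const_mul μ),
    intervalIntegral.integral_const_mul, h1, shiftedForm]
  ring

lemma integral_norm_le_of_sq_eq_one (hg : ContinuousOn g (Icc (-1) 1))
    (h1 : ∫ x in (-1 : ℝ)..1, ‖g x‖ ^ 2 = 1) : ∫ x in (-1 : ℝ)..1, ‖g x‖ ≤ 2 := by
  have h := sq_integral_le hg.norm neg_one_mem_Icc' one_mem_Icc' (by norm_num)
  rw [h1] at h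
  nlinarith

/-- The supremum of the Rayleigh quotient of `μ ∂² + q` is attained by an eigenfunction. -/
theorem exists_first_eigenvalue (hμ : 0 < μ) (hq : ContinuousOn q (Icc (-1) 1)) :
    ∃ Λ : ℝ, (∃ f f₁ f₂ : ℝ → ℂ, H2NeumannWith f f₁ f₂ ∧ (∃ x ∈ Icc (-1 : ℝ) 1, f x ≠ 0) ∧
        ∀ᵐ x ∂volΩ, (μ : ℂ) * f₂ x + (q x : ℂ) * f x = Λ * f x) ∧
      ∀ g g₁ g₂ : ℝ → ℂ, H2NeumannWith g g₁ g₂ →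
        ∫ x in (-1 : ℝ)..1, (q x * ‖g x‖ ^ 2 - μ * ‖g₁ x‖ ^ 2) ≤
          Λ * ∫ x in (-1 : ℝ)..1, ‖g x‖ ^ 2 := by
  obtain ⟨Q, hQ0, hQ⟩ := hq.exists_bound_Icc
  have hupper : ∀ g g₁ g₂ : ℝ → ℂ, H2NeumannWith g g₁ g₂ →
      ∫ x in (-1 : ℝ)..1, (q x * ‖g x‖ ^ 2 - μ * ‖g₁ x‖ ^ 2) ≤
        Q * ∫ x in (-1 : ℝ)..1, ‖g x‖ ^ 2 := by
    intro g g₁ g₂ hg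
    have h1 := hg.cont
    have h2 := hg.cont₁
    rw [← intervalIntegral.integral_const_mul]
    refine intervalIntegral.integral_mono_on (by norm_num)
      (ContinuousOn.intervalIntegrable_Icc (by fun_prop))
      (ContinuousOn.intervalIntegrable_Icc (by fun_prop)) fun x hx => ?_
    have h3 : q x ≤ Q := (le_abs_self _).trans (hQ x hx)
    nlinarith [mul_le_mul_of_nonneg_right h3 (sq_nonneg ‖g x‖), mul_nonneg hμ.le (sq_nonneg ‖g₁ x‖)]
  let S : Set ℝ := {r | ∃ g g₁ g₂ : ℝ → ℂ, H2NeumannWith g g₁ g₂ ∧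
    ∫ x in (-1 : ℝ)..1, ‖g x‖ ^ 2 = 1 ∧
    r = ∫ x in (-1 : ℝ)..1, (q x * ‖g x‖ ^ 2 - μ * ‖g₁ x‖ ^ 2)}
  have hSb : BddAbove S := by
    refine ⟨Q, ?_⟩
    rintro r ⟨g, g₁, g₂, hg, h1, rfl⟩
    simpa [h1] using hupper g g₁ g₂ hg
  have hSne : S.Nonempty := by
    refine ⟨_, fun _ => ((Real.sqrt (1 / 2) : ℝ) : ℂ), _, _, H2NeumannWith.const _, ?_, rfl⟩
    simp only [Complex.norm_real, Real.norm_eq_abs, sq_abs]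
    rw [Real.sq_sqrt (by norm_num)]
    norm_num
  set Λ := sSup S with hΛ
  have hform : ∀ g g₁ g₂ : ℝ → ℂ, H2NeumannWith g g₁ g₂ →
      ∫ x in (-1 : ℝ)..1, (q x * ‖g x‖ ^ 2 - μ * ‖g₁ x‖ ^ 2) ≤
        Λ * ∫ x in (-1 : ℝ)..1, ‖g x‖ ^ 2 := by
    intro g g₁ g₂ hg
    have hN0 : 0 ≤ ∫ x in (-1 : ℝ)..1, ‖g x‖ ^ 2 :=
      intervalIntegral.integral_nonneg (by norm_num) fun _ _ => by positivity
    set N := ∫ x in (-1 : ℝ)..1, ‖g x‖ ^ 2 with hN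
    rcases hN0.eq_or_lt with h0 | hpos
    · have := hupper g g₁ g₂ hg
      rw [← hN, ← h0, mul_zero] at this
      rwa [← h0, mul_zero]
    · set c : ℝ := (Real.sqrt N)⁻¹ with hc
      have hc2 : c ^ 2 = N⁻¹ := by rw [hc, inv_pow, Real.sq_sqrt hN0]
      have hn : ∀ z : ℂ, ‖(c : ℂ) * z‖ ^ 2 = N⁻¹ * ‖z‖ ^ 2 := fun z => by
        rw [norm_mul, mul_pow, Complex.norm_real, Real.norm_eq_abs, sq_abs, hc2]
      have hmem : N⁻¹ * ∫ x in (-1 : ℝ)..1, (q x * ‖g x‖ ^ 2 - μ * ‖g₁ x‖ ^ 2) ∈ S := by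
        refine ⟨_, _, _, hg.const_mul (c : ℂ), ?_, ?_⟩
        · simp only [hn, intervalIntegral.integral_const_mul]
          rw [← hN, inv_mul_cancel₀ hpos.ne']
        · rw [← intervalIntegral.integral_const_mul]
          refine intervalIntegral.integral_congr fun x _ => ?_
          simp only [hn]
          ring
      have h1 := le_csSup hSb hmem
      rw [inv_mul_le_iff₀ hpos] at h1
      linarith
  refine ⟨Λ, ?_, hform⟩
  -- If `Λ` is not an eigenvalue, the Fredholm alternative gives a bounded solution operator for the
  -- shifted problem, and this will keep all Rayleigh quotients a fixed distance below their
  -- supremum.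
  by_contra hne
  let b : ℝ → ℂ := fun x => (((Λ - q x) / μ : ℝ) : ℂ)
  have hb : MemLp b ⊤ volΩ := (continuousOn_coeff hq Λ).memLp_volΩ ⊤
  have hunit : IsUnit (1 - (leftConst ℂ + dop b)) := by
    refine isUnit_one_sub_of_compact (isCompactOperator_leftConst.add (isCompactOperator_dop b))
      fun f hf => ?_
    by_contra hf0
    apply hne
    have hH := neumann_of_fixed (k := fun _ => 0) (h := 0) hb MemLp.zero'
      (fun x hx => by simp [dint]; rfl) (f := f) (by rw [hf, add_zero])
    refine ⟨_, _, _, hH, ?_, ?_⟩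
    · by_contra! hz
      exact hf0 (CI.ext_inj fun x hx => by rw [hz x hx]; rfl)
    · refine ae_of_all _ fun x => ?_
      have hμ' : (μ : ℂ) ≠ 0 := by exact_mod_cast hμ.ne'
      simp only [b]
      push_cast
      field_simp
      ring
  obtain ⟨u, hu⟩ := hunit
  set C := ‖(↑u⁻¹ : CI ℂ →L[ℂ] CI ℂ)‖ * (3 * (2 / μ)) with hCdef
  have hC0 : 0 ≤ C := by positivity
  -- Let `f` solve `(Λ - (μ ∂² + q)) f = g`. The form takes the value `1` on `(g, f)`, at most `2 C`
  -- on `(f, f)` and `Λ - r` on `(g, g)`. It is nonnegative, so Cauchy–Schwarz, here as a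
  -- discriminant bound, gives the claim.
  have hkey : ∀ r ∈ S, 1 ≤ (Λ - r) * (C * 2) := by
    rintro r ⟨g, g₁, g₂, hg, h1, rfl⟩
    have hg1 := integral_norm_le_of_sq_eq_one hg.cont h1
    let k : ℝ → ℂ := fun x => -(1 / (μ : ℂ)) * g x
    have hkc : ContinuousOn k (Icc (-1) 1) := continuousOn_const.mul hg.cont
    have hki := hkc.intervalIntegrable_Icc
    let h : CI ℂ := CI.mk (dint k) (isPrim_dint hki).continuousOn
    have hhn : ‖h‖ ≤ 3 * (2 / μ) := by
      refine CI.norm_le_of_forall (by positivity) fun x hx => ?_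
      rw [CI.ext_mk _ hx]
      refine (norm_dint_le hki hx).trans ?_
      gcongr
      have : ∀ x, ‖k x‖ = 1 / μ * ‖g x‖ := fun x => by
        simp [k, abs_of_pos hμ]
      simp only [this, intervalIntegral.integral_const_mul]
      calc 1 / μ * ∫ x in (-1 : ℝ)..1, ‖g x‖ ≤ 1 / μ * 2 :=
            mul_le_mul_of_nonneg_left hg1 (by positivity)
        _ = 2 / μ := by ring
    let f : CI ℂ := (↑u⁻¹ : CI ℂ →L[ℂ] CI ℂ) h
    have hfn : ∀ x ∈ Icc (-1 : ℝ) 1, ‖f.ext x‖ ≤ C := fun x _ =>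
      (f.norm_ext_le x).trans ((ContinuousLinearMap.le_opNorm _ _).trans (by
        rw [hCdef]; gcongr))
    have hf : f = (leftConst ℂ + dop b) f + h := by
      have h2 : (u : CI ℂ →L[ℂ] CI ℂ) f = h := by
        have : ((u : CI ℂ →L[ℂ] CI ℂ) * ↑u⁻¹) h = h := by rw [Units.mul_inv]; rfl
        exact this
      rw [hu] at h2
      rw [← h2]
      simp
    obtain ⟨f₁, hH⟩ : ∃ f₁, H2NeumannWith f.ext f₁ (fun x => b x * f.ext x + k x) :=
      ⟨_, neumann_of_fixed hb (hkc.memLp_volΩ ⊤) (fun x hx => CI.ext_mk _ hx) hf⟩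
    have hsolve : ∀ᵐ x ∂volΩ, (μ : ℂ) * (b x * f.ext x + k x) = (Λ - q x : ℝ) * f.ext x - g x := by
      refine ae_of_all _ fun x => ?_
      have hμ' : (μ : ℂ) ≠ 0 := by exact_mod_cast hμ.ne'
      simp only [b, k]
      push_cast
      field_simp
      ring
    have e1 := shiftedForm_eq_of_solves hq Λ hg hH hsolve
    have e2 := shiftedForm_eq_of_solves hq Λ hH hH hsolve
    have e3 : ∫ x in (-1 : ℝ)..1, (g x * conj (g x)).re = 1 := by
      refine Eq.trans (intervalIntegral.integral_congr fun x _ => ?_) h1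
      simp only [Complex.mul_conj', ← Complex.ofReal_pow, Complex.ofReal_re]
    rw [e3] at e1
    have e4 := (integral_sq_le_of_bound hH.cont hg.cont hfn).trans
      (mul_le_mul_of_nonneg_left hg1 hC0)
    rw [← e2] at e4
    have hnn : ∀ t : ℝ, 0 ≤ shiftedForm μ q Λ f.ext f₁ f.ext f₁ * (t * t) +
        2 * shiftedForm μ q Λ g g₁ f.ext f₁ * t + shiftedForm μ q Λ g g₁ g g₁ := by
      intro t
      rw [← shiftedForm_add_smul hq Λ t hg hH, shiftedForm_self hq Λ (hg.add (hH.const_mul (t : ℂ))),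
        sub_nonneg]
      exact hform _ _ _ (hg.add (hH.const_mul (t : ℂ)))
    have hd := discrim_le_zero hnn
    rw [discrim, e1] at hd
    have e5 := shiftedForm_self (μ := μ) hq Λ hg
    rw [h1, mul_one] at e5
    have e6 : 0 ≤ shiftedForm μ q Λ g g₁ g g₁ := by simpa using hnn 0
    rw [← e5]
    nlinarith [mul_le_mul_of_nonneg_left e4 e6]
  have hCpos : 0 < C := by
    obtain ⟨r, hr⟩ := hSne
    by_contra! hC
    have h2 := hkey r hr
    rw [le_antisymm hC hC0] at h2
    norm_num at h2
  have hle : Λ ≤ Λ - 1 / (C * 2) := by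
    refine csSup_le hSne fun r hr => ?_
    have h2 := hkey r hr
    rw [← div_le_iff₀ (by positivity)] at h2
    linarith
  have : 0 < 1 / (C * 2) := by positivity
  linarith

end scalar

/-! ### A priori bounds for steady states -/

section apriori

variable {μ γN γL A : ℝ} {V : ℝ → ℝ} {P P₁ P₂ : ℝ → ℂ}

/-- Expanding the square leaves `γL` times the deficit minus `γN` times the right side of the energy
identity, which is nonnegative. -/
lemma integral_deficit_sq_le (hμ : 0 < μ) (hγN : 0 < γN) (hP : H2NeumannWith P P₁ P₂)
    (h : ∀ᵐ x ∂volΩ, P₂ x = (((γN * ‖P x‖ ^ 2 - γL) / μ : ℝ) +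
      Complex.I * ((A / μ * V x : ℝ) : ℂ)) * P x) :
    ∫ x in (-1 : ℝ)..1, (γL - γN * ‖P x‖ ^ 2) ^ 2 ≤
      γL * ∫ x in (-1 : ℝ)..1, (γL - γN * ‖P x‖ ^ 2) := by
  have h1 := steady_energy hμ hP h
  have h0 : 0 ≤ μ * ∫ x in (-1 : ℝ)..1, ‖P₁ x‖ ^ 2 :=
    mul_nonneg hμ.le (intervalIntegral.integral_nonneg (by norm_num) fun _ _ => by positivity)
  rw [h1] at h0
  have hc := hP.cont
  have h2 : ∫ x in (-1 : ℝ)..1, (γL - γN * ‖P x‖ ^ 2) ^ 2 =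
      γL * (∫ x in (-1 : ℝ)..1, (γL - γN * ‖P x‖ ^ 2)) -
        γN * ∫ x in (-1 : ℝ)..1, (γL * ‖P x‖ ^ 2 - γN * ‖P x‖ ^ 4) := by
    rw [← intervalIntegral.integral_const_mul, ← intervalIntegral.integral_const_mul,
      ← intervalIntegral.integral_sub (ContinuousOn.intervalIntegrable_Icc (by fun_prop))
        (ContinuousOn.intervalIntegrable_Icc (by fun_prop))]
    refine intervalIntegral.integral_congr fun x _ => ?_
    ring
  rw [h2]
  nlinarith

lemma integral_deficit_nonneg (hμ : 0 < μ) (hγN : 0 < γN) (hγL : 0 < γL)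
    (hP : H2NeumannWith P P₁ P₂)
    (h : ∀ᵐ x ∂volΩ, P₂ x = (((γN * ‖P x‖ ^ 2 - γL) / μ : ℝ) +
      Complex.I * ((A / μ * V x : ℝ) : ℂ)) * P x) :
    0 ≤ ∫ x in (-1 : ℝ)..1, (γL - γN * ‖P x‖ ^ 2) := by
  have h1 := integral_deficit_sq_le hμ hγN hP h
  have h2 : 0 ≤ ∫ x in (-1 : ℝ)..1, (γL - γN * ‖P x‖ ^ 2) ^ 2 :=
    intervalIntegral.integral_nonneg (by norm_num) fun _ _ => by positivity
  exact nonneg_of_mul_nonneg_right (h2.trans h1) hγL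

lemma integral_norm_sq_le (hμ : 0 < μ) (hγN : 0 < γN) (hγL : 0 < γL)
    (hP : H2NeumannWith P P₁ P₂)
    (h : ∀ᵐ x ∂volΩ, P₂ x = (((γN * ‖P x‖ ^ 2 - γL) / μ : ℝ) +
      Complex.I * ((A / μ * V x : ℝ) : ℂ)) * P x) :
    ∫ x in (-1 : ℝ)..1, ‖P x‖ ^ 2 ≤ 2 * (γL / γN) := by
  have h1 := integral_deficit_nonneg hμ hγN hγL hP h
  have hc := hP.cont
  rw [intervalIntegral.integral_sub intervalIntegrable_const
    (ContinuousOn.intervalIntegrable_Icc (by fun_prop)), intervalIntegral.integral_const,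
    intervalIntegral.integral_const_mul] at h1
  rw [← mul_div_assoc, le_div_iff₀ hγN]
  norm_num at h1
  linarith

lemma integral_deriv_sq_le (hμ : 0 < μ) (hγN : 0 < γN) (hγL : 0 < γL)
    (hP : H2NeumannWith P P₁ P₂)
    (h : ∀ᵐ x ∂volΩ, P₂ x = (((γN * ‖P x‖ ^ 2 - γL) / μ : ℝ) +
      Complex.I * ((A / μ * V x : ℝ) : ℂ)) * P x) :
    ∫ x in (-1 : ℝ)..1, ‖P₁ x‖ ^ 2 ≤ 2 * γL ^ 2 / (γN * μ) := by
  have h1 := steady_energy hμ hP h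
  have h2 := integral_norm_sq_le hμ hγN hγL hP h
  have hc := hP.cont
  have h3 : ∫ x in (-1 : ℝ)..1, (γL * ‖P x‖ ^ 2 - γN * ‖P x‖ ^ 4) ≤
      γL * ∫ x in (-1 : ℝ)..1, ‖P x‖ ^ 2 := by
    rw [← intervalIntegral.integral_const_mul]
    refine intervalIntegral.integral_mono_on (by norm_num)
      (ContinuousOn.intervalIntegrable_Icc (by fun_prop))
      (ContinuousOn.intervalIntegrable_Icc (by fun_prop)) fun x _ => ?_
    have : 0 ≤ γN * ‖P x‖ ^ 4 := by positivity
    linarith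
  have h4 := mul_le_mul_of_nonneg_left h2 hγL.le
  rw [le_div_iff₀ (by positivity)]
  have h5 : γL * (2 * (γL / γN)) * γN = 2 * γL ^ 2 := by field_simp
  nlinarith

/-- The Hölder estimate compares `‖P x‖` with `‖P y‖` for every `y`; averaging over `y` leaves only
the energy and the mean square, both already bounded. -/
lemma norm_steady_le (hμ : 0 < μ) (hγN : 0 < γN) (hγL : 0 < γL)
    (hP : H2NeumannWith P P₁ P₂)
    (h : ∀ᵐ x ∂volΩ, P₂ x = (((γN * ‖P x‖ ^ 2 - γL) / μ : ℝ) +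
      Complex.I * ((A / μ * V x : ℝ) : ℂ)) * P x) {x : ℝ} (hx : x ∈ Icc (-1 : ℝ) 1) :
    ‖P x‖ ≤ 2 + γL / γN + 4 * γL ^ 2 / (γN * μ) := by
  have h1 := integral_deriv_sq_le hμ hγN hγL hP h
  have h2 := integral_norm_sq_le hμ hγN hγL hP h
  have hc := hP.cont
  have h3 : ∀ y ∈ Icc (-1 : ℝ) 1,
      ‖P x‖ ≤ 2 + 4 * γL ^ 2 / (γN * μ) + ‖P y‖ ^ 2 / 2 := by
    intro y hy
    have h4 := hP.norm_sub_sq_le hy hx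
    have h5 : |x - y| ≤ 2 := abs_le.2 ⟨by linarith [hx.1, hy.2], by linarith [hx.2, hy.1]⟩
    have h6 : ‖P x - P y‖ ^ 2 ≤ 4 * γL ^ 2 / (γN * μ) := by
      have h0 : 0 ≤ ∫ x in (-1 : ℝ)..1, ‖P₁ x‖ ^ 2 :=
        intervalIntegral.integral_nonneg (by norm_num) fun _ _ => by positivity
      have h8 := mul_le_mul_of_nonneg_right h5 h0
      have h9 : 2 * (2 * γL ^ 2 / (γN * μ)) = 4 * γL ^ 2 / (γN * μ) := by ring
      linarith
    have h7 := norm_le_norm_add_norm_sub' (P x) (P y)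
    nlinarith [sq_nonneg (‖P x - P y‖ - 1), sq_nonneg (‖P y‖ - 1), sq_nonneg ‖P x - P y‖]
  have h4 : ∫ _ in (-1 : ℝ)..1, ‖P x‖ ≤
      ∫ y in (-1 : ℝ)..1, ((2 + 4 * γL ^ 2 / (γN * μ)) + (1 / 2) * ‖P y‖ ^ 2) := by
    refine intervalIntegral.integral_mono_on (by norm_num) intervalIntegrable_const
      (ContinuousOn.intervalIntegrable_Icc (by fun_prop)) fun y hy => ?_
    linarith [h3 y hy]
  rw [intervalIntegral.integral_add intervalIntegrable_const
    (ContinuousOn.intervalIntegrable_Icc (by fun_prop)), intervalIntegral.integral_const,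
    intervalIntegral.integral_const, intervalIntegral.integral_const_mul] at h4
  norm_num at h4
  have h5 : 0 < γL / γN := by positivity
  linarith

lemma eq_zero_of_integral_sq {g : ℝ → ℝ} (hg : ContinuousOn g (Icc (-1) 1))
    (h : ∫ x in (-1 : ℝ)..1, g x ^ 2 ≤ 0) : ∀ x ∈ Icc (-1 : ℝ) 1, g x = 0 := by
  intro x hx
  by_contra hne
  have hpos : 0 < ∫ x in (-1 : ℝ)..1, g x ^ 2 :=
    intervalIntegral.integral_pos (by norm_num) (hg.pow 2) (fun _ _ => sq_nonneg _)
      ⟨x, hx, by positivity⟩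
  linarith

/-- A steady state with a zero is far from the constant modulus. -/
lemma deficit_of_zero (hμ : 0 < μ) (hγN : 0 < γN) (hγL : 0 < γL)
    (hP : H2NeumannWith P P₁ P₂)
    (h : ∀ᵐ x ∂volΩ, P₂ x = (((γN * ‖P x‖ ^ 2 - γL) / μ : ℝ) +
      Complex.I * ((A / μ * V x : ℝ) : ℂ)) * P x) {x₀ : ℝ} (hx₀ : x₀ ∈ Icc (-1 : ℝ) 1)
    (h0 : P x₀ = 0) :
    γL / 4 * min 1 (μ / (4 * γL)) ≤ ∫ x in (-1 : ℝ)..1, (γL - γN * ‖P x‖ ^ 2) := by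
  have h1 := integral_deficit_sq_le hμ hγN hP h
  have hE := integral_deriv_sq_le hμ hγN hγL hP h
  -- Within distance `μ / (4 γL)` of the zero, the Hölder estimate keeps `γN ‖P‖² ≤ γL / 2`; the cap
  -- `1` lets an interval of length `δ` starting at `x₀` fit on at least one side.
  set δ := min 1 (μ / (4 * γL)) with hδ
  have hδ0 : 0 < δ := lt_min one_pos (by positivity)
  have hδ1 : δ ≤ 1 := min_le_left _ _
  have hδ2 : δ * (4 * γL) ≤ μ := (le_div_iff₀ (by positivity)).1 (min_le_right _ _)
  have hc := hP.cont
  have hnear : ∀ x ∈ Icc (-1 : ℝ) 1, |x - x₀| ≤ δ →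
      (γL / 2) ^ 2 ≤ (γL - γN * ‖P x‖ ^ 2) ^ 2 := by
    intro x hx hxδ
    have h2 := hP.norm_sub_sq_le hx₀ hx
    rw [h0, sub_zero] at h2
    have h00 : 0 ≤ ∫ x in (-1 : ℝ)..1, ‖P₁ x‖ ^ 2 :=
      intervalIntegral.integral_nonneg (by norm_num) fun _ _ => by positivity
    have h3 : ‖P x‖ ^ 2 ≤ δ * (2 * γL ^ 2 / (γN * μ)) :=
      h2.trans (mul_le_mul hxδ hE h00 hδ0.le)
    have h4 : γN * ‖P x‖ ^ 2 ≤ γL / 2 := by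
      calc γN * ‖P x‖ ^ 2 ≤ γN * (δ * (2 * γL ^ 2 / (γN * μ))) :=
            mul_le_mul_of_nonneg_left h3 hγN.le
        _ = (δ * (4 * γL)) * (γL / 2) / μ := by field_simp; ring
        _ ≤ μ * (γL / 2) / μ := by gcongr
        _ = γL / 2 := by field_simp
    have h5 : γL / 2 ≤ γL - γN * ‖P x‖ ^ 2 := by linarith
    gcongr
  have hi : IntervalIntegrable (fun x => (γL - γN * ‖P x‖ ^ 2) ^ 2) volume (-1) 1 :=
    ContinuousOn.intervalIntegrable_Icc (by fun_prop)
  obtain ⟨l, hl1, hl2, hl3, hl4⟩ : ∃ l, -1 ≤ l ∧ l + δ ≤ 1 ∧ l ≤ x₀ ∧ x₀ ≤ l + δ := by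
    rcases le_total x₀ 0 with hle | hle
    · exact ⟨x₀, hx₀.1, by linarith, le_rfl, by linarith⟩
    · exact ⟨x₀ - δ, by linarith, by linarith [hx₀.2], by linarith, by linarith⟩
  have hm1 : l ∈ Icc (-1 : ℝ) 1 := ⟨hl1, by linarith⟩
  have hm2 : l + δ ∈ Icc (-1 : ℝ) 1 := ⟨by linarith, hl2⟩
  have h2 := IsPrim.mono_integral hi (fun _ _ => by positivity) hm1 hm2 (by linarith)
  have h3 := intervalIntegral.integral_mono_on (by linarith)
    (intervalIntegrable_const (c := (γL / 2) ^ 2)) (hi.sub_Icc hm1 hm2)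
    (fun x hx => hnear x ⟨by linarith [hx.1], by linarith [hx.2]⟩
      (abs_le.2 ⟨by linarith [hx.1], by linarith [hx.2]⟩))
  rw [intervalIntegral.integral_const, smul_eq_mul, add_sub_cancel_left] at h3
  have h4 : γL * (γL / 4 * δ) ≤ γL * ∫ x in (-1 : ℝ)..1, (γL - γN * ‖P x‖ ^ 2) := by
    calc γL * (γL / 4 * δ) = δ * (γL / 2) ^ 2 := by ring
      _ ≤ _ := h3.trans (h2.trans h1)
  exact le_of_mul_le_mul_left h4 hγL

end apriori

/-! ### Steady states without shear -/

section noshear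

variable {μ γN γL : ℝ} {V : ℝ → ℝ}

/-- A solution of a linear second order equation with vanishing data at `-1` vanishes. -/
lemma eq_zero_of_linear_ode {f f₁ f₂ : ℝ → ℝ} (hf : H2NeumannWith f f₁ f₂) {C : ℝ}
    (hC : ∀ᵐ x ∂volΩ, |f₂ x| ≤ C * |f x|) (hC0 : 0 ≤ C) (h0 : f (-1) = 0) :
    ∀ x ∈ Icc (-1 : ℝ) 1, f x = 0 := by
  have hyc : ContinuousOn (fun t => |f t| + |f₁ t|) (Icc (-1) 1) := hf.cont.abs.add hf.cont₁.abs
  have hG := IsPrim.of_integral hyc.intervalIntegrable_Icc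
  set G : ℝ → ℝ := fun x => ∫ t in (-1 : ℝ)..x, (|f t| + |f₁ t|) with hGdef
  have hGnn : ∀ x ∈ Icc (-1 : ℝ) 1, 0 ≤ G x := fun x hx =>
    intervalIntegral.integral_nonneg hx.1 fun _ _ => by positivity
  have hfi := hf.cont.abs.intervalIntegrable_Icc
  have hf1i := hf.cont₁.abs.intervalIntegrable_Icc
  -- Since `f` and `f₁` both vanish at `-1`, the derivative `|f| + |f₁|` of `G` is controlled by `G`
  -- itself, and Grönwall gives `G = 0`.
  have hle : ∀ x ∈ Icc (-1 : ℝ) 1, |f x| + |f₁ x| ≤ (C + 1) * G x := by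
    intro x hx
    have hs1 := hfi.sub_Icc neg_one_mem_Icc' hx
    have hs2 := hf1i.sub_Icc neg_one_mem_Icc' hx
    have hsplit : G x = (∫ t in (-1 : ℝ)..x, |f t|) + ∫ t in (-1 : ℝ)..x, |f₁ t| :=
      intervalIntegral.integral_add hs1 hs2
    have hn1 : 0 ≤ ∫ t in (-1 : ℝ)..x, |f t| :=
      intervalIntegral.integral_nonneg hx.1 fun _ _ => by positivity
    have hn2 : 0 ≤ ∫ t in (-1 : ℝ)..x, |f₁ t| :=
      intervalIntegral.integral_nonneg hx.1 fun _ _ => by positivity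
    have h1 : |f x| ≤ ∫ t in (-1 : ℝ)..x, |f₁ t| := by
      rw [hf.prim.eq x hx, h0, zero_add]
      exact intervalIntegral.abs_integral_le_integral_abs hx.1
    have h2 : |f₁ x| ≤ C * ∫ t in (-1 : ℝ)..x, |f t| := by
      rw [hf.deriv_eq x hx, hf.left, zero_add, ← intervalIntegral.integral_const_mul]
      refine (intervalIntegral.abs_integral_le_integral_abs hx.1).trans ?_
      refine intervalIntegral.integral_mono_ae_restrict hx.1
        (hf.int.abs.sub_Icc neg_one_mem_Icc' hx) (hs1.const_mul C) ?_
      rw [EventuallyLE]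
      exact ae_restrict_of_ae_restrict_of_subset (Icc_subset_Icc_right hx.2) hC
    rw [hsplit]
    nlinarith
  have hGd : ∀ x ∈ Ico (-1 : ℝ) 1, HasDerivWithinAt G (|f x| + |f₁ x|) (Ici x) x := by
    intro x hx
    have h1 := hG.hasDerivWithinAt hyc ⟨hx.1, hx.2.le⟩
    refine (h1.mono (Icc_subset_Icc_left hx.1)).mono_of_mem_nhdsWithin ?_
    exact Icc_mem_nhdsGE hx.2
  have hgr := norm_le_gronwallBound_of_norm_deriv_right_le (f := G) (δ := 0) (K := C + 1) (ε := 0)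
    hG.continuousOn hGd (by simp [hGdef]) (fun x hx => by
      have h1 := hle x ⟨hx.1, hx.2.le⟩
      rw [Real.norm_of_nonneg (by positivity), Real.norm_of_nonneg (hGnn x ⟨hx.1, hx.2.le⟩)]
      linarith)
  intro x hx
  have h1 := hgr x hx
  rw [gronwallBound_ε0_δ0] at h1
  have h2 : G x = 0 := norm_le_zero_iff.1 h1
  have h3 := hle x hx
  rw [h2, mul_zero] at h3
  have := abs_nonneg (f x)
  have := abs_nonneg (f₁ x)
  exact abs_eq_zero.1 (by linarith)

/-- Without shear, steady states are real up to a constant phase. -/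
lemma exists_phase {P P₁ P₂ : ℝ → ℂ} (hP : H2NeumannWith P P₁ P₂)
    (h : ∀ᵐ x ∂volΩ, P₂ x = (((γN * ‖P x‖ ^ 2 - γL) / μ : ℝ) : ℂ) * P x) :
    ∃ (u : ℂ) (p p₁ p₂ : ℝ → ℝ), ‖u‖ = 1 ∧ H2NeumannWith p p₁ p₂ ∧
      (∀ x ∈ Icc (-1 : ℝ) 1, P x = u * p x) ∧
      ∀ᵐ x ∂volΩ, p₂ x = (γN * ‖P x‖ ^ 2 - γL) / μ * p x := by
  obtain ⟨u, hu, r, hr⟩ : ∃ u : ℂ, ‖u‖ = 1 ∧ ∃ r : ℝ, P (-1) = u * r := by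
    by_cases h0 : P (-1) = 0
    · exact ⟨1, by simp, 0, by simp [h0]⟩
    · refine ⟨P (-1) / ‖P (-1)‖, ?_, ‖P (-1)‖, ?_⟩
      · rw [norm_div, Complex.norm_real, norm_norm, div_self (norm_ne_zero_iff.2 h0)]
      · have : (‖P (-1)‖ : ℂ) ≠ 0 := by exact_mod_cast norm_ne_zero_iff.2 h0
        field_simp
  have huu : conj u * u = 1 := by rw [Complex.conj_mul', hu]; simp
  have huu' : u * conj u = 1 := by rw [mul_comm, huu]
  have hQ := hP.const_mul (conj u)
  have hQeq : ∀ᵐ x ∂volΩ, conj u * P₂ x = (((γN * ‖P x‖ ^ 2 - γL) / μ : ℝ) : ℂ) * (conj u * P x) := by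
    filter_upwards [h] with x hx
    rw [hx]; ring
  have hre := hQ.map Complex.reCLM
  have him := hQ.map Complex.imCLM
  obtain ⟨C, hC0, hC⟩ : ∃ C, 0 ≤ C ∧ ∀ x ∈ Icc (-1 : ℝ) 1, ‖(γN * ‖P x‖ ^ 2 - γL) / μ‖ ≤ C := by
    have := hP.cont
    exact ContinuousOn.exists_bound_Icc (by fun_prop)
  -- The rotation `conj u` makes the value at `-1` real. The imaginary part solves a linear equation
  -- with a real coefficient and zero data there.
  have him0 := eq_zero_of_linear_ode him (C := C) (by
    filter_upwards [hQeq, ae_of_forall_Icc hC] with x h1 h2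
    simp only [Complex.imCLM_apply]
    rw [h1, Complex.im_ofReal_mul, abs_mul]
    exact mul_le_mul_of_nonneg_right h2 (abs_nonneg _)) hC0 (by
    simp only [Complex.imCLM_apply]
    rw [hr, ← mul_assoc, huu, one_mul, Complex.ofReal_im])
  refine ⟨u, _, _, _, hu, hre, fun x hx => ?_, ?_⟩
  · have h1 := him0 x hx
    simp only [Complex.imCLM_apply] at h1
    have h2 : conj u * P x = ((conj u * P x).re : ℂ) := by
      apply Complex.ext <;> simp [h1]
    rw [Complex.reCLM_apply, ← h2, ← mul_assoc, huu', one_mul]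
  · filter_upwards [hQeq] with x h1
    simp only [Complex.reCLM_apply]
    rw [h1, Complex.re_ofReal_mul]

/-- Without shear, a steady state without zeros has constant modulus. -/
lemma norm_const_of_ne_zero (hμ : 0 < μ) (hγN : 0 < γN) {P P₁ P₂ : ℝ → ℂ}
    (hP : H2NeumannWith P P₁ P₂)
    (h : ∀ᵐ x ∂volΩ, P₂ x = (((γN * ‖P x‖ ^ 2 - γL) / μ : ℝ) : ℂ) * P x)
    (hγL : 0 < γL) (h0 : ∀ x ∈ Icc (-1 : ℝ) 1, P x ≠ 0) :
    ∀ x ∈ Icc (-1 : ℝ) 1, γL - γN * ‖P x‖ ^ 2 = 0 := by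
  have hc := hP.cont
  have hsq := integral_deficit_sq_le (A := 0) (V := 0) (γL := γL) hμ hγN hP (by
    filter_upwards [h] with x hx
    rw [hx]; simp)
  suffices hle : ∫ x in (-1 : ℝ)..1, (γL - γN * ‖P x‖ ^ 2) ≤ 0 from
    eq_zero_of_integral_sq (by fun_prop) (hsq.trans (mul_nonpos_of_nonneg_of_nonpos hγL.le hle))
  obtain ⟨u, p, p₁, p₂, hu, hp, hPp, hp2⟩ := exists_phase hP h
  have hp0 : ∀ x ∈ Icc (-1 : ℝ) 1, p x ≠ 0 := fun x hx hz => h0 x hx (by rw [hPp x hx, hz]; simp)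
  -- Integrating `(p₁ / p)'` over the interval gives `∫ p₂ / p = ∫ (p₁ / p)² ≥ 0`, and the left side
  -- is `-1 / μ` times the deficit.
  have hinv : IsPrim (fun x => (p x)⁻¹) (fun x => -p₁ x / p x ^ 2) := by
    refine IsPrim.of_hasDeriv (fun x hx => (hp.hasDeriv x hx).inv (hp0 x hx)) ?_
    exact hp.cont₁.neg.div (hp.cont.pow 2) fun x hx => pow_ne_zero 2 (hp0 x hx)
  have h1 := (hp.prim₁.mul hinv).integral_eq
  simp only [hp.left, hp.right, zero_mul, sub_zero] at h1
  have h2 : ∫ x in (-1 : ℝ)..1, (p₂ x * (p x)⁻¹ + p₁ x * (-p₁ x / p x ^ 2)) =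
      ∫ x in (-1 : ℝ)..1, (-(1 / μ) * (γL - γN * ‖P x‖ ^ 2) - (p₁ x / p x) ^ 2) := by
    refine integral_congr_volΩ ?_ one_mem_Icc'
    filter_upwards [hp2, ae_of_forall_Icc hp0] with x h3 h4
    rw [h3]
    field_simp
    ring
  rw [h2, intervalIntegral.integral_sub (ContinuousOn.intervalIntegrable_Icc (by fun_prop)),
    intervalIntegral.integral_const_mul] at h1
  · have h3 : 0 ≤ ∫ x in (-1 : ℝ)..1, (p₁ x / p x) ^ 2 :=
      intervalIntegral.integral_nonneg (by norm_num) fun _ _ => by positivity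
    have h4 : 1 / μ * ∫ x in (-1 : ℝ)..1, (γL - γN * ‖P x‖ ^ 2) ≤ 0 := by linarith
    exact nonpos_of_mul_nonpos_right h4 (by positivity)
  · exact ((hp.cont₁.div hp.cont hp0).pow 2).intervalIntegrable_Icc

end noshear

/-! ### The spectrum of the linearization without shear -/

section spectrum

variable {μ γN γL : ℝ} {V : ℝ → ℝ} {P φ ψ f g φ' ψ' f' g' : ℝ → ℂ}

/-- Green's formula: at zero shear the complexified linearization is symmetric for the `L²` product
of pairs, since the two off-diagonal coefficients are conjugate to each other. Hence real
eigenvalues and orthogonal eigenfunctions. -/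
lemma linearized_symm (h : LinearizedMapsTo μ γN γL 0 V P φ ψ f g)
    (h' : LinearizedMapsTo μ γN γL 0 V P φ' ψ' f' g') :
    ∫ x in (-1 : ℝ)..1, (f x * conj (φ' x) + g x * conj (ψ' x) -
      (φ x * conj (f' x) + ψ x * conj (g' x))) = 0 := by
  obtain ⟨φ₁, φ₂, ψ₁, ψ₂, hφ, hψ, e1, e2⟩ := h
  obtain ⟨φ₁', φ₂', ψ₁', ψ₂', hφ', hψ', e1', e2'⟩ := h'
  have hp := (((hφ.prim₁.mul hφ'.prim.map_conj).sub (hφ.prim.mul hφ'.prim₁.map_conj)).add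
    ((hψ.prim₁.mul hψ'.prim.map_conj).sub (hψ.prim.mul hψ'.prim₁.map_conj))).const_mul (μ : ℂ)
  have h1 := hp.integral_eq
  simp only [hφ.left, hφ.right, hφ'.left, hφ'.right, hψ.left, hψ.right, hψ'.left, hψ'.right,
    map_zero, mul_zero, zero_mul, sub_zero, add_zero] at h1
  rw [← h1]
  refine integral_congr_volΩ ?_ one_mem_Icc'
  filter_upwards [e1, e2, e1', e2'] with x h1 h2 h3 h4
  rw [← h1, ← h2, ← h3, ← h4]
  simp only [map_add, map_sub, map_mul, map_pow, Complex.conj_ofReal, Complex.conj_conj,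
    Complex.conj_I, map_ofNat, Complex.ofReal_zero, map_zero]
  ring

lemma LinearizedMapsTo.continuousOn {A : ℝ} (h : LinearizedMapsTo μ γN γL A V P φ ψ f g) :
    ContinuousOn φ (Icc (-1) 1) ∧ ContinuousOn ψ (Icc (-1) 1) := by
  obtain ⟨φ₁, φ₂, ψ₁, ψ₂, hφ, hψ, -, -⟩ := h
  exact ⟨hφ.cont, hψ.cont⟩

lemma integral_pair_sq_pos (hφ : ContinuousOn φ (Icc (-1) 1)) (hψ : ContinuousOn ψ (Icc (-1) 1))
    (h : ∃ x ∈ Icc (-1 : ℝ) 1, φ x ≠ 0 ∨ ψ x ≠ 0) :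
    0 < ∫ x in (-1 : ℝ)..1, (‖φ x‖ ^ 2 + ‖ψ x‖ ^ 2) := by
  obtain ⟨x, hx, h⟩ := h
  refine intervalIntegral.integral_pos (by norm_num) ((hφ.norm.pow 2).add (hψ.norm.pow 2))
    (fun _ _ => by positivity) ⟨x, hx, ?_⟩
  rcases h with h | h
  · have := norm_pos_iff.2 h
    positivity
  · have := norm_pos_iff.2 h
    positivity

lemma linearized_orthogonal {z z' : ℂ}
    (h : LinearizedMapsTo μ γN γL 0 V P φ ψ (fun x => z * φ x) (fun x => z * ψ x))
    (h' : LinearizedMapsTo μ γN γL 0 V P φ' ψ' (fun x => z' * φ' x) (fun x => z' * ψ' x)) :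
    (z - conj z') * ∫ x in (-1 : ℝ)..1, (φ x * conj (φ' x) + ψ x * conj (ψ' x)) = 0 := by
  rw [← linearized_symm h h', ← intervalIntegral.integral_const_mul]
  refine intervalIntegral.integral_congr fun x _ => ?_
  simp only [map_mul]
  ring

lemma IsLinEigenvalue.im_eq_zero {z : ℂ} (h : IsLinEigenvalue μ γN γL 0 V P z) : z.im = 0 := by
  obtain ⟨φ, ψ, hne, h⟩ := h
  have h1 := linearized_orthogonal h h
  have hpos := integral_pair_sq_pos h.continuousOn.1 h.continuousOn.2 hne
  have h2 : ∫ x in (-1 : ℝ)..1, (φ x * conj (φ x) + ψ x * conj (ψ x)) =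
      ((∫ x in (-1 : ℝ)..1, (‖φ x‖ ^ 2 + ‖ψ x‖ ^ 2) : ℝ) : ℂ) := by
    rw [← intervalIntegral.integral_ofReal]
    refine intervalIntegral.integral_congr fun x _ => ?_
    simp [Complex.mul_conj']
  rw [h2, mul_eq_zero] at h1
  rcases h1 with h1 | h1
  · rw [sub_eq_zero, eq_comm, Complex.conj_eq_iff_im] at h1
    exact h1
  · exact absurd (by exact_mod_cast h1) hpos.ne'

/-- One copy of `γN |P|²` stays in the scalar forms. The other, together with the coupling,
contributes at most `-γN |P|² (‖φ‖ - ‖ψ‖)²`, so it can be dropped. -/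
lemma re_eigenvalue_le (hγN : 0 < γN) {z : ℂ} {φ₁ φ₂ ψ₁ ψ₂ : ℝ → ℂ}
    (hP : ContinuousOn P (Icc (-1) 1)) (hφ : H2NeumannWith φ φ₁ φ₂) (hψ : H2NeumannWith ψ ψ₁ ψ₂)
    (e1 : ∀ᵐ x ∂volΩ, (μ : ℂ) * φ₂ x + ((γL : ℂ) - Complex.I * ((0 : ℝ) : ℂ) * (V x : ℂ)) * φ x
      - (γN : ℂ) * (2 * (‖P x‖ : ℂ) ^ 2 * φ x + P x ^ 2 * ψ x) = z * φ x)
    (e2 : ∀ᵐ x ∂volΩ, (μ : ℂ) * ψ₂ x + ((γL : ℂ) + Complex.I * ((0 : ℝ) : ℂ) * (V x : ℂ)) * ψ x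
      - (γN : ℂ) * (2 * (‖P x‖ : ℂ) ^ 2 * ψ x + conj (P x) ^ 2 * φ x) = z * ψ x) :
    z.re * ∫ x in (-1 : ℝ)..1, (‖φ x‖ ^ 2 + ‖ψ x‖ ^ 2) ≤
      (∫ x in (-1 : ℝ)..1, ((γL - γN * ‖P x‖ ^ 2) * ‖φ x‖ ^ 2 - μ * ‖φ₁ x‖ ^ 2)) +
      ∫ x in (-1 : ℝ)..1, ((γL - γN * ‖P x‖ ^ 2) * ‖ψ x‖ ^ 2 - μ * ‖ψ₁ x‖ ^ 2) := by
  have hp := (((hφ.prim₁.mul hφ.prim.map_conj).add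
    (hψ.prim₁.mul hψ.prim.map_conj)).const_mul (μ : ℂ)).re
  have h1 := hp.integral_eq
  simp only [hφ.left, hφ.right, hψ.left, hψ.right, mul_zero, zero_mul, sub_zero,
    add_zero, Complex.zero_re] at h1
  have c1 := hφ.cont
  have c2 := hφ.cont₁
  have c3 := hψ.cont
  have c4 := hψ.cont₁
  have i1 : IntervalIntegrable (fun x => ‖φ x‖ ^ 2 + ‖ψ x‖ ^ 2) volume (-1) 1 :=
    ContinuousOn.intervalIntegrable_Icc (by fun_prop)
  have i2 : IntervalIntegrable (fun x => (γL - γN * ‖P x‖ ^ 2) * ‖φ x‖ ^ 2 - μ * ‖φ₁ x‖ ^ 2)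
      volume (-1) 1 := ContinuousOn.intervalIntegrable_Icc (by fun_prop)
  have i3 : IntervalIntegrable (fun x => (γL - γN * ‖P x‖ ^ 2) * ‖ψ x‖ ^ 2 - μ * ‖ψ₁ x‖ ^ 2)
      volume (-1) 1 := ContinuousOn.intervalIntegrable_Icc (by fun_prop)
  have hae : ∀ᵐ x ∂volΩ, 0 ≤ (γL - γN * ‖P x‖ ^ 2) * ‖φ x‖ ^ 2 - μ * ‖φ₁ x‖ ^ 2 +
      ((γL - γN * ‖P x‖ ^ 2) * ‖ψ x‖ ^ 2 - μ * ‖ψ₁ x‖ ^ 2) - z.re * (‖φ x‖ ^ 2 + ‖ψ x‖ ^ 2) +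
      (μ * (φ₂ x * conj (φ x) + φ₁ x * conj (φ₁ x) + (ψ₂ x * conj (ψ x) +
        ψ₁ x * conj (ψ₁ x)))).re := by
    filter_upwards [e1, e2] with x h3 h4
    have h5 : (μ : ℂ) * φ₂ x = z * φ x - γL * φ x +
        γN * (2 * (‖P x‖ : ℂ) ^ 2 * φ x + P x ^ 2 * ψ x) := by
      rw [← h3]; push_cast; ring
    have h6 : (μ : ℂ) * ψ₂ x = z * ψ x - γL * ψ x +
        γN * (2 * (‖P x‖ : ℂ) ^ 2 * ψ x + conj (P x) ^ 2 * φ x) := by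
      rw [← h4]; push_cast; ring
    have h7 : (μ : ℂ) * (φ₂ x * conj (φ x) + φ₁ x * conj (φ₁ x) + (ψ₂ x * conj (ψ x) +
        ψ₁ x * conj (ψ₁ x))) = z * ((‖φ x‖ ^ 2 + ‖ψ x‖ ^ 2 : ℝ) : ℂ)
        + ((-γL * (‖φ x‖ ^ 2 + ‖ψ x‖ ^ 2) + 2 * γN * ‖P x‖ ^ 2 * (‖φ x‖ ^ 2 + ‖ψ x‖ ^ 2)
          + μ * (‖φ₁ x‖ ^ 2 + ‖ψ₁ x‖ ^ 2) : ℝ) : ℂ)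
        + ((γN : ℝ) : ℂ) * (P x ^ 2 * ψ x * conj (φ x) + conj (P x ^ 2 * ψ x * conj (φ x))) := by
      have e : (μ : ℂ) * (φ₂ x * conj (φ x) + φ₁ x * conj (φ₁ x) + (ψ₂ x * conj (ψ x) +
        ψ₁ x * conj (ψ₁ x))) = (μ * φ₂ x) * conj (φ x) + μ * (φ₁ x * conj (φ₁ x)) +
          (μ * ψ₂ x) * conj (ψ x) + μ * (ψ₁ x * conj (ψ₁ x)) := by ring
      rw [e, h5, h6]
      push_cast
      simp only [← Complex.mul_conj', map_mul, map_pow, Complex.conj_conj]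
      ring
    rw [h7, Complex.add_conj]
    simp only [Complex.add_re, Complex.re_mul_ofReal, Complex.ofReal_re]
    have h8 : |(P x ^ 2 * ψ x * conj (φ x)).re| ≤ ‖P x‖ ^ 2 * ‖ψ x‖ * ‖φ x‖ := by
      refine (Complex.abs_re_le_norm _).trans (le_of_eq ?_)
      simp
    have h9 := neg_le_of_abs_le h8
    have h10 : 0 ≤ γN * ‖P x‖ ^ 2 * (‖ψ x‖ - ‖φ x‖) ^ 2 := by positivity
    nlinarith [mul_le_mul_of_nonneg_left h9 hγN.le]
  have hnn := intervalIntegral.integral_nonneg_of_ae_restrict (by norm_num) hae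
  rw [intervalIntegral.integral_add ((i2.add i3).sub (i1.const_mul _)) hp.int, h1,
    intervalIntegral.integral_sub (i2.add i3) (i1.const_mul _),
    intervalIntegral.integral_add i2 i3, intervalIntegral.integral_const_mul] at hnn
  linarith

/-- Without shear the first eigenvalue exists, is real, and is bounded below by the deficit. -/
theorem exists_isFirstEigenvalue (hμ : 0 < μ) (hγN : 0 < γN)
    (hP : IsSteadyState μ γN γL 0 V P) :
    ∃ Λ : ℝ, IsFirstEigenvalue μ γN γL 0 V P Λ ∧
      (∫ x in (-1 : ℝ)..1, (γL - γN * ‖P x‖ ^ 2)) / 2 ≤ Λ := by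
  obtain ⟨P₁, P₂, hP, heq⟩ := hP
  have heq' : ∀ᵐ x ∂volΩ, P₂ x = (((γN * ‖P x‖ ^ 2 - γL) / μ : ℝ) : ℂ) * P x := by
    filter_upwards [steady_second_deriv hμ heq] with x hx
    rw [hx]; simp
  obtain ⟨u, p, p₁, p₂, hu, hp, hPp, -⟩ := exists_phase hP heq'
  have hc := hP.cont
  obtain ⟨Λ, ⟨v, v₁, v₂, hv, ⟨x₀, hx₀, hv0⟩, hveq⟩, hΛ⟩ := exists_first_eigenvalue (μ := μ)
    (q := fun x => γL - γN * ‖P x‖ ^ 2) hμ (by fun_prop)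
  -- For this pair the coupling is exactly `P² ψ = -|P|² φ`, so the system collapses to the scalar
  -- eigenvalue problem. It is the direction of the neutral phase mode, and the equality case of
  -- `re_eigenvalue_le`.
  refine ⟨Λ, ⟨⟨fun x => u * v x, fun x => -conj u * v x, ⟨x₀, hx₀, Or.inl ?_⟩, _, _, _, _,
    hv.const_mul u, hv.const_mul (-conj u), ?_, ?_⟩, ?_⟩, ?_⟩
  · refine mul_ne_zero ?_ hv0
    rw [← norm_ne_zero_iff, hu]
    exact one_ne_zero
  · filter_upwards [hveq, ae_mem_Icc] with x hx hxI
    have huu : conj u * u = 1 := by rw [Complex.conj_mul', hu]; simp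
    have h1 : P x ^ 2 * conj u = u * (‖P x‖ : ℂ) ^ 2 := by
      rw [← Complex.mul_conj', hPp x hxI]
      simp only [map_mul, Complex.conj_ofReal]
      ring
    push_cast at hx ⊢
    linear_combination u * hx + γN * v x * h1
  · filter_upwards [hveq, ae_mem_Icc] with x hx hxI
    have h1 : conj (P x) ^ 2 * u = conj u * (‖P x‖ : ℂ) ^ 2 := by
      rw [← Complex.mul_conj', hPp x hxI]
      simp only [map_mul, Complex.conj_ofReal]
      ring
    push_cast at hx ⊢
    linear_combination -conj u * hx - γN * v x * h1
  · rintro z ⟨φ, ψ, hne, φ₁, φ₂, ψ₁, ψ₂, hφ, hψ, e1, e2⟩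
    have h1 := re_eigenvalue_le hγN hc hφ hψ e1 e2
    have h2 := hΛ _ _ _ hφ
    have h3 := hΛ _ _ _ hψ
    have hpos := integral_pair_sq_pos hφ.cont hψ.cont hne
    have h4 : ∫ x in (-1 : ℝ)..1, (‖φ x‖ ^ 2 + ‖ψ x‖ ^ 2) =
        (∫ x in (-1 : ℝ)..1, ‖φ x‖ ^ 2) + ∫ x in (-1 : ℝ)..1, ‖ψ x‖ ^ 2 :=
      intervalIntegral.integral_add (hφ.cont.norm.pow 2).intervalIntegrable_Icc
        (hψ.cont.norm.pow 2).intervalIntegrable_Icc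
    refine le_of_mul_le_mul_right ?_ hpos
    rw [h4] at h1 ⊢
    linarith
  -- The test function `1` has squared norm `2`, hence half the deficit.
  · have h1 := hΛ _ _ _ (H2NeumannWith.const 1)
    simp at h1
    norm_num at h1
    linarith

/-- The potential in `re_eigenvalue_le` vanishes identically, leaving only the nonpositive diffusion
terms. -/
lemma not_isLinearlyUnstable_of_norm_const (hμ : 0 < μ) (hγN : 0 < γN)
    (hP : IsSteadyState μ γN γL 0 V P)
    (h : ∀ x ∈ Icc (-1 : ℝ) 1, γL - γN * ‖P x‖ ^ 2 = 0) :
    ¬ IsLinearlyUnstable μ γN γL 0 V P := by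
  rintro ⟨z, ⟨φ, ψ, hne, φ₁, φ₂, ψ₁, ψ₂, hφ, hψ, e1, e2⟩, hz⟩
  obtain ⟨P₁, P₂, hP, -⟩ := hP
  have h1 := re_eigenvalue_le hγN hP.cont hφ hψ e1 e2
  have hpos := integral_pair_sq_pos hφ.cont hψ.cont hne
  have h2 : ∀ χ χ₁ : ℝ → ℂ,
      ∫ x in (-1 : ℝ)..1, ((γL - γN * ‖P x‖ ^ 2) * ‖χ x‖ ^ 2 - μ * ‖χ₁ x‖ ^ 2) ≤ 0 := by
    intro χ χ₁
    rw [integral_congr_Icc (g := fun x => -(μ * ‖χ₁ x‖ ^ 2)) (fun x hx => by simp [h x hx])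
      one_mem_Icc', intervalIntegral.integral_neg]
    exact neg_nonpos.2 (intervalIntegral.integral_nonneg (by norm_num) fun _ _ => by positivity)
  linarith [h2 φ φ₁, h2 ψ ψ₁, mul_pos hz hpos]

/-- Without shear a steady state either has constant modulus or has a uniform deficit. -/
lemma norm_const_or_deficit (hμ : 0 < μ) (hγN : 0 < γN) (hγL : 0 < γL)
    (hP : IsSteadyState μ γN γL 0 V P) :
    (∀ x ∈ Icc (-1 : ℝ) 1, γL - γN * ‖P x‖ ^ 2 = 0) ∨
      γL / 4 * min 1 (μ / (4 * γL)) ≤ ∫ x in (-1 : ℝ)..1, (γL - γN * ‖P x‖ ^ 2) := by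
  obtain ⟨P₁, P₂, hP, heq⟩ := hP
  have h1 := steady_second_deriv hμ heq
  by_cases h0 : ∃ x ∈ Icc (-1 : ℝ) 1, P x = 0
  · obtain ⟨x₀, hx₀, h0⟩ := h0
    exact Or.inr (deficit_of_zero hμ hγN hγL hP h1 hx₀ h0)
  · push Not at h0
    refine Or.inl (norm_const_of_ne_zero hμ hγN hP ?_ hγL h0)
    filter_upwards [h1] with x hx
    rw [hx]; simp

theorem exists_gap_noshear (hμ : 0 < μ) (hγN : 0 < γN) (hγL : 0 < γL) (V : ℝ → ℝ) :
    ∃ C : ℝ, 0 < C ∧ ∀ P : ℝ → ℂ, IsSteadyState μ γN γL 0 V P →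
      IsLinearlyUnstable μ γN γL 0 V P →
        ∃ lam : ℝ, IsFirstEigenvalue μ γN γL 0 V P lam ∧ C < lam := by
  have hpos : 0 < γL / 4 * min 1 (μ / (4 * γL)) :=
    mul_pos (by positivity) (lt_min one_pos (by positivity))
  -- The eigenvalue is at least half the deficit; a further factor `2` makes the inequality strict.
  refine ⟨γL / 4 * min 1 (μ / (4 * γL)) / 4, by positivity, fun P hP hu => ?_⟩
  rcases norm_const_or_deficit hμ hγN hγL hP with h | h
  · exact absurd hu (not_isLinearlyUnstable_of_norm_const hμ hγN hP h)
  · obtain ⟨Λ, h1, h2⟩ := exists_isFirstEigenvalue hμ hγN hP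
    exact ⟨Λ, h1, by linarith⟩

end spectrum

/-! ### Persistence of instability -/

section hurwitz

variable {X : Type*} [NormedAddCommGroup X] [NormedSpace ℂ X]

/-- For `T x = y` write `S x = y - (T - S) x`; applying the inverse of `S` costs a quarter of `‖x‖`,
which is absorbed on the left. -/
lemma norm_inverse_le_of_close {S T : X →L[ℂ] X} (hS : IsUnit S) (hT : IsUnit T) {M : ℝ}
    (hM : 1 ≤ M) (h1 : ‖Ring.inverse S‖ ≤ M) (h2 : ‖T - S‖ ≤ 1 / (4 * M)) :
    ‖Ring.inverse T‖ ≤ 2 * M := by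
  refine ContinuousLinearMap.opNorm_le_bound _ (by linarith) fun y => ?_
  set x := Ring.inverse T y with hx
  have hTx : T x = y := by
    have : (T * Ring.inverse T) y = y := by rw [Ring.mul_inverse_cancel _ hT]; rfl
    exact this
  have hSx : x = Ring.inverse S (S x) := by
    have : (Ring.inverse S * S) x = x := by rw [Ring.inverse_mul_cancel _ hS]; rfl
    exact this.symm
  have h3 : ‖S x‖ ≤ ‖y‖ + 1 / (4 * M) * ‖x‖ := by
    have : S x = y - (T - S) x := by rw [sub_apply, hTx]; abel
    rw [this]
    exact (norm_sub_le _ _).trans (add_le_add le_rfl ((T - S).le_of_opNorm_le h2 x))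
  have h4 : ‖x‖ ≤ M * (‖y‖ + 1 / (4 * M) * ‖x‖) := by
    conv_lhs => rw [hSx]
    exact ((Ring.inverse S).le_of_opNorm_le h1 _).trans
      (mul_le_mul_of_nonneg_left h3 (by linarith))
  have h5 : M * (1 / (4 * M) * ‖x‖) = ‖x‖ / 4 := by field_simp
  have := norm_nonneg y
  have := norm_nonneg x
  nlinarith

variable [CompleteSpace X]

/-- If an operator pencil is singular at the centre of a disc and invertible on its boundary, then
nearby holomorphic pencils are singular somewhere in the disc. -/
lemma exists_not_isUnit_of_close {F₀ : ℂ → X →L[ℂ] X} (hF₀ : Continuous F₀) {z₀ : ℂ} {r : ℝ}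
    (hr : 0 < r) (hu : ∀ z ∈ Metric.sphere z₀ r, IsUnit (F₀ z)) {x₀ : X} (hx₀ : x₀ ≠ 0)
    (hker : F₀ z₀ x₀ = 0) :
    ∃ ε > 0, ∀ F : ℂ → X →L[ℂ] X, Differentiable ℂ F → (∀ z, ‖F z - F₀ z‖ ≤ ε) →
      ∃ z ∈ Metric.closedBall z₀ r, ¬ IsUnit (F z) := by
  have hcont : ContinuousOn (fun z => ‖Ring.inverse (F₀ z)‖) (Metric.sphere z₀ r) := by
    intro z hz
    obtain ⟨v, hv⟩ := hu z hz
    refine ContinuousAt.continuousWithinAt (ContinuousAt.norm ?_)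
    refine ContinuousAt.comp (f := F₀) (g := Ring.inverse) ?_ hF₀.continuousAt
    rw [← hv]
    exact NormedRing.inverse_continuousAt v
  obtain ⟨M', hM'⟩ := (isCompact_sphere z₀ r).exists_bound_of_continuousOn hcont
  set M := max M' 1 with hM
  have hM1 : 1 ≤ M := le_max_right _ _
  refine ⟨1 / (4 * M), by positivity, fun F hF hclose => ?_⟩
  by_contra! hall
  -- If `F` were invertible on the whole disc, its inverse would be holomorphic, and the maximum
  -- principle would carry the boundary bound `2 * M` to the centre.
  have hd : DiffContOnCl ℂ (fun z => Ring.inverse (F z)) (Metric.ball z₀ r) := by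
    refine DifferentiableOn.diffContOnCl fun z hz => ?_
    rw [closure_ball z₀ hr.ne'] at hz
    obtain ⟨v, hv⟩ := hall z hz
    have : DifferentiableAt ℂ Ring.inverse (F z) := by
      rw [← hv]
      exact differentiableAt_inverse v.isUnit
    exact (this.comp z hF.differentiableAt).differentiableWithinAt
  have hbd : ∀ z ∈ frontier (Metric.ball z₀ r), ‖Ring.inverse (F z)‖ ≤ 2 * M := by
    intro z hz
    rw [frontier_ball z₀ hr.ne'] at hz
    refine norm_inverse_le_of_close (hu z hz) (hall z (Metric.sphere_subset_closedBall hz)) hM1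
      ?_ (hclose z)
    have := hM' z hz
    rw [norm_norm] at this
    exact this.trans (le_max_left _ _)
  have h1 := Complex.norm_le_of_forall_mem_frontier_norm_le Metric.isBounded_ball hd hbd
    (subset_closure (Metric.mem_ball_self hr))
  -- `F z₀` nearly annihilates `x₀`, so the bound on its inverse gives `‖x₀‖ ≤ ‖x₀‖ / 2`.
  have h2 : x₀ = Ring.inverse (F z₀) ((F z₀ - F₀ z₀) x₀) := by
    rw [sub_apply, hker, sub_zero]
    have : (Ring.inverse (F z₀) * F z₀) x₀ = x₀ := by
      rw [Ring.inverse_mul_cancel _ (hall z₀ (Metric.mem_closedBall_self hr.le))]; rfl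
    exact this.symm
  have h3 : ‖x₀‖ ≤ 2 * M * (1 / (4 * M) * ‖x₀‖) := by
    conv_lhs => rw [h2]
    exact ((Ring.inverse (F z₀)).le_of_opNorm_le h1 _).trans
      (mul_le_mul_of_nonneg_left ((F z₀ - F₀ z₀).le_of_opNorm_le (hclose z₀) x₀) (by linarith))
  have h4 : 2 * M * (1 / (4 * M) * ‖x₀‖) = ‖x₀‖ / 2 := by field_simp; norm_num
  have h5 := norm_pos_iff.2 hx₀
  linarith

end hurwitz

/-! ### Compact operator pencils for Neumann systems. -/

section pencil

variable {X : Type*} [NormedAddCommGroup X] [NormedSpace ℂ X]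

lemma IsCompactOperator.prod_clm {X Y Z : Type*} [NormedAddCommGroup X] [NormedSpace ℂ X]
    [NormedAddCommGroup Y] [NormedSpace ℂ Y] [NormedAddCommGroup Z] [NormedSpace ℂ Z]
    {S : X →L[ℂ] Y} {T : X →L[ℂ] Z} (hS : IsCompactOperator S) (hT : IsCompactOperator T) :
    IsCompactOperator (S.prod T) := by
  obtain ⟨K, hK, hKS⟩ := hS
  obtain ⟨L, hL, hLT⟩ := hT
  refine ⟨K ×ˢ L, hK.prod hL, ?_⟩
  filter_upwards [hKS, hLT] with x h1 h2 using ⟨h1, h2⟩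

/-- The operator matrix with the given entries. -/
noncomputable def blockOp (T₁₁ T₁₂ T₂₁ T₂₂ : X →L[ℂ] X) : (X × X) →L[ℂ] (X × X) :=
  (T₁₁.comp (ContinuousLinearMap.fst ℂ X X) + T₁₂.comp (ContinuousLinearMap.snd ℂ X X)).prod
  (T₂₁.comp (ContinuousLinearMap.fst ℂ X X) + T₂₂.comp (ContinuousLinearMap.snd ℂ X X))

lemma isCompactOperator_blockOp {T₁₁ T₁₂ T₂₁ T₂₂ : X →L[ℂ] X} (h₁ : IsCompactOperator T₁₁)
    (h₂ : IsCompactOperator T₁₂) (h₃ : IsCompactOperator T₂₁) (h₄ : IsCompactOperator T₂₂) :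
    IsCompactOperator (blockOp T₁₁ T₁₂ T₂₁ T₂₂) :=
  IsCompactOperator.prod_clm ((h₁.comp_clm _).add (h₂.comp_clm _))
    ((h₃.comp_clm _).add (h₄.comp_clm _))

lemma norm_blockOp_sub_le {S₁₁ S₁₂ S₂₁ S₂₂ T₁₁ T₁₂ T₂₁ T₂₂ : X →L[ℂ] X} {ε : ℝ} (hε : 0 ≤ ε)
    (h₁ : ‖S₁₁ - T₁₁‖ ≤ ε) (h₂ : ‖S₁₂ - T₁₂‖ ≤ ε) (h₃ : ‖S₂₁ - T₂₁‖ ≤ ε)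
    (h₄ : ‖S₂₂ - T₂₂‖ ≤ ε) :
    ‖blockOp S₁₁ S₁₂ S₂₁ S₂₂ - blockOp T₁₁ T₁₂ T₂₁ T₂₂‖ ≤ 2 * ε := by
  refine ContinuousLinearMap.opNorm_le_bound _ (by positivity) fun f => ?_
  have e : (blockOp S₁₁ S₁₂ S₂₁ S₂₂ - blockOp T₁₁ T₁₂ T₂₁ T₂₂) f =
      ((S₁₁ - T₁₁) f.1 + (S₁₂ - T₁₂) f.2, (S₂₁ - T₂₁) f.1 + (S₂₂ - T₂₂) f.2) := by
    simp only [blockOp, sub_apply, ContinuousLinearMap.prod_apply, add_apply,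
      ContinuousLinearMap.comp_apply, ContinuousLinearMap.coe_fst', ContinuousLinearMap.coe_snd',
      Prod.mk_sub_mk]
    congr 1 <;> abel
  have key : ∀ (S T : X →L[ℂ] X), ‖S‖ ≤ ε → ‖T‖ ≤ ε → ‖S f.1 + T f.2‖ ≤ 2 * ε * ‖f‖ := by
    intro S T hS hT
    have h1 := S.le_of_opNorm_le hS f.1
    have h2 := T.le_of_opNorm_le hT f.2
    have h3 := norm_fst_le f
    have h4 := norm_snd_le f
    have h5 := norm_add_le (S f.1) (T f.2)
    nlinarith
  rw [e, Prod.norm_mk]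
  exact max_le (key _ _ h₁ h₂) (key _ _ h₃ h₄)

/-- The operator pencil `1 - blockOp T - z (C, C)`. -/
noncomputable def blockPencil (T₁₁ T₁₂ T₂₁ T₂₂ C : X →L[ℂ] X) (z : ℂ) :
    (X × X) →L[ℂ] (X × X) :=
  1 - blockOp T₁₁ T₁₂ T₂₁ T₂₂ - z • blockOp C 0 0 C

lemma differentiable_blockPencil (T₁₁ T₁₂ T₂₁ T₂₂ C : X →L[ℂ] X) :
    Differentiable ℂ (blockPencil T₁₁ T₁₂ T₂₁ T₂₂ C) := by
  unfold blockPencil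
  fun_prop

lemma blockPencil_apply (T₁₁ T₁₂ T₂₁ T₂₂ C : X →L[ℂ] X) (z : ℂ) (f : X × X) :
    blockPencil T₁₁ T₁₂ T₂₁ T₂₂ C z f =
      (f.1 - (T₁₁ f.1 + T₁₂ f.2) - z • C f.1, f.2 - (T₂₁ f.1 + T₂₂ f.2) - z • C f.2) := by
  simp only [blockPencil, blockOp, sub_apply, ContinuousLinearMap.prod_apply, add_apply,
      ContinuousLinearMap.comp_apply, ContinuousLinearMap.coe_fst', ContinuousLinearMap.coe_snd',
      smul_apply, one_apply_eq_self, zero_apply, add_zero, zero_add]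
  rfl

lemma norm_blockPencil_sub_le {S₁₁ S₁₂ S₂₁ S₂₂ T₁₁ T₁₂ T₂₁ T₂₂ : X →L[ℂ] X} (C : X →L[ℂ] X)
    {ε : ℝ} (hε : 0 ≤ ε)
    (h₁ : ‖S₁₁ - T₁₁‖ ≤ ε) (h₂ : ‖S₁₂ - T₁₂‖ ≤ ε) (h₃ : ‖S₂₁ - T₂₁‖ ≤ ε)
    (h₄ : ‖S₂₂ - T₂₂‖ ≤ ε) (z : ℂ) :
    ‖blockPencil S₁₁ S₁₂ S₂₁ S₂₂ C z - blockPencil T₁₁ T₁₂ T₂₁ T₂₂ C z‖ ≤ 2 * ε := by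
  have e : blockPencil S₁₁ S₁₂ S₂₁ S₂₂ C z - blockPencil T₁₁ T₁₂ T₂₁ T₂₂ C z =
      -(blockOp S₁₁ S₁₂ S₂₁ S₂₂ - blockOp T₁₁ T₁₂ T₂₁ T₂₂) := by
    simp only [blockPencil]
    abel
  rw [e, norm_neg]
  exact norm_blockOp_sub_le hε h₁ h₂ h₃ h₄

lemma isUnit_blockPencil [CompleteSpace X] {T₁₁ T₁₂ T₂₁ T₂₂ C : X →L[ℂ] X}
    (h₁ : IsCompactOperator T₁₁) (h₂ : IsCompactOperator T₁₂) (h₃ : IsCompactOperator T₂₁)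
    (h₄ : IsCompactOperator T₂₂) (hC : IsCompactOperator C) {z : ℂ}
    (h : ∀ f, blockPencil T₁₁ T₁₂ T₂₁ T₂₂ C z f = 0 → f = 0) :
    IsUnit (blockPencil T₁₁ T₁₂ T₂₁ T₂₂ C z) := by
  have e : blockPencil T₁₁ T₁₂ T₂₁ T₂₂ C z =
      1 - (blockOp T₁₁ T₁₂ T₂₁ T₂₂ + z • blockOp C 0 0 C) := by
    rw [blockPencil, sub_sub]
  rw [e]
  refine isUnit_one_sub_of_compact ((isCompactOperator_blockOp h₁ h₂ h₃ h₄).add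
    ((isCompactOperator_blockOp hC isCompactOperator_zero isCompactOperator_zero hC).smul z))
    fun f hf => h f ?_
  rw [e, sub_apply, hf]
  simp

variable {b₁₁ b₁₂ b₂₁ b₂₂ : ℝ → ℂ}

/-- The pencil whose kernel consists of the solutions of the Neumann system
`φ'' = (b₁₁ + z c) φ + b₁₂ ψ`, `ψ'' = b₂₁ φ + (b₂₂ + z c) ψ`. -/
noncomputable def pencil (b₁₁ b₁₂ b₂₁ b₂₂ c : ℝ → ℂ) :
    ℂ → (CI ℂ × CI ℂ) →L[ℂ] (CI ℂ × CI ℂ) :=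
  blockPencil (leftConst ℂ + dop b₁₁) (dop b₁₂) (dop b₂₁) (leftConst ℂ + dop b₂₂) (dop c)

lemma isUnit_pencil {c : ℝ → ℂ} {z : ℂ}
    (h : ∀ f, pencil b₁₁ b₁₂ b₂₁ b₂₂ c z f = 0 → f = 0) :
    IsUnit (pencil b₁₁ b₁₂ b₂₁ b₂₂ c z) :=
  isUnit_blockPencil (isCompactOperator_leftConst.add (isCompactOperator_dop b₁₁))
    (isCompactOperator_dop b₁₂) (isCompactOperator_dop b₂₁)
    (isCompactOperator_leftConst.add (isCompactOperator_dop b₂₂)) (isCompactOperator_dop c) h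

lemma pencil_apply (b₁₁ b₁₂ b₂₁ b₂₂ c : ℝ → ℂ) (z : ℂ) (f : CI ℂ × CI ℂ) :
    pencil b₁₁ b₁₂ b₂₁ b₂₂ c z f =
      (f.1 - (leftConst ℂ f.1 + dop b₁₁ f.1 + dop b₁₂ f.2) - z • dop c f.1,
       f.2 - (dop b₂₁ f.1 + (leftConst ℂ f.2 + dop b₂₂ f.2)) - z • dop c f.2) :=
  blockPencil_apply _ _ _ _ _ z f

lemma pencil_eq_zero_iff {c : ℝ → ℂ} {z : ℂ} (hb₁ : MemLp b₁₁ ⊤ volΩ) (hb₂ : MemLp b₁₂ ⊤ volΩ)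
    (hb₃ : MemLp b₂₁ ⊤ volΩ) (hb₄ : MemLp b₂₂ ⊤ volΩ) (hc : MemLp c ⊤ volΩ) (f : CI ℂ × CI ℂ) :
    pencil b₁₁ b₁₂ b₂₁ b₂₂ c z f = 0 ↔
      (∀ x ∈ Icc (-1 : ℝ) 1, f.1.ext x = f.1.ext (-1) +
        dint (fun t => b₁₁ t * f.1.ext t + b₁₂ t * f.2.ext t + z * (c t * f.1.ext t)) x) ∧
      (∀ x ∈ Icc (-1 : ℝ) 1, f.2.ext x = f.2.ext (-1) +
        dint (fun t => b₂₁ t * f.1.ext t + b₂₂ t * f.2.ext t + z * (c t * f.2.ext t)) x) := by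
  have key : ∀ {b b' : ℝ → ℂ} (_ : MemLp b ⊤ volΩ) (_ : MemLp b' ⊤ volΩ) (g : CI ℂ) (u v : CI ℂ)
      {x : ℝ}, x ∈ Icc (-1 : ℝ) 1 →
      dint (fun t => b t * u.ext t + b' t * v.ext t + z * (c t * g.ext t)) x =
        (dop b u).ext x + (dop b' v).ext x + z * (dop c g).ext x := by
    intro b b' hb hb' g u v x hx
    rw [dop_apply hb u hx, dop_apply hb' v hx, dop_apply hc g hx, ← dint_const_mul,
      ← dint_add (MemLp.mul_CI hb u) (MemLp.mul_CI hb' v) hx,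
      ← dint_add ((MemLp.mul_CI hb u).add (MemLp.mul_CI hb' v))
        ((MemLp.mul_CI hc g).const_mul z) hx]
  rw [pencil_apply, Prod.mk_eq_zero]
  refine and_congr ⟨fun h x hx => ?_, fun h => ?_⟩ ⟨fun h x hx => ?_, fun h => ?_⟩
  · rw [key hb₁ hb₂ _ _ _ hx, ← leftConst_apply f.1 x]
    have h1 : (f.1 - (leftConst ℂ f.1 + dop b₁₁ f.1 + dop b₁₂ f.2) - z • dop c f.1).ext x =
      f.1.ext x - ((leftConst ℂ f.1).ext x + (dop b₁₁ f.1).ext x + (dop b₁₂ f.2).ext x) -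
        z * (dop c f.1).ext x := rfl
    rw [h] at h1
    have h2 : (0 : CI ℂ).ext x = 0 := rfl
    rw [h2] at h1
    linear_combination -h1
  · refine CI.ext_inj fun x hx => ?_
    have h1 : (f.1 - (leftConst ℂ f.1 + dop b₁₁ f.1 + dop b₁₂ f.2) - z • dop c f.1).ext x =
      f.1.ext x - ((leftConst ℂ f.1).ext x + (dop b₁₁ f.1).ext x + (dop b₁₂ f.2).ext x) -
        z * (dop c f.1).ext x := rfl
    have h2 : (0 : CI ℂ).ext x = 0 := rfl
    have h3 := h x hx
    rw [key hb₁ hb₂ _ _ _ hx, ← leftConst_apply f.1 x] at h3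
    rw [h1, h2]
    linear_combination h3
  · rw [key hb₃ hb₄ _ _ _ hx, ← leftConst_apply f.2 x]
    have h1 : (f.2 - (dop b₂₁ f.1 + (leftConst ℂ f.2 + dop b₂₂ f.2)) - z • dop c f.2).ext x =
      f.2.ext x - ((dop b₂₁ f.1).ext x + ((leftConst ℂ f.2).ext x + (dop b₂₂ f.2).ext x)) -
        z * (dop c f.2).ext x := rfl
    rw [h] at h1
    have h2 : (0 : CI ℂ).ext x = 0 := rfl
    rw [h2] at h1
    linear_combination -h1
  · refine CI.ext_inj fun x hx => ?_
    have h1 : (f.2 - (dop b₂₁ f.1 + (leftConst ℂ f.2 + dop b₂₂ f.2)) - z • dop c f.2).ext x =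
      f.2.ext x - ((dop b₂₁ f.1).ext x + ((leftConst ℂ f.2).ext x + (dop b₂₂ f.2).ext x)) -
        z * (dop c f.2).ext x := rfl
    have h2 : (0 : CI ℂ).ext x = 0 := rfl
    have h3 := h x hx
    rw [key hb₃ hb₄ _ _ _ hx, ← leftConst_apply f.2 x] at h3
    rw [h1, h2]
    linear_combination h3

end pencil

/-! ### The pencil of the linearization, and countability of its real eigenvalues at zero shear. -/

section linpencil

variable {μ γN γL A : ℝ} {V : ℝ → ℝ} {P : ℝ → ℂ}

/-- The diagonal coefficient of the linearization; the sign `s = ±1` distinguishes the two rows. -/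
noncomputable def diagCoeff (μ γN γL A : ℝ) (V : ℝ → ℝ) (P : ℝ → ℂ) (s : ℂ) (x : ℝ) : ℂ :=
  (-(γL : ℂ) + s * (Complex.I * (A : ℂ) * (V x : ℂ)) + 2 * γN * (‖P x‖ : ℂ) ^ 2) / μ

/-- The pencil of the linearization at `P`. -/
noncomputable def linPencil (μ γN γL A : ℝ) (V : ℝ → ℝ) (P : ℝ → ℂ) :
    ℂ → (CI ℂ × CI ℂ) →L[ℂ] (CI ℂ × CI ℂ) :=
  pencil (diagCoeff μ γN γL A V P 1) (fun x => γN * P x ^ 2 / μ)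
    (fun x => γN * conj (P x) ^ 2 / μ) (diagCoeff μ γN γL A V P (-1)) (fun _ => 1 / μ)

lemma memLp_diagCoeff (hV : MemLp V ⊤ volΩ) (hP : ContinuousOn P (Icc (-1) 1)) (s : ℂ) :
    MemLp (diagCoeff μ γN γL A V P s) ⊤ volΩ := by
  have h1 : MemLp (fun x => (V x : ℂ)) ⊤ volΩ := hV.ofReal
  have h2 : ContinuousOn (fun x => -(γL : ℂ) + 2 * γN * (‖P x‖ : ℂ) ^ 2) (Icc (-1) 1) := by
    have h3 : ContinuousOn (fun x => (‖P x‖ : ℂ)) (Icc (-1) 1) :=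
      Complex.continuous_ofReal.comp_continuousOn hP.norm
    fun_prop
  have h3 := ((h1.const_mul (s * (Complex.I * A))).add (h2.memLp_volΩ ⊤)).const_mul (1 / (μ : ℂ))
  refine h3.ae_eq (ae_of_all _ fun x => ?_)
  simp only [diagCoeff, Pi.add_apply]
  ring

lemma memLp_offCoeff (hP : ContinuousOn P (Icc (-1) 1)) :
    MemLp (fun x => (γN : ℂ) * P x ^ 2 / μ) ⊤ volΩ ∧
      MemLp (fun x => (γN : ℂ) * conj (P x) ^ 2 / μ) ⊤ volΩ := by
  have h : ContinuousOn (fun x => conj (P x)) (Icc (-1) 1) :=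
    Complex.continuous_conj.comp_continuousOn hP
  exact ⟨ContinuousOn.memLp_volΩ (by fun_prop) ⊤, ContinuousOn.memLp_volΩ (by fun_prop) ⊤⟩

/-- With its converse `exists_pencil_kernel`, this identifies eigenvalues with singular points of a
bounded holomorphic pencil, to which `exists_not_isUnit_of_close` applies. -/
lemma isLinEigenvalue_of_pencil (hμ : 0 < μ) (hV : MemLp V ⊤ volΩ)
    (hP : ContinuousOn P (Icc (-1) 1)) {z : ℂ} {f : CI ℂ × CI ℂ} (hf : f ≠ 0)
    (h : linPencil μ γN γL A V P z f = 0) : IsLinEigenvalue μ γN γL A V P z := by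
  have hc : MemLp (fun _ : ℝ => 1 / (μ : ℂ)) ⊤ volΩ := memLp_const _
  have hb₁ := memLp_diagCoeff (μ := μ) (γN := γN) (γL := γL) (A := A) hV hP 1
  have hb₄ := memLp_diagCoeff (μ := μ) (γN := γN) (γL := γL) (A := A) hV hP (-1)
  obtain ⟨hb₂, hb₃⟩ := memLp_offCoeff (μ := μ) (γN := γN) hP
  obtain ⟨h1, h2⟩ := (pencil_eq_zero_iff hb₁ hb₂ hb₃ hb₄ hc f).1 h
  have m1 := f.1.continuous_ext.continuousOn (s := Icc (-1 : ℝ) 1)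
  have m2 := f.2.continuous_ext.continuousOn (s := Icc (-1 : ℝ) 1)
  have H1 := H2NeumannWith.of_dint (MemLp.two_of_top
    (((MemLp.mul_continuousOn_volΩ hb₁ m1).add (MemLp.mul_continuousOn_volΩ hb₂ m2)).add
      ((MemLp.mul_continuousOn_volΩ hc m1).const_mul z))) h1
  have H2 := H2NeumannWith.of_dint (MemLp.two_of_top
    (((MemLp.mul_continuousOn_volΩ hb₃ m1).add (MemLp.mul_continuousOn_volΩ hb₄ m2)).add
      ((MemLp.mul_continuousOn_volΩ hc m2).const_mul z))) h2
  have hμ' : (μ : ℂ) ≠ 0 := by exact_mod_cast hμ.ne'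
  refine ⟨f.1.ext, f.2.ext, ?_, _, _, _, _, H1, H2, ae_of_all _ fun x => ?_,
    ae_of_all _ fun x => ?_⟩
  · by_contra! hz
    apply hf
    exact Prod.ext (CI.ext_inj fun x hx => (hz x hx).1) (CI.ext_inj fun x hx => (hz x hx).2)
  · simp only [Pi.add_apply, diagCoeff]
    field_simp
    ring
  · simp only [Pi.add_apply, diagCoeff]
    field_simp
    ring

lemma exists_pencil_kernel (hμ : 0 < μ) (hV : MemLp V ⊤ volΩ)
    (hP : ContinuousOn P (Icc (-1) 1)) {z : ℂ} (h : IsLinEigenvalue μ γN γL A V P z) :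
    ∃ f : CI ℂ × CI ℂ, f ≠ 0 ∧ linPencil μ γN γL A V P z f = 0 := by
  have hc : MemLp (fun _ : ℝ => 1 / (μ : ℂ)) ⊤ volΩ := memLp_const _
  have hb₁ := memLp_diagCoeff (μ := μ) (γN := γN) (γL := γL) (A := A) hV hP 1
  have hb₄ := memLp_diagCoeff (μ := μ) (γN := γN) (γL := γL) (A := A) hV hP (-1)
  obtain ⟨hb₂, hb₃⟩ := memLp_offCoeff (μ := μ) (γN := γN) hP
  have hμ' : (μ : ℂ) ≠ 0 := by exact_mod_cast hμ.ne'
  obtain ⟨φ, ψ, ⟨x₀, hx₀, hne⟩, φ₁, φ₂, ψ₁, ψ₂, hφ, hψ, e1, e2⟩ := h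
  refine ⟨(CI.mk φ hφ.cont, CI.mk ψ hψ.cont), ?_, ?_⟩
  · intro h0
    rw [Prod.mk_eq_zero] at h0
    have h1 : φ x₀ = 0 := by rw [← CI.ext_mk hφ.cont hx₀, h0.1]; rfl
    have h2 : ψ x₀ = 0 := by rw [← CI.ext_mk hψ.cont hx₀, h0.2]; rfl
    simp [h1, h2] at hne
  · refine (pencil_eq_zero_iff hb₁ hb₂ hb₃ hb₄ hc _).2 ⟨fun x hx => ?_, fun x hx => ?_⟩
    · simp only [CI.ext_mk _ hx, CI.ext_mk _ neg_one_mem_Icc']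
      rw [hφ.eq_dint hx]
      congr 1
      refine dint_congr ?_ hx
      filter_upwards [e1, ae_mem_Icc] with t ht htI
      simp only [CI.ext_mk _ htI, diagCoeff]
      field_simp
      linear_combination ht
    · simp only [CI.ext_mk _ hx, CI.ext_mk _ neg_one_mem_Icc']
      rw [hψ.eq_dint hx]
      congr 1
      refine dint_congr ?_ hx
      filter_upwards [e2, ae_mem_Icc] with t ht htI
      simp only [CI.ext_mk _ htI, diagCoeff]
      field_simp
      linear_combination ht

lemma add_sub_add_left_clm {X : Type*} [NormedAddCommGroup X] [NormedSpace ℂ X]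
    (a b c : X →L[ℂ] X) : a + b - (a + c) = b - c := by abel

/-- The parts depending on `z` cancel, so the estimate is uniform in `z`. The `12` is the `6` for
each entry times the two entries in a row. -/
lemma norm_linPencil_sub_le (hV : MemLp V ⊤ volΩ) {P' : ℝ → ℂ} (hP : ContinuousOn P (Icc (-1) 1))
    (hP' : ContinuousOn P' (Icc (-1) 1)) {A' ε : ℝ} (hε : 0 ≤ ε)
    (h₁ : ∀ s : ℂ, ‖s‖ = 1 → ∀ᵐ x ∂volΩ,
      ‖diagCoeff μ γN γL A V P s x - diagCoeff μ γN γL A' V P' s x‖ ≤ ε)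
    (h₂ : ∀ᵐ x ∂volΩ, ‖(γN : ℂ) * P x ^ 2 / μ - γN * P' x ^ 2 / μ‖ ≤ ε) (z : ℂ) :
    ‖linPencil μ γN γL A V P z - linPencil μ γN γL A' V P' z‖ ≤ 12 * ε := by
  have hb₁ := memLp_diagCoeff (μ := μ) (γN := γN) (γL := γL) (A := A) hV hP 1
  have hb₄ := memLp_diagCoeff (μ := μ) (γN := γN) (γL := γL) (A := A) hV hP (-1)
  obtain ⟨hb₂, hb₃⟩ := memLp_offCoeff (μ := μ) (γN := γN) hP
  have hc₁ := memLp_diagCoeff (μ := μ) (γN := γN) (γL := γL) (A := A') hV hP' 1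
  have hc₄ := memLp_diagCoeff (μ := μ) (γN := γN) (γL := γL) (A := A') hV hP' (-1)
  obtain ⟨hc₂, hc₃⟩ := memLp_offCoeff (μ := μ) (γN := γN) hP'
  have hl : ∀ b b' : ℝ → ℂ, leftConst ℂ + dop b - (leftConst ℂ + dop b') = dop b - dop b' :=
    fun b b' => add_sub_add_left_clm _ _ _
  refine (norm_blockPencil_sub_le (dop fun _ => 1 / (μ : ℂ)) (ε := 6 * ε) (by positivity)
    ?_ ?_ ?_ ?_ z).trans (by linarith)
  · rw [hl]
    exact norm_dop_sub_le hb₁ hc₁ hε (h₁ 1 (by simp))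
  · exact norm_dop_sub_le hb₂ hc₂ hε h₂
  · refine norm_dop_sub_le hb₃ hc₃ hε ?_
    filter_upwards [h₂] with x hx
    rw [← RCLike.norm_conj]
    simpa using hx
  · rw [hl]
    exact norm_dop_sub_le hb₄ hc₄ hε (h₁ (-1) (by simp))

/-- Eigenfunctions for distinct real eigenvalues are orthogonal, so there are countably many. -/
lemma countable_eigenvalues :
    {r : ℝ | IsLinEigenvalue μ γN γL 0 V P (r : ℂ)}.Countable := by
  set Z := {r : ℝ | IsLinEigenvalue μ γN γL 0 V P (r : ℂ)} with hZ
  have hex : ∀ r ∈ Z, ∃ f : CI ℂ × CI ℂ, ∫ x in (-1 : ℝ)..1, (‖f.1.ext x‖ ^ 2 + ‖f.2.ext x‖ ^ 2) = 1 ∧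
      LinearizedMapsTo μ γN γL 0 V P f.1.ext f.2.ext (fun x => (r : ℂ) * f.1.ext x)
        (fun x => (r : ℂ) * f.2.ext x) := by
    rintro r ⟨φ, ψ, hne, h⟩
    have hpos := integral_pair_sq_pos h.continuousOn.1 h.continuousOn.2 hne
    obtain ⟨φ₁, φ₂, ψ₁, ψ₂, hφ, hψ, e1, e2⟩ := h
    set N := ∫ x in (-1 : ℝ)..1, (‖φ x‖ ^ 2 + ‖ψ x‖ ^ 2) with hN
    set c : ℝ := (Real.sqrt N)⁻¹ with hc
    have hc2 : c ^ 2 = N⁻¹ := by rw [hc, inv_pow, Real.sq_sqrt hpos.le]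
    have hφc := hφ.const_mul (c : ℂ)
    have hψc := hψ.const_mul (c : ℂ)
    refine ⟨(CI.mk _ hφc.cont, CI.mk _ hψc.cont), ?_, _, _, _, _,
      hφc.congr (fun x hx => CI.ext_mk hφc.cont hx) (ae_eq_refl _),
      hψc.congr (fun x hx => CI.ext_mk hψc.cont hx) (ae_eq_refl _), ?_, ?_⟩
    · rw [integral_congr_Icc (g := fun x => N⁻¹ * (‖φ x‖ ^ 2 + ‖ψ x‖ ^ 2)) (fun x hx => ?_)
        one_mem_Icc', intervalIntegral.integral_const_mul, ← hN, inv_mul_cancel₀ hpos.ne']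
      simp only [CI.ext_mk _ hx, norm_mul, mul_pow, Complex.norm_real, Real.norm_eq_abs, sq_abs,
        hc2]
      ring
    · filter_upwards [e1, ae_mem_Icc] with x h1 hx
      simp only [CI.ext_mk _ hx]
      linear_combination (c : ℂ) * h1
    · filter_upwards [e2, ae_mem_Icc] with x h1 hx
      simp only [CI.ext_mk _ hx]
      linear_combination (c : ℂ) * h1
  choose! f hf1 hf2 using hex
  -- Orthonormal pairs have squared `L²` distance `2`, while each of the two components contributes
  -- at most `2 d²` for sup distance `d`; so `d² ≥ 1 / 2`. The balls of radius `1 / 4` are then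
  -- disjoint in a separable space.
  have hdist : ∀ r ∈ Z, ∀ s ∈ Z, r ≠ s → 1 / 2 ≤ dist (f r) (f s) := by
    intro r hr s hs hrs
    have h0 := linearized_orthogonal (hf2 r hr) (hf2 s hs)
    rw [Complex.conj_ofReal, mul_eq_zero, or_iff_right (by
      rw [sub_eq_zero]; exact_mod_cast hrs)] at h0
    have c1 := (f r).1.continuous_ext
    have c2 := (f r).2.continuous_ext
    have c3 := (f s).1.continuous_ext
    have c4 := (f s).2.continuous_ext
    have c5 := Complex.continuous_conj.comp c3
    have c6 := Complex.continuous_conj.comp c4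
    have i0 : IntervalIntegrable (fun x => (f r).1.ext x * conj ((f s).1.ext x) +
        (f r).2.ext x * conj ((f s).2.ext x)) volume (-1) 1 :=
      ((c1.mul c5).add (c2.mul c6)).intervalIntegrable _ _
    have h1 : ∫ x in (-1 : ℝ)..1, ((f r).1.ext x * conj ((f s).1.ext x) +
        (f r).2.ext x * conj ((f s).2.ext x)).re = 0 := by
      have := Complex.reCLM.intervalIntegral_comp_comm i0
      rw [h0] at this
      simpa using this
    have i1 : IntervalIntegrable (fun x => ‖(f r).1.ext x‖ ^ 2 + ‖(f r).2.ext x‖ ^ 2) volume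
      (-1) 1 := Continuous.intervalIntegrable (by fun_prop) _ _
    have i2 : IntervalIntegrable (fun x => ‖(f s).1.ext x‖ ^ 2 + ‖(f s).2.ext x‖ ^ 2) volume
      (-1) 1 := Continuous.intervalIntegrable (by fun_prop) _ _
    have i3 : IntervalIntegrable (fun x => ((f r).1.ext x * conj ((f s).1.ext x) +
        (f r).2.ext x * conj ((f s).2.ext x)).re) volume (-1) 1 :=
      (Complex.continuous_re.comp ((c1.mul c5).add (c2.mul c6))).intervalIntegrable _ _
    have h2 : ∫ x in (-1 : ℝ)..1, (‖(f r).1.ext x - (f s).1.ext x‖ ^ 2 +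
        ‖(f r).2.ext x - (f s).2.ext x‖ ^ 2) = 2 := by
      have e : ∀ x, ‖(f r).1.ext x - (f s).1.ext x‖ ^ 2 + ‖(f r).2.ext x - (f s).2.ext x‖ ^ 2 =
          ((‖(f r).1.ext x‖ ^ 2 + ‖(f r).2.ext x‖ ^ 2) +
            (‖(f s).1.ext x‖ ^ 2 + ‖(f s).2.ext x‖ ^ 2)) -
          2 * ((f r).1.ext x * conj ((f s).1.ext x) + (f r).2.ext x * conj ((f s).2.ext x)).re := by
        intro x
        simp only [Complex.sq_norm, Complex.normSq_sub, Complex.add_re]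
        ring
      simp only [e]
      rw [intervalIntegral.integral_sub (i1.add i2) (i3.const_mul _),
        intervalIntegral.integral_add i1 i2, hf1 r hr, hf1 s hs,
        intervalIntegral.integral_const_mul, h1]
      norm_num
    set d := dist (f r) (f s) with hd
    have hd0 : 0 ≤ d := dist_nonneg
    have h3 : ∫ x in (-1 : ℝ)..1, (‖(f r).1.ext x - (f s).1.ext x‖ ^ 2 +
        ‖(f r).2.ext x - (f s).2.ext x‖ ^ 2) ≤ ∫ _ in (-1 : ℝ)..1, 2 * d ^ 2 := by
      refine intervalIntegral.integral_mono_on (by norm_num)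
        (Continuous.intervalIntegrable (by fun_prop) _ _) intervalIntegrable_const fun x _ => ?_
      have h4 : ‖(f r).1.ext x - (f s).1.ext x‖ ≤ d := by
        refine (CI.norm_ext_le ((f r).1 - (f s).1) x).trans ?_
        rw [hd, dist_eq_norm]
        exact norm_fst_le (f r - f s)
      have h5 : ‖(f r).2.ext x - (f s).2.ext x‖ ≤ d := by
        refine (CI.norm_ext_le ((f r).2 - (f s).2) x).trans ?_
        rw [hd, dist_eq_norm]
        exact norm_snd_le (f r - f s)
      have h6 : ‖(f r).1.ext x - (f s).1.ext x‖ ^ 2 ≤ d ^ 2 := by gcongr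
      have h7 : ‖(f r).2.ext x - (f s).2.ext x‖ ^ 2 ≤ d ^ 2 := by gcongr
      linarith
    rw [h2, intervalIntegral.integral_const, smul_eq_mul] at h3
    nlinarith
  refine PairwiseDisjoint.countable_of_isOpen (s := fun r => Metric.ball (f r) (1 / 4)) ?_
    (fun _ _ => Metric.isOpen_ball) (fun r _ => ⟨f r, Metric.mem_ball_self (by norm_num)⟩)
  intro r hr s hs hrs
  refine Metric.ball_disjoint_ball ?_
  linarith [hdist r hr s hs hrs]

end linpencil

/-! ### Instability survives small changes of shear and profile. -/

section transfer

variable {μ γN γL : ℝ} {V : ℝ → ℝ} {P₀ : ℝ → ℂ}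

/-- A steady state with positive first eigenvalue at zero shear stays unstable under small
perturbations of the shear and of the profile. -/
lemma exists_unstable_nhds (hμ : 0 < μ) (hγN : 0 < γN) (hV : MemLp V ⊤ volΩ)
    (hP₀ : ContinuousOn P₀ (Icc (-1) 1)) {Λ : ℝ} (hΛ : 0 < Λ)
    (h : IsFirstEigenvalue μ γN γL 0 V P₀ Λ) :
    ∃ ε > 0, ∀ (A : ℝ) (P : ℝ → ℂ), ContinuousOn P (Icc (-1) 1) → |A| ≤ ε →
      (∀ x ∈ Icc (-1 : ℝ) 1, ‖P x - P₀ x‖ ≤ ε) → IsLinearlyUnstable μ γN γL A V P := by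
  -- The circle about `Λ` of radius `Λ - r` meets the real axis at `r` and beyond `Λ`. Eigenvalues
  -- are real and at most `Λ`, so only `r` has to be avoided, which countability allows; `r > 0`
  -- keeps the disc in the right half-plane.
  obtain ⟨r, ⟨hr0, hrΛ⟩, hr⟩ : ∃ r ∈ Ioo 0 Λ, ¬ IsLinEigenvalue μ γN γL 0 V P₀ (r : ℂ) := by
    by_contra! hall
    exact (mt Cardinal.Real.Ioo_countable_iff.1 (not_le.2 hΛ))
      ((countable_eigenvalues (μ := μ) (γN := γN) (γL := γL) (V := V) (P := P₀)).mono hall)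
  obtain ⟨f₀, hf₀, hk⟩ := exists_pencil_kernel hμ hV hP₀ h.1
  have hF₀ : Differentiable ℂ (linPencil μ γN γL 0 V P₀) := differentiable_blockPencil _ _ _ _ _
  obtain ⟨ε₀, hε₀, H⟩ := exists_not_isUnit_of_close hF₀.continuous (z₀ := (Λ : ℂ)) (r := Λ - r)
    (by linarith) (fun z hz => by
      refine isUnit_pencil fun f hf => ?_
      by_contra hne
      have hz' : IsLinEigenvalue μ γN γL 0 V P₀ z := isLinEigenvalue_of_pencil hμ hV hP₀ hne hf
      have him := hz'.im_eq_zero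
      have hzr : z = (z.re : ℂ) := Complex.ext rfl (by simp [him])
      have hle := h.2 z hz'
      rw [hzr] at hz hz'
      rw [mem_sphere_iff_norm, ← Complex.ofReal_sub, Complex.norm_real, Real.norm_eq_abs,
        abs_of_nonpos (by linarith)] at hz
      have : z.re = r := by linarith
      rw [this] at hz'
      exact hr hz') hf₀ hk
  obtain ⟨C, hC0, hC⟩ := MemLp.exists_bound hV
  obtain ⟨M, hM0, hM⟩ := hP₀.exists_bound_Icc
  -- A common Lipschitz constant for the coefficients of the pencil: `C` for the shear, and `2 M +
  -- 1` bounds `‖P‖ + ‖P₀‖` when the profiles differ by at most `1`.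
  set D := (C + 2 * γN * (2 * M + 1)) / μ with hD
  have hD0 : 0 ≤ D := by positivity
  refine ⟨min 1 (ε₀ / (12 * D + 1)), by positivity, fun A P hP hA hPP => ?_⟩
  set ε := min 1 (ε₀ / (12 * D + 1)) with hε
  have hε0 : 0 < ε := by positivity
  have hε1 : ε ≤ 1 := min_le_left _ _
  have hεD : 12 * (ε * D) ≤ ε₀ := by
    have h1 : ε ≤ ε₀ / (12 * D + 1) := min_le_right _ _
    rw [le_div_iff₀ (by positivity)] at h1
    nlinarith
  have hnP : ∀ x ∈ Icc (-1 : ℝ) 1, ‖P x‖ ≤ M + 1 := fun x hx => by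
    have h1 := hM x hx
    have h2 := hPP x hx
    have h3 := norm_add_le (P x - P₀ x) (P₀ x)
    rw [sub_add_cancel] at h3
    linarith
  have hclose : ∀ z, ‖linPencil μ γN γL A V P z - linPencil μ γN γL 0 V P₀ z‖ ≤ ε₀ := by
    intro z
    refine (norm_linPencil_sub_le hV hP hP₀ (ε := ε * D) (by positivity) ?_ ?_ z).trans hεD
    · intro s hs
      filter_upwards [hC, ae_mem_Icc] with x hx hxI
      have e : diagCoeff μ γN γL A V P s x - diagCoeff μ γN γL 0 V P₀ s x =
          (s * (Complex.I * ((A * V x : ℝ) : ℂ)) +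
            ((2 * γN * ((‖P x‖ - ‖P₀ x‖) * (‖P x‖ + ‖P₀ x‖)) : ℝ) : ℂ)) / μ := by
        simp only [diagCoeff]
        push_cast
        ring
      rw [e, norm_div, Complex.norm_real, Real.norm_eq_abs, abs_of_pos hμ, hD, ← mul_div_assoc]
      refine div_le_div_of_nonneg_right ((norm_add_le _ _).trans ?_) hμ.le
      rw [norm_mul, norm_mul, hs, Complex.norm_I, Complex.norm_real, Complex.norm_real,
        Real.norm_eq_abs, Real.norm_eq_abs, abs_mul, abs_mul, abs_mul, abs_mul,
        abs_of_nonneg (by positivity : 0 ≤ ‖P x‖ + ‖P₀ x‖), abs_of_pos hγN, abs_two, one_mul,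
        one_mul]
      have h1 : |A| * |V x| ≤ ε * C := mul_le_mul hA hx (abs_nonneg _) hε0.le
      have h2 : |‖P x‖ - ‖P₀ x‖| * (‖P x‖ + ‖P₀ x‖) ≤ ε * (2 * M + 1) := by
        refine mul_le_mul ((abs_norm_sub_norm_le _ _).trans (hPP x hxI)) ?_ (by positivity) hε0.le
        linarith [hnP x hxI, hM x hxI]
      nlinarith
    · filter_upwards [ae_mem_Icc] with x hxI
      have e : (γN : ℂ) * P x ^ 2 / μ - γN * P₀ x ^ 2 / μ =
          (γN : ℂ) * ((P x - P₀ x) * (P x + P₀ x)) / μ := by ring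
      rw [e, norm_div, Complex.norm_real, Real.norm_eq_abs, abs_of_pos hμ, hD, ← mul_div_assoc]
      refine div_le_div_of_nonneg_right ?_ hμ.le
      rw [norm_mul, norm_mul, Complex.norm_real, Real.norm_eq_abs, abs_of_pos hγN]
      have h2 : ‖P x - P₀ x‖ * ‖P x + P₀ x‖ ≤ ε * (2 * M + 1) := by
        refine mul_le_mul (hPP x hxI) ((norm_add_le _ _).trans ?_) (norm_nonneg _) hε0.le
        linarith [hnP x hxI, hM x hxI]
      have h3 : 0 ≤ ε * C := by positivity
      have h4 : 0 ≤ γN * (ε * (2 * M + 1)) := by positivity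
      nlinarith
  obtain ⟨z, hz, hnu⟩ := H _ (differentiable_blockPencil _ _ _ _ _) hclose
  have hex : ∃ f, linPencil μ γN γL A V P z f = 0 ∧ f ≠ 0 := by
    by_contra! hall
    exact hnu (isUnit_pencil hall)
  obtain ⟨f, hf, hfne⟩ := hex
  refine ⟨z, isLinEigenvalue_of_pencil hμ hV hP hfne hf, ?_⟩
  rw [mem_closedBall_iff_norm] at hz
  have h1 := (Complex.abs_re_le_norm (z - Λ)).trans hz
  rw [Complex.sub_re, Complex.ofReal_re, abs_le] at h1
  linarith

end transfer

/-! ### Compactness of steady states as the shear tends to zero. -/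

section compactness

variable {μ γN γL : ℝ} {V : ℝ → ℝ}

/-- Steady states for bounded shear are uniformly bounded and uniformly Lipschitz. -/
lemma exists_lipschitz_steady (hμ : 0 < μ) (hγN : 0 < γN) (hγL : 0 < γL)
    (hV : IsShearProfile V) :
    ∃ L : ℝ, 0 ≤ L ∧ ∀ A : ℝ, |A| ≤ 1 → ∀ P P₁ P₂ : ℝ → ℂ, H2NeumannWith P P₁ P₂ →
      (∀ᵐ x ∂volΩ, P₂ x = (((γN * ‖P x‖ ^ 2 - γL) / μ : ℝ) +
        Complex.I * ((A / μ * V x : ℝ) : ℂ)) * P x) →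
      (∀ᵐ x ∂volΩ, ‖P₂ x‖ ≤ L) ∧ (∀ x ∈ Icc (-1 : ℝ) 1, ‖P₁ x‖ ≤ L) ∧
        (∀ x ∈ Icc (-1 : ℝ) 1, ‖P x‖ ≤ L) ∧
        ∀ x ∈ Icc (-1 : ℝ) 1, ∀ y ∈ Icc (-1 : ℝ) 1, ‖P y - P x‖ ≤ L * |y - x| := by
  obtain ⟨C, hC0, hC⟩ := hV.exists_bound
  set M := 2 + γL / γN + 4 * γL ^ 2 / (γN * μ) with hM
  have hM0 : 0 ≤ M := by positivity
  set K := ((γN * M ^ 2 + γL) / μ + C / μ) * M with hK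
  have hK0 : 0 ≤ K := by positivity
  refine ⟨2 * K + M, by positivity, fun A hA P P₁ P₂ hP h => ?_⟩
  have hPM : ∀ x ∈ Icc (-1 : ℝ) 1, ‖P x‖ ≤ M := fun x hx => norm_steady_le hμ hγN hγL hP h hx
  have h2 : ∀ᵐ x ∂volΩ, ‖P₂ x‖ ≤ K := by
    filter_upwards [h, hC, ae_mem_Icc] with x hx hCx hxI
    have hPx := hPM x hxI
    rw [hx, norm_mul]
    refine mul_le_mul ((norm_add_le _ _).trans (add_le_add ?_ ?_)) hPx (norm_nonneg _)
      (by positivity)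
    · rw [Complex.norm_real, Real.norm_eq_abs, abs_div, abs_of_pos hμ]
      refine div_le_div_of_nonneg_right (abs_le.2 ⟨?_, ?_⟩) hμ.le
      · nlinarith [mul_nonneg hγN.le (sq_nonneg ‖P x‖), mul_nonneg hγN.le (sq_nonneg M)]
      · nlinarith [mul_le_mul_of_nonneg_left (pow_le_pow_left₀ (norm_nonneg (P x)) hPx 2) hγN.le]
    · rw [norm_mul, Complex.norm_I, one_mul, Complex.norm_real, Real.norm_eq_abs, div_mul_eq_mul_div,
        abs_div, abs_of_pos hμ, abs_mul]
      refine div_le_div_of_nonneg_right ?_ hμ.le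
      nlinarith [abs_nonneg (V x)]
  have h1 : ∀ x ∈ Icc (-1 : ℝ) 1, ‖P₁ x‖ ≤ 2 * K + M := fun x hx => by
    have := hP.prim₁.norm_sub_le h2 neg_one_mem_Icc' hx
    rw [hP.left, sub_zero, abs_of_nonneg (by linarith [hx.1])] at this
    nlinarith [hx.2]
  exact ⟨h2.mono fun x hx => by linarith, h1, fun x hx => by linarith [hPM x hx],
    fun x hx y hy => hP.prim.norm_sub_le (ae_of_forall_Icc h1) hx hy⟩

/-- For weak shear, the modulus of a steady state that is not unstable is nearly constant. -/
lemma exists_norm_close_of_not_unstable (hμ : 0 < μ) (hγN : 0 < γN) (hγL : 0 < γL)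
    (hV : IsShearProfile V) {ε : ℝ} (hε : 0 < ε) :
    ∃ A₀ > 0, ∀ A : ℝ, |A| ≤ A₀ → ∀ P : ℝ → ℂ, IsSteadyState μ γN γL A V P →
      ¬ IsLinearlyUnstable μ γN γL A V P →
        ∀ x ∈ Icc (-1 : ℝ) 1, |‖P x‖ - Real.sqrt (γL / γN)| < ε := by
  by_contra! hneg
  choose A hA P hP hPs y hy hye using fun n : ℕ => hneg (1 / ((n : ℝ) + 1)) (by positivity)
  have hA1 : ∀ n, |A n| ≤ 1 := fun n => (hA n).trans (by
    rw [div_le_one (by positivity)]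
    linarith [n.cast_nonneg (α := ℝ)])
  have hA0 : Tendsto A atTop (𝓝 0) :=
    squeeze_zero_norm hA tendsto_one_div_add_atTop_nhds_zero_nat
  choose P₁ P₂ hPN hPe using hP
  have hode := fun n => steady_second_deriv hμ (hPe n)
  obtain ⟨L, hL0, hL⟩ := exists_lipschitz_steady hμ hγN hγL hV
  have hmem : ∀ n, CI.mk (P n) (hPN n).cont ∈ {f : CI ℂ | ‖f‖ ≤ L ∧
      ∀ x ∈ Icc (-1 : ℝ) 1, ∀ y ∈ Icc (-1 : ℝ) 1, ‖f.ext y - f.ext x‖ ≤ L * |y - x|} := by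
    intro n
    obtain ⟨-, -, h3, h4⟩ := hL (A n) (hA1 n) _ _ _ (hPN n) (hode n)
    refine ⟨CI.norm_le_of_forall hL0 fun x hx => ?_, fun x hx y hy => ?_⟩
    · rw [CI.ext_mk _ hx]
      exact h3 x hx
    · rw [CI.ext_mk _ hx, CI.ext_mk _ hy]
      exact h4 x hx y hy
  obtain ⟨f, -, φ, hφ, hf⟩ := (isCompact_lipschitz (𝕜 := ℂ) L).tendsto_subseq hmem
  have hconv : ∀ x ∈ Icc (-1 : ℝ) 1, Tendsto (fun n => P (φ n) x) atTop (𝓝 (f.ext x)) := by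
    intro x hx
    rw [tendsto_iff_norm_sub_tendsto_zero]
    refine squeeze_zero (fun _ => norm_nonneg _) (fun n => ?_)
      (tendsto_iff_norm_sub_tendsto_zero.1 hf)
    rw [← CI.ext_mk (hPN (φ n)).cont hx]
    exact CI.norm_ext_le (CI.mk (P (φ n)) (hPN (φ n)).cont - f) x
  set k : ℝ → ℂ := fun x => (((γN * ‖f.ext x‖ ^ 2 - γL) / μ : ℝ) : ℂ) * f.ext x with hk
  have hkc : Continuous k := by
    have := f.continuous_ext
    exact (Complex.continuous_ofReal.comp (by fun_prop)).mul this
  have hki : IntervalIntegrable k volume (-1) 1 := hkc.intervalIntegrable _ _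
  obtain ⟨B, hB0, hB⟩ := hkc.continuousOn.exists_bound_Icc
  -- The equation expresses `P₂` through `P` and the shear, both of which converge, and `L`
  -- dominates. The resulting `L¹` convergence suffices to pass to the limit in the `dint` equation.
  have hlim : Tendsto (fun n => ∫ x in (-1 : ℝ)..1, ‖P₂ (φ n) x - k x‖) atTop (𝓝 0) := by
    have h0 : (∫ x in (-1 : ℝ)..1, (0 : ℝ)) = 0 := by simp
    rw [← h0]
    refine intervalIntegral.tendsto_integral_filter_of_dominated_convergence (fun _ => L + B)
      (Eventually.of_forall fun n => ?_) (Eventually.of_forall fun n => ?_)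
      intervalIntegrable_const ?_
    · exact ((hPN (φ n)).int.sub hki).norm.def'.aestronglyMeasurable
    · refine ae_uIoc_of_ae ?_ one_mem_Icc'
      filter_upwards [(hL _ (hA1 (φ n)) _ _ _ (hPN (φ n)) (hode (φ n))).1, ae_mem_Icc] with x hx hxI
      rw [norm_norm]
      exact (norm_sub_le _ _).trans (add_le_add hx (hB x hxI))
    · refine ae_uIoc_of_ae ?_ one_mem_Icc'
      filter_upwards [ae_all_iff.2 hode, ae_mem_Icc] with x hx hxI
      rw [← tendsto_zero_iff_norm_tendsto_zero, ← sub_self (k x)]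
      refine Tendsto.sub_const ?_ _
      simp only [hx]
      have h1 := hconv x hxI
      have h2 : Tendsto (fun n => (((γN * ‖P (φ n) x‖ ^ 2 - γL) / μ : ℝ) : ℂ)) atTop
          (𝓝 (((γN * ‖f.ext x‖ ^ 2 - γL) / μ : ℝ) : ℂ)) :=
        (Complex.continuous_ofReal.tendsto _).comp
          (((((h1.norm).pow 2).const_mul γN).sub_const γL).div_const μ)
      have h3 : Tendsto (fun n => ((A (φ n) / μ * V x : ℝ) : ℂ)) atTop (𝓝 ((0 / μ * V x : ℝ) : ℂ)) :=
        (Complex.continuous_ofReal.tendsto _).comp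
          (((hA0.comp hφ.tendsto_atTop).div_const μ).mul_const (V x))
      have h4 := (h2.add (h3.const_mul Complex.I)).mul h1
      simpa [hk] using h4
  have hfix : ∀ x ∈ Icc (-1 : ℝ) 1, f.ext x = f.ext (-1) + dint k x := by
    intro x hx
    refine tendsto_nhds_unique (hconv x hx) ?_
    have h1 : ∀ n, P (φ n) x = P (φ n) (-1) + (dint (fun t => P₂ (φ n) t - k t) x + dint k x) := by
      intro n
      rw [dint_sub (hPN (φ n)).int hki hx, sub_add_cancel]
      exact (hPN (φ n)).eq_dint hx
    simp only [h1]
    refine (hconv _ neg_one_mem_Icc').add ?_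
    have h2 : Tendsto (fun n => dint (fun t => P₂ (φ n) t - k t) x) atTop (𝓝 0) := by
      refine squeeze_zero_norm (fun n => norm_dint_le ((hPN (φ n)).int.sub hki) hx) ?_
      simpa using hlim.const_mul 3
    simpa using h2.add_const (dint k x)
  have hfN := H2NeumannWith.of_dint (hkc.continuousOn.memLp_volΩ 2) hfix
  have hμ' : (μ : ℂ) ≠ 0 := by exact_mod_cast hμ.ne'
  have hfs : IsSteadyState μ γN γL 0 V f.ext := by
    refine ⟨_, _, hfN, ae_of_all _ fun x => ?_⟩
    simp only [hk]
    push_cast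
    field_simp
    ring
  have hunif : Tendsto (fun n => ‖CI.mk (P (φ n)) (hPN (φ n)).cont - f‖) atTop (𝓝 0) :=
    tendsto_iff_norm_sub_tendsto_zero.1 hf
  have hclose : ∀ n, ∀ x ∈ Icc (-1 : ℝ) 1,
      ‖P (φ n) x - f.ext x‖ ≤ ‖CI.mk (P (φ n)) (hPN (φ n)).cont - f‖ := fun n x hx => by
    rw [← CI.ext_mk (hPN (φ n)).cont hx]
    exact CI.norm_ext_le (CI.mk (P (φ n)) (hPN (φ n)).cont - f) x
  -- A limit of constant modulus contradicts the distance `ε` kept at the points `y n`; a limit with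
  -- a deficit is unstable and passes its instability to the sequence.
  rcases norm_const_or_deficit hμ hγN hγL hfs with hc | hd
  · obtain ⟨n, hn⟩ := (hunif.eventually_lt_const hε).exists
    have h1 := hc _ (hy (φ n))
    have h2 : Real.sqrt (γL / γN) = ‖f.ext (y (φ n))‖ := by
      rw [show γL / γN = ‖f.ext (y (φ n))‖ ^ 2 by field_simp; linarith]
      exact Real.sqrt_sq (norm_nonneg _)
    have h3 := hye (φ n)
    rw [h2] at h3
    have h4 := abs_norm_sub_norm_le (P (φ n) (y (φ n))) (f.ext (y (φ n)))
    linarith [hclose n _ (hy (φ n))]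
  · obtain ⟨Λ, hΛ, hle⟩ := exists_isFirstEigenvalue hμ hγN hfs
    have hpos : 0 < γL / 4 * min 1 (μ / (4 * γL)) := by positivity
    obtain ⟨δ, hδ, H⟩ := exists_unstable_nhds hμ hγN hV.memLp f.continuous_ext.continuousOn
      (by linarith) hΛ
    have hA0' : Tendsto (fun n => |A (φ n)|) atTop (𝓝 0) := by
      simpa using (hA0.comp hφ.tendsto_atTop).abs
    obtain ⟨n, hn1, hn2⟩ :=
      ((hunif.eventually_lt_const hδ).and (hA0'.eventually_lt_const hδ)).exists
    exact hPs (φ n) (H _ _ (hPN (φ n)).cont hn2.le fun x hx => (hclose n x hx).trans hn1.le)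

end compactness

/-! ### The branch of steady states near the homogeneous one -/

section branch

lemma IsUnit.isInvertible_clm {X : Type*} [NormedAddCommGroup X] [NormedSpace ℝ X]
    {T : X →L[ℝ] X} (h : IsUnit T) : T.IsInvertible := by
  obtain ⟨u, rfl⟩ := h
  exact ⟨ContinuousLinearEquiv.unitsEquiv ℝ X u, rfl⟩

variable {X : Type*} [NormedCommRing X] [NormedAlgebra ℝ X] [CompleteSpace X]

/-- Implicit function theorem for `R = K R + D (p R³ - q R + A² (W R²)² R⁻³)` near the constant
solution `R = a` at `A = 0`. -/
lemma exists_implicit_branch (K D W : X →L[ℝ] X) {p q a : ℝ} (ha : a ≠ 0) (hroot : p * a ^ 3 = q * a)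
    (hK : K 1 = 1) (hu : IsUnit (1 - (K + (3 * p * a ^ 2 - q) • D))) :
    ∃ ψ : ℝ → X, Tendsto ψ (𝓝 0) (𝓝 (a • 1)) ∧ ∃ δ > 0,
      (∀ A : ℝ, |A| < δ → ψ A = K (ψ A) + D (p • ψ A ^ 3 - q • ψ A +
        A ^ 2 • (W (ψ A ^ 2) ^ 2 * Ring.inverse (ψ A) ^ 3))) ∧
      ∀ (A : ℝ) (R : X), |A| < δ → ‖R - a • 1‖ < δ →
        R = K R + D (p • R ^ 3 - q • R + A ^ 2 • (W (R ^ 2) ^ 2 * Ring.inverse R ^ 3)) →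
          ψ A = R := by
  set G : ℝ × X → X := fun v => v.2 - (K v.2 + D (p • v.2 ^ 3 - q • v.2 +
    v.1 ^ 2 • (W (v.2 ^ 2) ^ 2 * Ring.inverse v.2 ^ 3))) with hG
  set u : ℝ × X := (0, a • 1) with hu0
  have hau : IsUnit (a • (1 : X)) := by
    simpa [Algebra.algebraMap_eq_smul_one] using (isUnit_iff_ne_zero.2 ha).map (algebraMap ℝ X)
  have hinv : ContDiffAt ℝ 1 (fun v : ℝ × X => Ring.inverse v.2) u := by
    obtain ⟨w, hw⟩ := hau
    have h1 : ContDiffAt ℝ 1 Ring.inverse (Prod.snd u) := by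
      rw [hu0, ← hw]
      exact contDiffAt_ringInverse ℝ w
    exact h1.comp u contDiffAt_snd
  have hGs : ContDiffAt ℝ 1 G u := by
    have h2 : ContDiffAt ℝ 1 (fun v : ℝ × X => v.2) u := contDiffAt_snd
    have h1 : ContDiffAt ℝ 1 (fun v : ℝ × X => v.1) u := contDiffAt_fst
    have h3 : ContDiffAt ℝ 1 (fun v : ℝ × X => W (v.2 ^ 2)) u :=
      W.contDiff.contDiffAt.comp u (h2.pow 2)
    have h4 : ContDiffAt ℝ 1 (fun v : ℝ × X => p • v.2 ^ 3 - q • v.2 +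
        v.1 ^ 2 • (W (v.2 ^ 2) ^ 2 * Ring.inverse v.2 ^ 3)) u :=
      (((h2.pow 3).const_smul p).sub (h2.const_smul q)).add
        ((h1.pow 2).smul ((h3.pow 2).mul (hinv.pow 3)))
    exact h2.sub ((K.contDiff.contDiffAt.comp u h2).add (D.contDiff.contDiffAt.comp u h4))
  have hstrict := hGs.hasStrictFDerivAt one_ne_zero
  -- The nonlocal term carries the factor `A²`, so on the slice `A = 0` only the cubic is
  -- differentiated.
  have hpart : fderiv ℝ G u ∘L .inr ℝ ℝ X = 1 - (K + (3 * p * a ^ 2 - q) • D) := by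
    have h1 : HasFDerivAt (fun R : X => G (0, R)) (fderiv ℝ G u ∘L .inr ℝ ℝ X) (a • 1) :=
      hstrict.hasFDerivAt.comp (a • (1 : X)) (hasFDerivAt_prodMk_right (0 : ℝ) (a • (1 : X)))
    refine h1.unique ?_
    have h2 : HasFDerivAt (fun R : X => R ^ 3) ((3 * a ^ 2) • ContinuousLinearMap.id ℝ X)
        (a • 1) := by
      have h := (hasFDerivAt_id (𝕜 := ℝ) (a • (1 : X))).pow 3
      refine h.congr_fderiv (ContinuousLinearMap.ext fun y => ?_)
      simp [smul_pow, mul_smul, nsmul_eq_mul]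
      rw [show (3 : X) * y = (3 : ℝ) • y by rw [Algebra.smul_def, map_ofNat], smul_comm]
    have h3 : HasFDerivAt (fun R : X => R - (K R + D (p • R ^ 3 - q • R)))
        (ContinuousLinearMap.id ℝ X - (K + D ∘L (p • ((3 * a ^ 2) • ContinuousLinearMap.id ℝ X) -
          q • ContinuousLinearMap.id ℝ X))) (a • 1) :=
      (hasFDerivAt_id _).sub (K.hasFDerivAt.add (D.hasFDerivAt.comp _
        ((h2.const_smul p).sub ((hasFDerivAt_id _).const_smul q))))
    have h4 : (fun R : X => G (0, R)) = fun R : X => R - (K R + D (p • R ^ 3 - q • R)) := by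
      ext R
      simp [hG]
    rw [h4]
    refine h3.congr_fderiv (ContinuousLinearMap.ext fun y => ?_)
    simp only [sub_apply, add_apply, smul_apply, ContinuousLinearMap.comp_apply, map_sub, map_smul,
      ContinuousLinearMap.id_apply, one_apply_eq_self, sub_smul, smul_smul]
    rw [show p * (3 * a ^ 2) = 3 * p * a ^ 2 by ring]
  have hIn : (fderiv ℝ G u ∘L .inr ℝ ℝ X).IsInvertible := by
    rw [hpart]
    exact hu.isInvertible_clm
  have hGu : G u = 0 := by
    have : p • (a • (1 : X)) ^ 3 - q • (a • (1 : X)) = 0 := by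
      rw [smul_pow, one_pow, smul_smul, smul_smul, hroot, sub_self]
    simp only [hG, hu0]
    rw [zero_pow two_ne_zero, zero_smul, add_zero, this, map_zero, add_zero, map_smul, hK, sub_self]
  have hGeq : ∀ (A : ℝ) (R : X), G (A, R) = 0 ↔
      R = K R + D (p • R ^ 3 - q • R + A ^ 2 • (W (R ^ 2) ^ 2 * Ring.inverse R ^ 3)) :=
    fun A R => sub_eq_zero
  have e1 := hstrict.eventually_apply_eq_iff_implicitFunctionOfProdDomain hIn
  have e2 := hstrict.eventually_apply_implicitFunctionOfProdDomain hIn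
  have e3 := hstrict.tendsto_implicitFunctionOfProdDomain hIn
  rw [hGu] at e1 e2
  obtain ⟨δ₁, hδ₁, H₁⟩ := Metric.eventually_nhds_iff.1 e1
  obtain ⟨δ₂, hδ₂, H₂⟩ := Metric.eventually_nhds_iff.1 e2
  refine ⟨_, e3, min δ₁ δ₂, lt_min hδ₁ hδ₂, fun A hA => ?_, fun A R hA hR h => ?_⟩
  · rw [← hGeq]
    exact H₂ (by simpa [hu0] using hA.trans_le (min_le_right _ _))
  · refine (H₁ (y := (A, R)) ?_).1 ((hGeq A R).2 h)
    rw [hu0, Prod.dist_eq, max_lt_iff]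
    constructor
    · simpa using hA.trans_le (min_le_left _ _)
    · rw [dist_eq_norm]
      exact hR.trans_le (min_le_left _ _)

end branch

/-! ### The amplitude equation as a fixed-point problem. -/

section amplitude

variable {μ γN γL A : ℝ} {V : ℝ → ℝ}

/-- The flux `∫ V r²`, normalized to take opposite values at `±1`. -/
noncomputable def flux (V r : ℝ → ℝ) (x : ℝ) : ℝ :=
  (∫ t in (-1 : ℝ)..x, V t * r t ^ 2) - (∫ t in (-1 : ℝ)..1, V t * r t ^ 2) / 2

/-- The right hand side of the equation `r'' = ampSource r` for the amplitude of a steady state. -/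
noncomputable def ampSource (μ γN γL A : ℝ) (V r : ℝ → ℝ) (x : ℝ) : ℝ :=
  (γN * r x ^ 3 - γL * r x) / μ + (A / μ) ^ 2 * (flux V r x ^ 2 * (r x)⁻¹ ^ 3)

/-- `r` is a positive solution of the Neumann problem for the amplitude equation. -/
def IsAmplitude (μ γN γL A : ℝ) (V r : ℝ → ℝ) : Prop :=
  (∀ x ∈ Icc (-1 : ℝ) 1, 0 < r x) ∧ ∃ r₁ r₂ : ℝ → ℝ, H2NeumannWith r r₁ r₂ ∧
    ∀ᵐ x ∂volΩ, r₂ x = ampSource μ γN γL A V r x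

open Classical in
/-- The operator `f ↦ ∫ b f` with the normalization of `flux`. -/
noncomputable def primOp (b : ℝ → ℝ) : CI ℝ →L[ℝ] CI ℝ :=
  if hb : MemLp b ⊤ volΩ then
    LinearMap.mkContinuousOfExistsBound
      { toFun := fun f => CI.mk
          (fun x => (∫ t in (-1 : ℝ)..x, b t * f.ext t) - (∫ t in (-1 : ℝ)..1, b t * f.ext t) / 2)
          ((IsPrim.of_integral (MemLp.mul_CI hb f)).continuousOn.sub continuousOn_const)
        map_add' := fun f g => by
          ext x
          have h : ∀ y ∈ Icc (-1 : ℝ) 1, ∫ t in (-1 : ℝ)..y, b t * (f + g).ext t =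
              (∫ t in (-1 : ℝ)..y, b t * f.ext t) + ∫ t in (-1 : ℝ)..y, b t * g.ext t := by
            intro y hy
            rw [← intervalIntegral.integral_add
              ((MemLp.mul_CI hb f).sub_Icc neg_one_mem_Icc' hy)
              ((MemLp.mul_CI hb g).sub_Icc neg_one_mem_Icc' hy)]
            refine intervalIntegral.integral_congr fun t _ => ?_
            rw [← mul_add]
            rfl
          simp only [CI.mk_apply, ContinuousMap.add_apply, h _ x.2, h _ one_mem_Icc']
          ring
        map_smul' := fun c f => by
          ext x
          have h : ∀ y : ℝ, ∫ t in (-1 : ℝ)..y, b t * (c • f).ext t =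
              c * ∫ t in (-1 : ℝ)..y, b t * f.ext t := by
            intro y
            rw [← intervalIntegral.integral_const_mul]
            refine intervalIntegral.integral_congr fun t _ => ?_
            rw [mul_left_comm]
            rfl
          simp only [CI.mk_apply, ContinuousMap.smul_apply, RingHom.id_apply, smul_eq_mul, h]
          ring }
      (by
        obtain ⟨C, hC0, hC⟩ := MemLp.exists_bound hb
        refine ⟨2 * (2 * C), fun f => ?_⟩
        refine CI.norm_le_of_forall (by positivity) fun x hx => ?_
        rw [CI.ext_of_mem _ hx]
        have h1 := norm_primitive_le (MemLp.mul_CI hb f) hx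
        have h2 := norm_primitive_le (MemLp.mul_CI hb f) one_mem_Icc'
        have h3 := integral_norm_mul_CI_le hC f
        refine (norm_sub_le _ _).trans ?_
        rw [norm_div, Real.norm_ofNat]
        have := norm_nonneg (∫ t in (-1 : ℝ)..1, b t * f.ext t)
        linarith)
  else 0

lemma primOp_apply {b : ℝ → ℝ} (hb : MemLp b ⊤ volΩ) (f : CI ℝ) {x : ℝ}
    (hx : x ∈ Icc (-1 : ℝ) 1) : (primOp b f).ext x =
      (∫ t in (-1 : ℝ)..x, b t * f.ext t) - (∫ t in (-1 : ℝ)..1, b t * f.ext t) / 2 := by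
  rw [primOp, dif_pos hb, CI.ext_of_mem _ hx]
  rfl

lemma flux_congr {r r' : ℝ → ℝ} (h : ∀ x ∈ Icc (-1 : ℝ) 1, r x = r' x) {x : ℝ}
    (hx : x ∈ Icc (-1 : ℝ) 1) : flux V r x = flux V r' x := by
  have h' : ∀ t ∈ Icc (-1 : ℝ) 1, V t * r t ^ 2 = V t * r' t ^ 2 := fun t ht => by rw [h t ht]
  simp only [flux, integral_congr_Icc h' hx, integral_congr_Icc h' one_mem_Icc']

lemma ampSource_congr {r r' : ℝ → ℝ} (h : ∀ x ∈ Icc (-1 : ℝ) 1, r x = r' x) {x : ℝ}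
    (hx : x ∈ Icc (-1 : ℝ) 1) : ampSource μ γN γL A V r x = ampSource μ γN γL A V r' x := by
  simp only [ampSource, h x hx, flux_congr h hx]

lemma IsAmplitude.congr {r r' : ℝ → ℝ} (hr : IsAmplitude μ γN γL A V r)
    (h : ∀ x ∈ Icc (-1 : ℝ) 1, r' x = r x) : IsAmplitude μ γN γL A V r' := by
  obtain ⟨hp, r₁, r₂, hN, he⟩ := hr
  refine ⟨fun x hx => by rw [h x hx]; exact hp x hx, r₁, r₂, hN.congr h (ae_eq_refl _), ?_⟩
  filter_upwards [he, ae_mem_Icc] with x hx hxI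
  rw [hx, ampSource_congr h hxI]

lemma isPrim_flux (hV : MemLp V ⊤ volΩ) {r : ℝ → ℝ} (hr : ContinuousOn r (Icc (-1) 1)) :
    IsPrim (flux V r) (fun x => V x * r x ^ 2) := by
  have h := IsPrim.of_integral (intervalIntegrable_iff_integrable.2
    ((MemLp.mul_continuousOn_volΩ hV (hr.pow 2)).integrable le_top))
  exact (h.const_add (-((∫ t in (-1 : ℝ)..1, V t * r t ^ 2) / 2))).congr
    (fun x _ => by simp only [flux, Pi.pow_apply]; ring) (ae_eq_refl _)

lemma continuousOn_ampSource (hV : MemLp V ⊤ volΩ) {r : ℝ → ℝ} (hr : ContinuousOn r (Icc (-1) 1))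
    (hp : ∀ x ∈ Icc (-1 : ℝ) 1, 0 < r x) :
    ContinuousOn (ampSource μ γN γL A V r) (Icc (-1) 1) := by
  have h1 := (isPrim_flux hV hr).continuousOn
  have h2 : ContinuousOn (fun x => (r x)⁻¹) (Icc (-1) 1) := hr.inv₀ fun x hx => (hp x hx).ne'
  unfold ampSource
  fun_prop

/-- The fixed point formulation of the amplitude equation. -/
lemma isAmplitude_iff (hV : MemLp V ⊤ volΩ) {R : CI ℝ} (hp : ∀ x ∈ Icc (-1 : ℝ) 1, 0 < R.ext x) :
    IsAmplitude μ γN γL A V R.ext ↔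
      R = leftConst ℝ R + dop (fun _ => 1) ((γN / μ) • R ^ 3 - (γL / μ) • R +
        A ^ 2 • (((1 / μ) • primOp V) (R ^ 2) ^ 2 * Ring.inverse R ^ 3)) := by
  have hunit : IsUnit R := by
    rw [ContinuousMap.isUnit_iff_forall_ne_zero]
    intro x
    have := hp x x.2
    rw [CI.ext_coe] at this
    exact this.ne'
  have hinv : ∀ x ∈ Icc (-1 : ℝ) 1, (Ring.inverse R).ext x = (R.ext x)⁻¹ := by
    intro x hx
    have h1 : (R * Ring.inverse R).ext x = R.ext x * (Ring.inverse R).ext x := rfl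
    rw [Ring.mul_inverse_cancel _ hunit] at h1
    exact eq_inv_of_mul_eq_one_right h1.symm
  have hc1 : MemLp (fun _ : ℝ => (1 : ℝ)) ⊤ volΩ := memLp_const _
  have hsrc : ∀ x ∈ Icc (-1 : ℝ) 1, ((γN / μ) • R ^ 3 - (γL / μ) • R +
        A ^ 2 • (((1 / μ) • primOp V) (R ^ 2) ^ 2 * Ring.inverse R ^ 3)).ext x =
          ampSource μ γN γL A V R.ext x := by
    intro x hx
    have h1 : ((γN / μ) • R ^ 3 - (γL / μ) • R +
        A ^ 2 • (((1 / μ) • primOp V) (R ^ 2) ^ 2 * Ring.inverse R ^ 3)).ext x =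
        γN / μ * R.ext x ^ 3 - γL / μ * R.ext x + A ^ 2 * ((1 / μ * (primOp V (R ^ 2)).ext x) ^ 2 *
          (Ring.inverse R).ext x ^ 3) := rfl
    have h2 : (primOp V (R ^ 2)).ext x = flux V R.ext x := primOp_apply hV _ hx
    rw [h1, hinv x hx, h2, ampSource]
    ring
  have hrhs : ∀ x ∈ Icc (-1 : ℝ) 1,
      (leftConst ℝ R + dop (fun _ => 1) ((γN / μ) • R ^ 3 - (γL / μ) • R +
        A ^ 2 • (((1 / μ) • primOp V) (R ^ 2) ^ 2 * Ring.inverse R ^ 3))).ext x =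
      R.ext (-1) + dint (ampSource μ γN γL A V R.ext) x := by
    intro x hx
    rw [← dint_congr (ae_of_forall_Icc hsrc) hx, ← leftConst_apply R x]
    have h1 := dop_apply hc1 ((γN / μ) • R ^ 3 - (γL / μ) • R +
        A ^ 2 • (((1 / μ) • primOp V) (R ^ 2) ^ 2 * Ring.inverse R ^ 3)) hx
    simp only [one_mul] at h1
    rw [← h1]
    rfl
  constructor
  · rintro ⟨-, r₁, r₂, hN, he⟩
    refine CI.ext_inj fun x hx => ?_
    rw [hrhs x hx, hN.eq_dint hx, dint_congr he hx]
  · intro h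
    refine ⟨hp, _, _, H2NeumannWith.of_dint
      ((continuousOn_ampSource hV R.continuous_ext.continuousOn hp).memLp_volΩ 2) fun x hx => ?_,
      ae_eq_refl _⟩
    rw [← hrhs x hx, ← h]

/-- A Neumann solution of `f'' = b f` satisfies `∫ f'² + b ∫ f² = 0`, so it vanishes, and the
Fredholm alternative applies. -/
lemma isUnit_linearized_amplitude {b : ℝ} (hb : 0 < b) :
    IsUnit (1 - (leftConst ℝ + b • dop (fun _ => (1 : ℝ)))) := by
  have hc1 : MemLp (fun _ : ℝ => (1 : ℝ)) ⊤ volΩ := memLp_const _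
  have hc2 : MemLp (fun _ : ℝ => b * 1) ⊤ volΩ := memLp_const _
  rw [smul_dop hc1]
  refine isUnit_one_sub_of_compact (isCompactOperator_leftConst.add (isCompactOperator_dop _))
    fun f hf => ?_
  have hN : H2NeumannWith f.ext (fun s => ∫ t in (-1 : ℝ)..s, b * 1 * f.ext t)
      (fun t => b * 1 * f.ext t) := by
    refine H2NeumannWith.of_dint (MemLp.two_of_top
      (MemLp.mul_continuousOn_volΩ hc2 f.continuous_ext.continuousOn)) fun x hx => ?_
    rw [← dop_apply hc2 f hx, ← leftConst_apply f x]
    conv_lhs => rw [← hf]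
    rfl
  have h1 := (hN.prim.mul hN.prim₁).integral_eq
  rw [hN.left, hN.right, mul_zero, mul_zero, sub_zero] at h1
  have c1 := hN.cont₁
  have c0 := f.continuous_ext.continuousOn (s := Icc (-1 : ℝ) 1)
  have h2 : b * ∫ x in (-1 : ℝ)..1, f.ext x ^ 2 ≤ 0 := by
    rw [← h1, ← intervalIntegral.integral_const_mul]
    refine intervalIntegral.integral_mono_on (by norm_num)
      (ContinuousOn.intervalIntegrable_Icc (by fun_prop))
      (ContinuousOn.intervalIntegrable_Icc (by fun_prop)) fun x hx => ?_
    nlinarith [mul_self_nonneg (∫ t in (-1 : ℝ)..x, b * 1 * f.ext t)]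
  refine CI.ext_inj fun x hx => ?_
  exact eq_zero_of_integral_sq c0 (nonpos_of_mul_nonpos_right h2 hb) x hx

/-- The branch of amplitudes near the homogeneous one. -/
lemma exists_amplitude_branch (hμ : 0 < μ) (hγN : 0 < γN) (hγL : 0 < γL) (hV : MemLp V ⊤ volΩ) :
    ∃ ψ : ℝ → CI ℝ, (∀ ε > 0, ∃ δ > 0, ∀ A, |A| < δ → ∀ x ∈ Icc (-1 : ℝ) 1,
        |(ψ A).ext x - Real.sqrt (γL / γN)| < ε) ∧
      ∃ δ > 0, (∀ A, |A| < δ → IsAmplitude μ γN γL A V (ψ A).ext) ∧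
        ∀ A r, |A| < δ → IsAmplitude μ γN γL A V r →
          (∀ x ∈ Icc (-1 : ℝ) 1, |r x - Real.sqrt (γL / γN)| < δ) →
            ∀ x ∈ Icc (-1 : ℝ) 1, r x = (ψ A).ext x := by
  set a := Real.sqrt (γL / γN) with ha
  have ha2 : a ^ 2 = γL / γN := Real.sq_sqrt (by positivity)
  have ha0 : 0 < a := Real.sqrt_pos.2 (by positivity)
  have hroot : γN / μ * a ^ 3 = γL / μ * a := by
    rw [pow_succ, ha2]
    field_simp
  have hK : leftConst ℝ (1 : CI ℝ) = 1 := CI.ext_inj fun x _ => by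
    rw [leftConst_apply]
    rfl
  -- At the root `a` of the cubic, the slope is `(3 γN a² - γL) / μ = 2 γL / μ > 0`.
  have hu : IsUnit (1 - (leftConst ℝ + (3 * (γN / μ) * a ^ 2 - γL / μ) • dop (fun _ => (1 : ℝ)))) := by
    refine isUnit_linearized_amplitude ?_
    rw [ha2, show 3 * (γN / μ) * (γL / γN) - γL / μ = 2 * γL / μ by field_simp; ring]
    positivity
  obtain ⟨ψ, hψ, δ, hδ, H1, H2⟩ := exists_implicit_branch (leftConst ℝ) (dop fun _ => (1 : ℝ))
    ((1 / μ) • primOp V) ha0.ne' hroot hK hu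
  have hclose : ∀ ε > 0, ∃ δ > 0, ∀ A, |A| < δ → ∀ x ∈ Icc (-1 : ℝ) 1,
      |(ψ A).ext x - a| < ε := by
    intro ε hε
    obtain ⟨η, hη, H⟩ := Metric.tendsto_nhds_nhds.1 hψ ε hε
    refine ⟨η, hη, fun A hA x hx => ?_⟩
    have h1 := H (x := A) (by simpa using hA)
    rw [dist_eq_norm] at h1
    have h2 : (ψ A - a • (1 : CI ℝ)).ext x = (ψ A).ext x - a * 1 := rfl
    have h3 := CI.norm_ext_le (ψ A - a • (1 : CI ℝ)) x
    rw [h2, mul_one, Real.norm_eq_abs] at h3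
    exact h3.trans_lt h1
  refine ⟨ψ, hclose, ?_⟩
  obtain ⟨δ', hδ', H3⟩ := hclose a ha0
  -- `δ'` ensures positivity of the branch; `δ / 2` is there because pointwise strict bounds yield
  -- only a weak bound on the sup norm.
  refine ⟨min (min δ δ') (δ / 2), by positivity, fun A hA => ?_, fun A r hA hr hra x hx => ?_⟩
  · have hA1 : |A| < δ := hA.trans_le ((min_le_left _ _).trans (min_le_left _ _))
    have hA2 : |A| < δ' := hA.trans_le ((min_le_left _ _).trans (min_le_right _ _))
    refine (isAmplitude_iff hV fun x hx => ?_).2 (H1 A hA1)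
    linarith [(abs_lt.1 (H3 A hA2 x hx)).1]
  · have hA1 : |A| < δ := hA.trans_le ((min_le_left _ _).trans (min_le_left _ _))
    obtain ⟨hp, r₁, r₂, hN, he⟩ := id hr
    set R := CI.mk r hN.cont with hR
    have hRr : ∀ x ∈ Icc (-1 : ℝ) 1, R.ext x = r x := fun x hx => CI.ext_mk hN.cont hx
    have h1 := (isAmplitude_iff hV fun x hx => by rw [hRr x hx]; exact hp x hx).1 (hr.congr hRr)
    have h2 : ‖R - a • (1 : CI ℝ)‖ < δ := by
      refine (CI.norm_le_of_forall (C := δ / 2) (by positivity) fun y hy => ?_).trans_lt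
        (by linarith)
      have h3 : (R - a • (1 : CI ℝ)).ext y = R.ext y - a * 1 := rfl
      rw [h3, mul_one, hRr y hy]
      exact (hra y hy).le.trans (min_le_right _ _)
    rw [H2 A R hA1 h2 h1, hRr x hx]

end amplitude

/-! ### Amplitudes and phases of steady states -/

section polar

variable {μ γN γL A : ℝ} {V : ℝ → ℝ}

lemma neg_mem_Icc' {x : ℝ} (hx : x ∈ Icc (-1 : ℝ) 1) : -x ∈ Icc (-1 : ℝ) 1 :=
  ⟨by linarith [hx.2], by linarith [hx.1]⟩

lemma H2NeumannWith.comp_neg {r r₁ r₂ : ℝ → ℝ} (h : H2NeumannWith r r₁ r₂) :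
    H2NeumannWith (fun x => r (-x)) (fun x => -r₁ (-x)) (fun x => r₂ (-x)) where
  hasDeriv x hx := by
    have h1 := (h.hasDeriv (-x) (neg_mem_Icc' hx)).comp x (hasDerivWithinAt_neg x (Icc (-1) 1))
      (fun y hy => neg_mem_Icc' hy)
    rw [← mul_neg_one]
    exact h1
  memLp := h.memLp.comp_measurePreserving measurePreserving_neg_volΩ
  deriv_eq x hx := by
    rw [intervalIntegral.integral_comp_neg (fun t => r₂ t), neg_neg,
      h.prim₁.integral_eq' (neg_mem_Icc' hx) one_mem_Icc']
    ring
  left := by simp [h.right]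
  right := by simp [h.left]

/-- Oddness of `V` reverses the integral, and the normalization with opposite end values is what
makes the constants match. It gives the amplitude equation its reflection symmetry without any
condition on `∫ V r²`. -/
lemma flux_comp_neg (hV : IsShearProfile V) {r : ℝ → ℝ} (hr : ContinuousOn r (Icc (-1) 1)) {x : ℝ}
    (hx : x ∈ Icc (-1 : ℝ) 1) : flux V (fun x => r (-x)) x = flux V r (-x) := by
  have h1 : ∀ y ∈ Icc (-1 : ℝ) 1, ∫ t in (-1 : ℝ)..y, V t * r (-t) ^ 2 =
      -∫ t in (-y)..1, V t * r t ^ 2 := by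
    intro y hy
    have h2 : (fun t => V t * r (-t) ^ 2) =ᵐ[volΩ] fun t => -(V (-t) * r (-t) ^ 2) := by
      filter_upwards [hV.odd] with t ht
      rw [ht]
      ring
    rw [integral_congr_volΩ h2 hy, intervalIntegral.integral_neg,
      intervalIntegral.integral_comp_neg (fun t => V t * r t ^ 2), neg_neg]
  have h3 := isPrim_flux hV.memLp hr
  have h4 := h3.integral_eq' (neg_mem_Icc' hx) one_mem_Icc'
  have h6 := h1 x hx
  have h7 := h1 1 one_mem_Icc'
  simp only [flux] at h4 ⊢
  rw [h6, h7, h4]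
  ring

lemma IsAmplitude.comp_neg (hV : IsShearProfile V) {r : ℝ → ℝ} (h : IsAmplitude μ γN γL A V r) :
    IsAmplitude μ γN γL A V (fun x => r (-x)) := by
  obtain ⟨hp, r₁, r₂, hN, he⟩ := h
  refine ⟨fun x hx => hp _ (neg_mem_Icc' hx), _, _, hN.comp_neg, ?_⟩
  filter_upwards [IsShearProfile.ae_neg_iff he, ae_mem_Icc] with x hx hxI
  rw [hx, ampSource, ampSource, flux_comp_neg hV hN.cont hxI]

/-- For even `r` the flux has equal values at `±1`, and by normalization opposite ones. -/
lemma integral_flux_eq_zero (hV : IsShearProfile V) {r : ℝ → ℝ} (hr : ContinuousOn r (Icc (-1) 1))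
    (heven : ∀ x ∈ Icc (-1 : ℝ) 1, r (-x) = r x) : ∫ t in (-1 : ℝ)..1, V t * r t ^ 2 = 0 := by
  have h1 := flux_comp_neg hV hr one_mem_Icc'
  rw [flux_congr heven one_mem_Icc'] at h1
  simp only [flux, intervalIntegral.integral_same] at h1
  linarith

lemma IsPrim.inv_pos {r r₁ r₂ : ℝ → ℝ} (h : H2NeumannWith r r₁ r₂)
    (hp : ∀ x ∈ Icc (-1 : ℝ) 1, 0 < r x) :
    IsPrim (fun x => (r x)⁻¹) (fun x => -r₁ x / r x ^ 2) := by
  refine IsPrim.of_hasDeriv (fun x hx => (h.hasDeriv x hx).inv (hp x hx).ne') ?_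
  exact h.cont₁.neg.div (h.cont.pow 2) fun x hx => (pow_pos (hp x hx) 2).ne'

lemma MemLp.mul_continuousOn_two {f g : ℝ → ℂ} (hf : MemLp f 2 volΩ)
    (hg : ContinuousOn g (Icc (-1) 1)) : MemLp (fun x => f x * g x) 2 volΩ := by
  have h := MemLp.mul (p := ⊤) (q := 2) (r := 2) hf (hg.memLp_volΩ ⊤)
  exact h.ae_eq (ae_of_all _ fun x => mul_comm _ _)

lemma H2NeumannWith.polar {r r₁ r₂ θ θ₁ θ₂ : ℝ → ℝ} (hr : H2NeumannWith r r₁ r₂)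
    (hθ : H2NeumannWith θ θ₁ θ₂) :
    H2NeumannWith (polar r θ)
      (fun x => ((r₁ x : ℂ) + Complex.I * (r x * θ₁ x)) * Complex.exp (Complex.I * (θ x : ℂ)))
      (fun x => (((r₂ x - r x * θ₁ x ^ 2 : ℝ) : ℂ) +
        Complex.I * ((2 * r₁ x * θ₁ x + r x * θ₂ x : ℝ) : ℂ)) *
          Complex.exp (Complex.I * (θ x : ℂ))) := by
  have hR := hr.ofReal
  have hT := hθ.ofReal
  have he : IsPrim (fun x => Complex.exp (Complex.I * (θ x : ℂ)))
      (fun x => Complex.exp (Complex.I * (θ x : ℂ)) * (Complex.I * θ₁ x)) := by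
    refine IsPrim.of_hasDeriv (fun x hx => ((hT.hasDeriv x hx).const_mul Complex.I).cexp) ?_
    have h1 := hT.cont
    have h2 := hT.cont₁
    fun_prop
  have hm : MemLp (fun x => (((r₂ x - r x * θ₁ x ^ 2 : ℝ) : ℂ) +
        Complex.I * ((2 * r₁ x * θ₁ x + r x * θ₂ x : ℝ) : ℂ)) *
          Complex.exp (Complex.I * (θ x : ℂ))) 2 volΩ := by
    refine MemLp.mul_continuousOn_two ?_ he.continuousOn
    have c1 := hR.cont
    have c2 := hT.cont₁
    have c3 := hR.cont₁
    have m1 := hR.memLp.add (ContinuousOn.memLp_volΩ (f := fun x => -((r x : ℂ) * θ₁ x ^ 2) +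
      Complex.I * (2 * r₁ x * θ₁ x)) (by fun_prop) 2)
    have m2 := m1.add ((MemLp.mul_continuousOn_two hT.memLp c1).const_mul Complex.I)
    refine m2.ae_eq (ae_of_all _ fun x => ?_)
    simp only [Pi.add_apply]
    push_cast
    ring
  refine H2NeumannWith.of_prim ((hR.prim.mul he).congr (fun x _ => rfl)
    (ae_of_all _ fun x => ?_)) (((hR.prim₁.add ((hR.prim.mul hT.prim₁).const_mul Complex.I)).mul
      he).congr (fun x _ => rfl) (ae_of_all _ fun x => ?_)) hm ?_ ?_
  · simp only
    ring
  · simp only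
    push_cast
    linear_combination ((r x : ℂ) * θ₁ x ^ 2 * Complex.exp (Complex.I * (θ x : ℂ))) *
      Complex.I_sq
  · simp [hr.left, hθ.left]
  · simp [hr.right, hθ.right]

/-- The phase belonging to an amplitude. -/
noncomputable def phase (μ A : ℝ) (V r : ℝ → ℝ) (x : ℝ) : ℝ :=
  ∫ t in (-1 : ℝ)..x, A / μ * (flux V r t * ((r t)⁻¹ * (r t)⁻¹))

/-- An even amplitude is the modulus of a steady state. -/
lemma IsAmplitude.isSteadyState (hμ : 0 < μ) (hV : IsShearProfile V) {r : ℝ → ℝ}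
    (h : IsAmplitude μ γN γL A V r) (heven : ∀ x ∈ Icc (-1 : ℝ) 1, r (-x) = r x) :
    MemH2Neumann r ∧ MemH2Neumann (phase μ A V r) ∧
      IsSteadyState μ γN γL A V (polar r (phase μ A V r)) := by
  obtain ⟨hp, r₁, r₂, hN, he⟩ := h
  have hinv := IsPrim.inv_pos hN hp
  have hf := isPrim_flux hV.memLp hN.cont
  have h0 := integral_flux_eq_zero hV hN.cont heven
  have hθp := (hf.mul (hinv.mul hinv)).const_mul (A / μ)
  have hθ : H2NeumannWith (phase μ A V r) (fun x => A / μ * (flux V r x * ((r x)⁻¹ * (r x)⁻¹)))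
      (fun x => A / μ * (V x * r x ^ 2 * ((r x)⁻¹ * (r x)⁻¹) +
        flux V r x * (-r₁ x / r x ^ 2 * (r x)⁻¹ + (r x)⁻¹ * (-r₁ x / r x ^ 2)))) := by
    refine H2NeumannWith.of_prim (IsPrim.of_integral hθp.continuousOn.intervalIntegrable_Icc) hθp
      ?_ ?_ ?_
    · have c1 := hN.cont
      have c2 := hN.cont₁
      have c3 := hf.continuousOn
      have c4 := hinv.continuousOn
      have c5 : ContinuousOn (fun x => -r₁ x / r x ^ 2) (Icc (-1) 1) :=
        c2.neg.div (c1.pow 2) fun x hx => (pow_pos (hp x hx) 2).ne'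
      have m1 := MemLp.two_of_top (MemLp.mul_continuousOn_volΩ hV.memLp
        (f := fun x => r x ^ 2 * ((r x)⁻¹ * (r x)⁻¹)) (by fun_prop))
      have m2 := ContinuousOn.memLp_volΩ (f := fun x => flux V r x *
        (-r₁ x / r x ^ 2 * (r x)⁻¹ + (r x)⁻¹ * (-r₁ x / r x ^ 2))) (by fun_prop) 2
      refine ((m1.add m2).const_mul (A / μ)).ae_eq (ae_of_all _ fun x => ?_)
      simp only [Pi.add_apply]
      ring
    -- Here evenness is needed: the flux, and with it the derivative of the phase, vanishes at the
    -- ends because `∫ V r² = 0`.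
    · simp [flux, h0]
    · simp [flux, h0]
  refine ⟨⟨_, _, hN⟩, ⟨_, _, hθ⟩, _, _, hN.polar hθ, ?_⟩
  filter_upwards [he, ae_mem_Icc] with x hx hxI
  have hrx := hp x hxI
  rw [norm_polar hrx.le, polar]
  -- After removal of the phase factor, `h1` is the real part of the steady equation and `h2` the
  -- imaginary part; naming the two expressions makes the complex identity linear in them.
  have h1 : μ * (r₂ x - r x * (A / μ * (flux V r x * ((r x)⁻¹ * (r x)⁻¹))) ^ 2) =
      γN * r x ^ 3 - γL * r x := by
    rw [hx, ampSource]
    field_simp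
    ring
  have h2 : μ * (2 * r₁ x * (A / μ * (flux V r x * ((r x)⁻¹ * (r x)⁻¹))) +
      r x * (A / μ * (V x * r x ^ 2 * ((r x)⁻¹ * (r x)⁻¹) +
        flux V r x * (-r₁ x / r x ^ 2 * (r x)⁻¹ + (r x)⁻¹ * (-r₁ x / r x ^ 2))))) =
      A * V x * r x := by
    field_simp
    ring
  generalize r₂ x - r x * (A / μ * (flux V r x * ((r x)⁻¹ * (r x)⁻¹))) ^ 2 = y₁ at h1 ⊢
  generalize 2 * r₁ x * (A / μ * (flux V r x * ((r x)⁻¹ * (r x)⁻¹))) +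
      r x * (A / μ * (V x * r x ^ 2 * ((r x)⁻¹ * (r x)⁻¹) +
        flux V r x * (-r₁ x / r x ^ 2 * (r x)⁻¹ + (r x)⁻¹ * (-r₁ x / r x ^ 2)))) = y₂ at h2 ⊢
  have h1' := congrArg (fun y : ℝ => (y : ℂ)) h1
  have h2' := congrArg (fun y : ℝ => (y : ℂ)) h2
  push_cast at h1' h2' ⊢
  linear_combination (-Complex.exp (Complex.I * (phase μ A V r x : ℂ))) * h1' -
    Complex.I * Complex.exp (Complex.I * (phase μ A V r x : ℂ)) * h2'

/-- The modulus of a nowhere vanishing steady state is an amplitude. -/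
lemma exists_norm_amplitude (hμ : 0 < μ) (hV : IsShearProfile V) {P P₁ P₂ : ℝ → ℂ} (hP : H2NeumannWith P P₁ P₂)
    (h : ∀ᵐ x ∂volΩ, P₂ x = (((γN * ‖P x‖ ^ 2 - γL) / μ : ℝ) +
      Complex.I * ((A / μ * V x : ℝ) : ℂ)) * P x)
    (h0 : ∀ x ∈ Icc (-1 : ℝ) 1, P x ≠ 0) :
    ∃ r₁ r₂ : ℝ → ℝ, H2NeumannWith (fun x => ‖P x‖) r₁ r₂ ∧
      (∀ᵐ x ∂volΩ, r₂ x = ampSource μ γN γL A V (fun x => ‖P x‖) x) ∧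
      ∀ x ∈ Icc (-1 : ℝ) 1, conj (P x) * P₁ x =
        ((‖P x‖ * r₁ x : ℝ) : ℂ) + Complex.I * ((A / μ * flux V (fun x => ‖P x‖) x : ℝ) : ℂ) := by
  have hpos : ∀ x ∈ Icc (-1 : ℝ) 1, 0 < ‖P x‖ := fun x hx => norm_pos_iff.2 (h0 x hx)
  have hfl := steady_flux hP h
  have hc : ContinuousOn (fun x => ‖P x‖) (Icc (-1) 1) := hP.cont.norm
  -- The flux of a steady state vanishes at both ends. Keeping the factor `A` here covers `A = 0`,
  -- where `∫ V |P|²` itself need not vanish.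
  have hj1 : ∫ t in (-1 : ℝ)..1, A / μ * V t * ‖P t‖ ^ 2 = 0 := by
    rw [hfl.integral_eq]
    simp [hP.left, hP.right]
  have hmulint : ∀ y : ℝ, ∫ t in (-1 : ℝ)..y, A / μ * V t * ‖P t‖ ^ 2 =
      A / μ * ∫ t in (-1 : ℝ)..y, V t * ‖P t‖ ^ 2 := by
    intro y
    rw [← intervalIntegral.integral_const_mul]
    simp only [mul_assoc]
  have hj : ∀ x ∈ Icc (-1 : ℝ) 1,
      (conj (P x) * P₁ x).im = A / μ * flux V (fun x => ‖P x‖) x := by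
    intro x hx
    have h1 := hfl.integral_eq' neg_one_mem_Icc' hx
    rw [hmulint] at h1 hj1
    simp only [hP.left, mul_zero, Complex.zero_im, sub_zero] at h1
    rw [← h1, flux, mul_sub, ← mul_div_assoc, hj1]
    ring
  set m : ℝ → ℝ := fun x => (conj (P x) * P₁ x).re with hm
  have hmp : IsPrim m (fun x => (conj (P₁ x) * P₁ x + conj (P x) * P₂ x).re) :=
    (hP.prim.map_conj.mul hP.prim₁).re
  have hder : ∀ x ∈ Icc (-1 : ℝ) 1,
      HasDerivWithinAt (fun x => ‖P x‖) (m x * ‖P x‖⁻¹) (Icc (-1) 1) x := by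
    intro x hx
    have h1 := (hP.hasDeriv x hx).norm_sq
    have h2 := h1.sqrt (pow_pos (hpos x hx) 2).ne'
    have h3 : HasDerivWithinAt (fun x => ‖P x‖) _ (Icc (-1) 1) x :=
      h2.congr (fun y _ => (Real.sqrt_sq (norm_nonneg _)).symm) (Real.sqrt_sq (norm_nonneg _)).symm
    convert h3 using 1
    rw [Real.sqrt_sq (norm_nonneg _), hm]
    have := hpos x hx
    have e : inner ℝ (P x) (P₁ x) = (conj (P x) * P₁ x).re := by
      rw [Complex.inner, mul_comm]
    rw [e]
    field_simp
  have hinv : IsPrim (fun x => ‖P x‖⁻¹) (fun x => -(m x * ‖P x‖⁻¹) / ‖P x‖ ^ 2) := by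
    refine IsPrim.of_hasDeriv (fun x hx => (hder x hx).inv (hpos x hx).ne') ?_
    have c1 := hmp.continuousOn
    have c2 : ContinuousOn (fun x => ‖P x‖⁻¹) (Icc (-1) 1) := hc.inv₀ fun x hx => (hpos x hx).ne'
    exact (c1.mul c2).neg.div (hc.pow 2) fun x hx => (pow_pos (hpos x hx) 2).ne'
  have hr₁ := hmp.mul hinv
  have hae : ∀ᵐ x ∂volΩ, (conj (P₁ x) * P₁ x + conj (P x) * P₂ x).re * ‖P x‖⁻¹ +
      m x * (-(m x * ‖P x‖⁻¹) / ‖P x‖ ^ 2) = ampSource μ γN γL A V (fun x => ‖P x‖) x := by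
    filter_upwards [h, ae_mem_Icc] with x hx hxI
    have hr := hpos x hxI
    have e1 : (conj (P x) * P₂ x).re = (γN * ‖P x‖ ^ 2 - γL) / μ * ‖P x‖ ^ 2 := by
      rw [hx, mul_left_comm, mul_comm (conj (P x)), Complex.mul_conj, Complex.normSq_eq_norm_sq,
        add_mul, mul_assoc, ← Complex.ofReal_mul, ← Complex.ofReal_mul, Complex.add_re,
        Complex.ofReal_re, Complex.I_mul_re, Complex.ofReal_im, neg_zero, add_zero]
    have e2 : (conj (P₁ x) * P₁ x).re = ‖P₁ x‖ ^ 2 := by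
      rw [mul_comm, Complex.mul_conj, Complex.normSq_eq_norm_sq, Complex.ofReal_re]
    -- Splitting `conj P * P₁` into real and imaginary parts separates radial and angular speed; the
    -- angular one is the flux and produces the centrifugal term.
    have e3 : ‖P₁ x‖ ^ 2 * ‖P x‖ ^ 2 = m x ^ 2 + (A / μ * flux V (fun x => ‖P x‖) x) ^ 2 := by
      rw [← hj x hxI, hm, ← mul_pow, mul_comm ‖P₁ x‖, ← RCLike.norm_conj (P x), ← norm_mul,
        Complex.sq_norm, Complex.normSq_apply]
      ring
    have e4 : ‖P₁ x‖ ^ 2 = (m x ^ 2 + (A / μ * flux V (fun x => ‖P x‖) x) ^ 2) / ‖P x‖ ^ 2 := by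
      rw [← e3]
      field_simp
    rw [Complex.add_re, e1, e2, e4, ampSource]
    field_simp
    ring
  refine ⟨_, _, H2NeumannWith.of_prim (IsPrim.of_hasDeriv hder hr₁.continuousOn) hr₁ ?_ ?_ ?_, hae,
    fun x hx => ?_⟩
  · exact ((continuousOn_ampSource hV.memLp hc hpos).memLp_volΩ 2).ae_eq
      (hae.mono fun x hx => hx.symm)
  · simp [hm, hP.left]
  · simp [hm, hP.right]
  · have := hpos x hx
    refine Complex.ext ?_ ?_
    · simp only [Complex.add_re, Complex.ofReal_re, Complex.I_mul_re, Complex.ofReal_im, neg_zero,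
        add_zero, hm]
      field_simp
    · simp only [Complex.add_im, Complex.ofReal_im, Complex.I_mul_im, Complex.ofReal_re, zero_add]
      exact hj x hx

/-- Nowhere vanishing steady states with the same modulus differ by a constant phase. -/
lemma eq_phase_of_norm_eq (hμ : 0 < μ) (hV : IsShearProfile V) {P Q : ℝ → ℂ}
    (hP : IsSteadyState μ γN γL A V P) (hQ : IsSteadyState μ γN γL A V Q)
    (h0 : ∀ x ∈ Icc (-1 : ℝ) 1, P x ≠ 0) (hPQ : ∀ x ∈ Icc (-1 : ℝ) 1, ‖P x‖ = ‖Q x‖) :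
    ∃ c : ℝ, ∀ x ∈ Icc (-1 : ℝ) 1, P x = Complex.exp (Complex.I * (c : ℂ)) * Q x := by
  obtain ⟨P₁, P₂, hPN, hPe⟩ := hP
  obtain ⟨Q₁, Q₂, hQN, hQe⟩ := hQ
  have h0' : ∀ x ∈ Icc (-1 : ℝ) 1, Q x ≠ 0 := fun x hx => by
    rw [← norm_pos_iff, ← hPQ x hx, norm_pos_iff]
    exact h0 x hx
  obtain ⟨r₁, r₂, hr, -, hPr⟩ := exists_norm_amplitude hμ hV hPN (steady_second_deriv hμ hPe) h0
  obtain ⟨s₁, s₂, hs, -, hQs⟩ := exists_norm_amplitude hμ hV hQN (steady_second_deriv hμ hQe) h0'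
  have hrs : ∀ x ∈ Icc (-1 : ℝ) 1, r₁ x = s₁ x := fun x hx =>
    (uniqueDiffOn_Icc (by norm_num) x hx).eq_deriv _ (hr.hasDeriv x hx)
      ((hs.hasDeriv x hx).congr hPQ (hPQ x hx))
  -- Both parts of `conj P * P₁` depend on the modulus alone. With equal moduli this makes the
  -- derivative of `P / Q` vanish.
  have hcross : ∀ x ∈ Icc (-1 : ℝ) 1, conj (P x) * P₁ x = conj (Q x) * Q₁ x := fun x hx => by
    rw [hPr x hx, hQs x hx, hPQ x hx, hrs x hx, flux_congr hPQ hx]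
  have hconst : IsPrim (fun x => P x / Q x) (fun _ => 0) := by
    refine IsPrim.of_hasDeriv (fun x hx => ?_) continuousOn_const
    have h1 := (hPN.hasDeriv x hx).div (hQN.hasDeriv x hx) (h0' x hx)
    have e : conj (P x) * P x = conj (Q x) * Q x := by
      rw [mul_comm, mul_comm (conj (Q x)), Complex.mul_conj, Complex.mul_conj,
        Complex.normSq_eq_norm_sq, Complex.normSq_eq_norm_sq, hPQ x hx]
    have hc : conj (P x) ≠ 0 := by simpa using h0 x hx
    have hcQ : conj (Q x) ≠ 0 := by simpa using h0' x hx
    have e2 : P₁ x * Q x - P x * Q₁ x = 0 := by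
      have e3 : conj (P x) * conj (Q x) * (P₁ x * Q x - P x * Q₁ x) = 0 := by
        linear_combination (conj (Q x) * Q x) * hcross x hx - (conj (Q x) * Q₁ x) * e
      exact (mul_eq_zero.1 e3).resolve_left (mul_ne_zero hc hcQ)
    rw [e2, zero_div] at h1
    exact h1
  have hu : ‖P (-1) / Q (-1)‖ = 1 := by
    rw [norm_div, hPQ _ neg_one_mem_Icc', div_self (norm_ne_zero_iff.2 (h0' _ neg_one_mem_Icc'))]
  refine ⟨(P (-1) / Q (-1)).arg, fun x hx => ?_⟩
  have h1 := hconst.integral_eq' neg_one_mem_Icc' hx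
  simp only [intervalIntegral.integral_zero] at h1
  have h2 := Complex.norm_mul_exp_arg_mul_I (P (-1) / Q (-1))
  rw [hu, Complex.ofReal_one, one_mul, mul_comm] at h2
  rw [h2, ← sub_eq_zero.1 h1.symm, div_mul_cancel₀ _ (h0' x hx)]

end polar

/-! ### Stability of nearly homogeneous steady states -/

section stability

variable {μ γN γL A : ℝ} {V : ℝ → ℝ}

/-- Pair the residual with `conj u` and integrate by parts; the contribution of `z.re ≥ 0` has the
favourable sign and is discarded. -/
lemma neumann_energy_le {u u₁ u₂ : ℝ → ℂ} (hu : H2NeumannWith u u₁ u₂) {z : ℂ} (hz : 0 ≤ z.re)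
    {b : ℝ} {h : ℝ → ℝ} (hh : ContinuousOn h (Icc (-1) 1))
    (hF : ∀ᵐ x ∂volΩ, ‖(μ : ℂ) * u₂ x - (z + b) * u x‖ ≤ h x) :
    μ * (∫ x in (-1 : ℝ)..1, ‖u₁ x‖ ^ 2) + b * (∫ x in (-1 : ℝ)..1, ‖u x‖ ^ 2) ≤
      ∫ x in (-1 : ℝ)..1, h x * ‖u x‖ := by
  have hp := (hu.prim.map_conj.mul hu.prim₁).re
  have h1 := hp.integral_eq
  simp only [hu.left, hu.right, mul_zero, Complex.zero_re, sub_zero] at h1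
  have c := hu.cont
  have c1 := hu.cont₁
  have i1 : IntervalIntegrable (fun x => ‖u₁ x‖ ^ 2) volume (-1) 1 :=
    ContinuousOn.intervalIntegrable_Icc (by fun_prop)
  have i2 : IntervalIntegrable (fun x => ‖u x‖ ^ 2) volume (-1) 1 :=
    ContinuousOn.intervalIntegrable_Icc (by fun_prop)
  have i3 : IntervalIntegrable (fun x => h x * ‖u x‖) volume (-1) 1 :=
    ContinuousOn.intervalIntegrable_Icc (by fun_prop)
  have h2 : ∫ x in (-1 : ℝ)..1, (μ * ‖u₁ x‖ ^ 2 + b * ‖u x‖ ^ 2 - h x * ‖u x‖) ≤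
      ∫ x in (-1 : ℝ)..1, μ * (conj (u₁ x) * u₁ x + conj (u x) * u₂ x).re := by
    refine intervalIntegral.integral_mono_ae_restrict (by norm_num)
      (((i1.const_mul μ).add (i2.const_mul b)).sub i3) (hp.int.const_mul μ) ?_
    filter_upwards [hF] with x hx
    have e1 : (conj (u₁ x) * u₁ x).re = ‖u₁ x‖ ^ 2 := by
      rw [mul_comm, Complex.mul_conj, Complex.normSq_eq_norm_sq, Complex.ofReal_re]
    have e2 : μ * (conj (u x) * u₂ x).re = (z.re + b) * ‖u x‖ ^ 2 +
        (conj (u x) * ((μ : ℂ) * u₂ x - (z + b) * u x)).re := by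
      have : (μ : ℂ) * (conj (u x) * u₂ x) = (z + b) * (‖u x‖ ^ 2 : ℝ) +
          conj (u x) * ((μ : ℂ) * u₂ x - (z + b) * u x) := by
        rw [← Complex.normSq_eq_norm_sq, ← Complex.mul_conj]
        ring
      have := congrArg Complex.re this
      rwa [Complex.re_ofReal_mul, Complex.add_re, Complex.re_mul_ofReal, Complex.add_re,
        Complex.ofReal_re] at this
    have e3 := (Complex.abs_re_le_norm (conj (u x) * ((μ : ℂ) * u₂ x - (z + b) * u x)))
    rw [norm_mul, RCLike.norm_conj] at e3
    have e4 := (abs_le.1 e3).1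
    have e5 := mul_le_mul_of_nonneg_left hx (norm_nonneg (u x))
    rw [Complex.add_re, mul_add, e1, e2]
    nlinarith [mul_nonneg hz (sq_nonneg ‖u x‖)]
  rw [intervalIntegral.integral_const_mul, h1, mul_zero, intervalIntegral.integral_sub
    ((i1.const_mul μ).add (i2.const_mul b)) i3, intervalIntegral.integral_add (i1.const_mul μ)
    (i2.const_mul b), intervalIntegral.integral_const_mul, intervalIntegral.integral_const_mul] at h2
  linarith

/-- Poincaré inequality for functions with vanishing mean. -/
lemma integral_norm_sq_le_of_mean_zero {u u₁ u₂ : ℝ → ℂ} (hu : H2NeumannWith u u₁ u₂)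
    (h0 : ∫ x in (-1 : ℝ)..1, u x = 0) :
    ∫ x in (-1 : ℝ)..1, ‖u x‖ ^ 2 ≤ 4 * ∫ x in (-1 : ℝ)..1, ‖u₁ x‖ ^ 2 := by
  set D := ∫ x in (-1 : ℝ)..1, ‖u₁ x‖ ^ 2 with hD
  have hD0 : 0 ≤ D := intervalIntegral.integral_nonneg (by norm_num) fun x _ => sq_nonneg _
  have c := hu.cont
  have hpt : ∀ x ∈ Icc (-1 : ℝ) 1, ‖u x‖ ^ 2 ≤ 2 * D := by
    intro x hx
    have h1 : ∀ y ∈ uIoc (-1 : ℝ) 1, ‖u x - u y‖ ≤ Real.sqrt (2 * D) := by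
      intro y hy
      rw [uIoc_of_le (by norm_num)] at hy
      have hy' : y ∈ Icc (-1 : ℝ) 1 := ⟨hy.1.le, hy.2⟩
      refine Real.le_sqrt_of_sq_le ((hu.norm_sub_sq_le hy' hx).trans ?_)
      refine mul_le_mul_of_nonneg_right (abs_le.2 ⟨?_, ?_⟩) hD0
      · linarith [hx.1, hy.2]
      · linarith [hx.2, hy.1]
    have h2 := intervalIntegral.norm_integral_le_of_norm_le_const h1
    rw [intervalIntegral.integral_sub intervalIntegrable_const c.intervalIntegrable_Icc, h0,
      intervalIntegral.integral_const, sub_zero, norm_smul, Real.norm_eq_abs,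
      show |(1 : ℝ) - -1| = 2 by norm_num] at h2
    have h3 : ‖u x‖ ≤ Real.sqrt (2 * D) := by linarith
    calc ‖u x‖ ^ 2 ≤ Real.sqrt (2 * D) ^ 2 := pow_le_pow_left₀ (norm_nonneg _) h3 2
      _ = 2 * D := Real.sq_sqrt (by positivity)
  have h4 := intervalIntegral.integral_mono_on (by norm_num : (-1 : ℝ) ≤ 1)
    (ContinuousOn.intervalIntegrable_Icc (f := fun x => ‖u x‖ ^ 2) (by fun_prop))
    intervalIntegrable_const hpt
  rw [intervalIntegral.integral_const, smul_eq_mul] at h4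
  linarith

lemma sq_integral_le_two_mul {g : ℝ → ℝ} (hg : ContinuousOn g (Icc (-1) 1)) :
    (∫ x in (-1 : ℝ)..1, g x) ^ 2 ≤ 2 * ∫ x in (-1 : ℝ)..1, g x ^ 2 := by
  have := sq_integral_le hg neg_one_mem_Icc' one_mem_Icc' (by norm_num)
  norm_num at this
  exact this

/-- This integral is the value of `∫ (φ - ψ)` on the neutral pair `(P, -conj P)`. Being bounded away
from zero, it allows the mean of `φ - ψ` to be removed by subtracting a multiple of that pair. -/
lemma norm_integral_add_conj {P : ℝ → ℂ} (hc : ContinuousOn P (Icc (-1) 1)) {a ε : ℝ} (ha : 0 < a)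
    (hεa : ε ≤ a / 2) (hP : ∀ x ∈ Icc (-1 : ℝ) 1, ‖P x - a‖ ≤ ε) :
    2 * a ≤ ‖∫ x in (-1 : ℝ)..1, (P x + conj (P x))‖ := by
  have hcc : ContinuousOn (fun x => conj (P x)) (Icc (-1) 1) :=
    Complex.continuous_conj.comp_continuousOn hc
  have h1 : ∀ x ∈ uIoc (-1 : ℝ) 1, ‖(P x + conj (P x)) - 2 * (a : ℂ)‖ ≤ a := by
    intro x hx
    rw [uIoc_of_le (by norm_num)] at hx
    have h2 := hP x ⟨hx.1.le, hx.2⟩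
    have e : (P x + conj (P x)) - 2 * (a : ℂ) = (P x - a) + conj (P x - a) := by
      rw [map_sub, Complex.conj_ofReal]
      ring
    rw [e]
    refine (norm_add_le _ _).trans ?_
    rw [RCLike.norm_conj]
    linarith
  have h2 := intervalIntegral.norm_integral_le_of_norm_le_const h1
  rw [intervalIntegral.integral_sub (ContinuousOn.intervalIntegrable_Icc
    (f := fun x => P x + conj (P x)) (hc.add hcc)) intervalIntegrable_const,
    intervalIntegral.integral_const, show |(1 : ℝ) - -1| = 2 by norm_num] at h2
  have h3 := norm_sub_norm_le (((1 : ℝ) - -1) • (2 * (a : ℂ)))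
    (∫ x in (-1 : ℝ)..1, (P x + conj (P x)))
  rw [norm_sub_rev] at h3
  rw [norm_smul, norm_mul, Complex.norm_real, Real.norm_eq_abs, Real.norm_eq_abs, abs_of_pos ha,
    show |(1 : ℝ) - -1| = 2 by norm_num, Complex.norm_ofNat] at h3
  linarith

set_option maxHeartbeats 1000000 in
/-- Modes orthogonal to the neutral one are damped near the homogeneous steady state. -/
lemma damped_modes_eq_zero (hμ : 0 < μ) (hγN : 0 < γN) (hγL : 0 < γL) {a C ε : ℝ} (ha : 0 < a)
    (haL : γN * a ^ 2 = γL) (hC : ∀ᵐ x ∂volΩ, |V x| ≤ C) (hC0 : 0 ≤ C) (hε : 0 ≤ ε)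
    (hεa : ε ≤ a / 2)
    (hsmall : 26 * ((C + 9 * a * γN) * ε) * (1 / (2 * γL) + 4 / μ) ≤ 1) (hA : |A| ≤ ε)
    {P : ℝ → ℂ} (hPc : ContinuousOn P (Icc (-1) 1)) (hP : ∀ x ∈ Icc (-1 : ℝ) 1, ‖P x - a‖ ≤ ε)
    {φ φ₁ φ₂ ψ ψ₁ ψ₂ : ℝ → ℂ} (hφ : H2NeumannWith φ φ₁ φ₂) (hψ : H2NeumannWith ψ ψ₁ ψ₂)
    {z β : ℂ} (hz : 0 ≤ z.re)
    (e1 : ∀ᵐ x ∂volΩ, (μ : ℂ) * φ₂ x + ((γL : ℂ) - Complex.I * (A : ℂ) * (V x : ℂ)) * φ x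
      - (γN : ℂ) * (2 * (‖P x‖ : ℂ) ^ 2 * φ x + P x ^ 2 * ψ x) = z * φ x + β * P x)
    (e2 : ∀ᵐ x ∂volΩ, (μ : ℂ) * ψ₂ x + ((γL : ℂ) + Complex.I * (A : ℂ) * (V x : ℂ)) * ψ x
      - (γN : ℂ) * (2 * (‖P x‖ : ℂ) ^ 2 * ψ x + conj (P x) ^ 2 * φ x) =
        z * ψ x - β * conj (P x))
    (hmean : ∫ x in (-1 : ℝ)..1, (φ x - ψ x) = 0) :
    (∀ x ∈ Icc (-1 : ℝ) 1, φ x = 0 ∧ ψ x = 0) ∧ β = 0 := by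
  -- The perturbation of each row has coefficients at most `(C + 6 a γN) ε` and `3 a γN ε`; `K ε`
  -- dominates both.
  set K := C + 9 * a * γN with hK
  have hK0 : 0 ≤ K := by positivity
  set G : ℝ → ℝ := fun x => ‖φ x + ψ x‖ + ‖φ x - ψ x‖ with hG
  have cφ := hφ.cont
  have cψ := hψ.cont
  have cG : ContinuousOn G (Icc (-1) 1) := by fun_prop
  have hsumG : ∀ x, ‖φ x‖ + ‖ψ x‖ ≤ G x := by
    intro x
    have h1 : ‖φ x‖ ≤ (‖φ x + ψ x‖ + ‖φ x - ψ x‖) / 2 := by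
      have := norm_add_le (φ x + ψ x) (φ x - ψ x)
      rw [show φ x + ψ x + (φ x - ψ x) = 2 * φ x by ring, norm_mul, Complex.norm_ofNat] at this
      linarith
    have h2 : ‖ψ x‖ ≤ (‖φ x + ψ x‖ + ‖φ x - ψ x‖) / 2 := by
      have := norm_sub_le (φ x + ψ x) (φ x - ψ x)
      rw [show φ x + ψ x - (φ x - ψ x) = 2 * ψ x by ring, norm_mul, Complex.norm_ofNat] at this
      linarith
    simp only [hG]
    linarith
  have haLC : (γN : ℂ) * (a : ℂ) ^ 2 = γL := by exact_mod_cast haL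
  have hPa : ∀ x ∈ Icc (-1 : ℝ) 1, ‖P x‖ ≤ 3 / 2 * a := fun x hx => by
    have h1 := norm_add_le (P x - a) (a : ℂ)
    rw [sub_add_cancel, Complex.norm_real, Real.norm_eq_abs, abs_of_pos ha] at h1
    linarith [hP x hx]
  have hsq : ∀ x ∈ Icc (-1 : ℝ) 1, ‖P x ^ 2 - (a : ℂ) ^ 2‖ ≤ 3 * a * ε := fun x hx => by
    rw [show P x ^ 2 - (a : ℂ) ^ 2 = (P x - a) * (P x + a) by ring, norm_mul, mul_comm]
    refine mul_le_mul ((norm_add_le _ _).trans ?_) (hP x hx) (norm_nonneg _) (by positivity)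
    rw [Complex.norm_real, Real.norm_eq_abs, abs_of_pos ha]
    linarith [hPa x hx]
  have hsqc : ∀ x ∈ Icc (-1 : ℝ) 1, ‖conj (P x) ^ 2 - (a : ℂ) ^ 2‖ ≤ 3 * a * ε := fun x hx => by
    rw [← RCLike.norm_conj]
    simpa using hsq x hx
  have hnsq : ∀ x ∈ Icc (-1 : ℝ) 1, ‖(‖P x‖ : ℂ) ^ 2 - (a : ℂ) ^ 2‖ ≤ 3 * a * ε := fun x hx => by
    rw [show (‖P x‖ : ℂ) ^ 2 - (a : ℂ) ^ 2 = (((‖P x‖ - a) * (‖P x‖ + a) : ℝ) : ℂ) by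
      push_cast; ring, Complex.norm_real, norm_mul, mul_comm, Real.norm_eq_abs, Real.norm_eq_abs,
      abs_of_nonneg (by positivity : 0 ≤ ‖P x‖ + a)]
    have h1 := abs_norm_sub_norm_le (P x) (a : ℂ)
    rw [Complex.norm_real, Real.norm_eq_abs, abs_of_pos ha] at h1
    exact mul_le_mul (by linarith [hPa x hx]) (h1.trans (hP x hx)) (abs_nonneg _) (by positivity)
  have herr : ∀ (x : ℝ) (q u v : ℂ), x ∈ Icc (-1 : ℝ) 1 → |V x| ≤ C → ‖q - (a : ℂ) ^ 2‖ ≤ 3 * a * ε →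
      ∀ s : ℂ, ‖s‖ = 1 → ‖s * (Complex.I * (A : ℂ) * (V x : ℂ)) * u +
        (γN : ℂ) * (2 * ((‖P x‖ : ℂ) ^ 2 - (a : ℂ) ^ 2) * u + (q - (a : ℂ) ^ 2) * v)‖ ≤
        K * ε * (‖u‖ + ‖v‖) := by
    intro x q u v hx hVx hq s hs
    refine (norm_add_le _ _).trans ?_
    rw [norm_mul, norm_mul, norm_mul, norm_mul, hs, Complex.norm_I, norm_mul (γN : ℂ),
      Complex.norm_real, Complex.norm_real, Complex.norm_real, Real.norm_eq_abs, Real.norm_eq_abs,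
      Real.norm_eq_abs, abs_of_pos hγN, one_mul, one_mul]
    have h1 : |A| * |V x| ≤ ε * C := mul_le_mul hA hVx (abs_nonneg _) hε
    have h2 : ‖2 * ((‖P x‖ : ℂ) ^ 2 - (a : ℂ) ^ 2) * u + (q - (a : ℂ) ^ 2) * v‖ ≤
        2 * (3 * a * ε) * ‖u‖ + 3 * a * ε * ‖v‖ := by
      refine (norm_add_le _ _).trans ?_
      rw [norm_mul, norm_mul, norm_mul, Complex.norm_ofNat]
      have := hnsq x hx
      gcongr
    have h3 : |A| * |V x| * ‖u‖ ≤ ε * C * ‖u‖ := mul_le_mul_of_nonneg_right h1 (norm_nonneg _)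
    have h4 := mul_le_mul_of_nonneg_left h2 hγN.le
    have h5 : 0 ≤ γN * a * ε * ‖u‖ := by positivity
    have h6 : 0 ≤ γN * a * ε * ‖v‖ := by positivity
    have h7 : 0 ≤ C * ε * ‖v‖ := by positivity
    rw [hK]
    linarith
  -- At `A = 0` and `P = a` both rows reduce to the potential term `γL (φ + ψ)`. The sum of the rows
  -- then sees `2 γL` and their difference sees no potential.
  have hE : ∀ᵐ x ∂volΩ, ‖(μ : ℂ) * φ₂ x - γL * (φ x + ψ x) - z * φ x - β * P x‖ ≤ K * ε * G x ∧
      ‖(μ : ℂ) * ψ₂ x - γL * (φ x + ψ x) - z * ψ x + β * conj (P x)‖ ≤ K * ε * G x := by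
    filter_upwards [e1, e2, hC, ae_mem_Icc] with x h1 h2 hVx hx
    constructor
    · have h3 := herr x (P x ^ 2) (φ x) (ψ x) hx hVx (hsq x hx) 1 (by simp)
      refine (le_of_eq ?_).trans (h3.trans (mul_le_mul_of_nonneg_left (hsumG x) (by positivity)))
      congr 1
      linear_combination h1 + (2 * φ x + ψ x) * haLC
    · have h3 := herr x (conj (P x) ^ 2) (ψ x) (φ x) hx hVx (hsqc x hx) (-1) (by simp)
      refine (le_of_eq ?_).trans (h3.trans (mul_le_mul_of_nonneg_left
        (by rw [add_comm]; exact hsumG x) (by positivity)))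
      congr 1
      linear_combination h2 + (2 * ψ x + φ x) * haLC
  have hs := hφ.add hψ
  have hd := hφ.sub hψ
  set S := ∫ x in (-1 : ℝ)..1, G x with hS
  have hG0 : ∀ x, 0 ≤ G x := fun x => by positivity
  have hS0 : 0 ≤ S := intervalIntegral.integral_nonneg (by norm_num) fun x _ => hG0 x
  have cPc : ContinuousOn (fun x => conj (P x)) (Icc (-1) 1) :=
    Complex.continuous_conj.comp_continuousOn hPc
  -- Integrate the difference of the rows: the second derivatives drop by the Neumann conditions and
  -- the `z` term by the zero mean, leaving `β` times an integral of size at least `2 a`.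
  have hβ : a * ‖β‖ ≤ K * ε * S := by
    have i1 := hd.int.const_mul (μ : ℂ)
    have i2 := hd.cont.intervalIntegrable_Icc.const_mul z
    have i3 := (ContinuousOn.intervalIntegrable_Icc (f := fun x => P x + conj (P x))
      (hPc.add cPc)).const_mul β
    have h1 : ‖∫ x in (-1 : ℝ)..1, ((μ : ℂ) * (φ₂ x - ψ₂ x) - z * (φ x - ψ x) -
        β * (P x + conj (P x)))‖ ≤ ∫ x in (-1 : ℝ)..1, 2 * (K * ε) * G x := by
      refine intervalIntegral.norm_integral_le_of_norm_le (by norm_num) ?_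
        (cG.intervalIntegrable_Icc.const_mul _)
      have := ae_uIoc_of_ae hE one_mem_Icc'
      rw [uIoc_of_le (by norm_num)] at this
      filter_upwards [this] with x hx hxI
      obtain ⟨h1, h2⟩ := hx hxI
      refine le_trans (le_of_eq ?_) ((norm_sub_le _ _).trans (add_le_add h1 h2) |>.trans (by linarith))
      congr 1
      ring
    rw [intervalIntegral.integral_sub (i1.sub i2) i3, intervalIntegral.integral_sub i1 i2,
      intervalIntegral.integral_const_mul, intervalIntegral.integral_const_mul,
      intervalIntegral.integral_const_mul, intervalIntegral.integral_const_mul, hmean,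
      hd.integral_eq_zero, mul_zero, mul_zero, sub_zero, zero_sub, norm_neg, norm_mul] at h1
    have h2 := norm_integral_add_conj hPc ha hεa hP
    have h3 := mul_le_mul_of_nonneg_left h2 (norm_nonneg β)
    linarith
  set h : ℝ → ℝ := fun x => 3 * (a * ‖β‖) + 2 * (K * ε) * G x with hh
  have ch : ContinuousOn h (Icc (-1) 1) := by fun_prop
  have hPP : ∀ x ∈ Icc (-1 : ℝ) 1, ∀ w : ℂ, ‖w‖ ≤ ‖P x‖ + ‖conj (P x)‖ → ‖β * w‖ ≤ 3 * (a * ‖β‖) := by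
    intro x hx w hw
    rw [RCLike.norm_conj] at hw
    rw [norm_mul]
    have h1 := mul_le_mul_of_nonneg_left (hw.trans (add_le_add (hPa x hx) (hPa x hx)))
      (norm_nonneg β)
    linarith
  have Es := neumann_energy_le (μ := μ) hs hz (b := 2 * γL) ch (by
    filter_upwards [hE, ae_mem_Icc] with x hx hxI
    have h3 := hPP x hxI (P x - conj (P x)) (norm_sub_le _ _)
    have h4 := norm_add_le ((μ : ℂ) * φ₂ x - γL * (φ x + ψ x) - z * φ x - β * P x)
      ((μ : ℂ) * ψ₂ x - γL * (φ x + ψ x) - z * ψ x + β * conj (P x))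
    have h5 := norm_add_le (β * (P x - conj (P x)))
      ((μ : ℂ) * φ₂ x - γL * (φ x + ψ x) - z * φ x - β * P x +
        ((μ : ℂ) * ψ₂ x - γL * (φ x + ψ x) - z * ψ x + β * conj (P x)))
    refine le_trans (le_of_eq ?_) (h5.trans (add_le_add h3 (h4.trans (add_le_add hx.1 hx.2)))
      |>.trans (by simp only [hh]; linarith))
    congr 1
    push_cast
    ring)
  have Ed := neumann_energy_le (μ := μ) hd hz (b := 0) ch (by
    filter_upwards [hE, ae_mem_Icc] with x hx hxI
    have h3 := hPP x hxI (P x + conj (P x)) (norm_add_le _ _)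
    have h4 := norm_sub_le ((μ : ℂ) * φ₂ x - γL * (φ x + ψ x) - z * φ x - β * P x)
      ((μ : ℂ) * ψ₂ x - γL * (φ x + ψ x) - z * ψ x + β * conj (P x))
    have h5 := norm_add_le (β * (P x + conj (P x)))
      ((μ : ℂ) * φ₂ x - γL * (φ x + ψ x) - z * φ x - β * P x -
        ((μ : ℂ) * ψ₂ x - γL * (φ x + ψ x) - z * ψ x + β * conj (P x)))
    refine le_trans (le_of_eq ?_) (h5.trans (add_le_add h3 (h4.trans (add_le_add hx.1 hx.2)))
      |>.trans (by simp only [hh]; linarith))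
    congr 1
    push_cast
    ring)
  set Ns := ∫ x in (-1 : ℝ)..1, ‖φ x + ψ x‖ ^ 2 with hNs
  set Nd := ∫ x in (-1 : ℝ)..1, ‖φ x - ψ x‖ ^ 2 with hNd
  have is : IntervalIntegrable (fun x => ‖φ x + ψ x‖ ^ 2) volume (-1) 1 :=
    ContinuousOn.intervalIntegrable_Icc (by fun_prop)
  have id : IntervalIntegrable (fun x => ‖φ x - ψ x‖ ^ 2) volume (-1) 1 :=
    ContinuousOn.intervalIntegrable_Icc (by fun_prop)
  have hNs0 : 0 ≤ Ns := intervalIntegral.integral_nonneg (by norm_num) fun x _ => sq_nonneg _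
  have hNd0 : 0 ≤ Nd := intervalIntegral.integral_nonneg (by norm_num) fun x _ => sq_nonneg _
  have hGG : ∫ x in (-1 : ℝ)..1, G x ^ 2 ≤ 2 * (Ns + Nd) := by
    rw [hNs, hNd, ← intervalIntegral.integral_add is id, ← intervalIntegral.integral_const_mul]
    refine intervalIntegral.integral_mono_on (by norm_num)
      (ContinuousOn.intervalIntegrable_Icc (by fun_prop)) ((is.add id).const_mul 2) fun x _ => ?_
    simp only [hG]
    nlinarith [sq_nonneg (‖φ x + ψ x‖ - ‖φ x - ψ x‖)]
  have hSS : S ^ 2 ≤ 4 * (Ns + Nd) := (sq_integral_le_two_mul cG).trans (by linarith)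
  have hbound : ∀ u : ℝ → ℂ, ContinuousOn u (Icc (-1) 1) → (∀ x, ‖u x‖ ≤ G x) →
      ∫ x in (-1 : ℝ)..1, h x * ‖u x‖ ≤ 16 * (K * ε) * (Ns + Nd) := by
    intro u hu huG
    have h1 : ∫ x in (-1 : ℝ)..1, h x * ‖u x‖ ≤
        ∫ x in (-1 : ℝ)..1, (3 * (a * ‖β‖) * G x + 2 * (K * ε) * G x ^ 2) := by
      refine intervalIntegral.integral_mono_on (by norm_num)
        (ContinuousOn.intervalIntegrable_Icc (by fun_prop))
        (ContinuousOn.intervalIntegrable_Icc (by fun_prop)) fun x _ => ?_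
      have h2 : h x * ‖u x‖ ≤ h x * G x :=
        mul_le_mul_of_nonneg_left (huG x) (by have := hG0 x; positivity)
      simp only [hh] at h2 ⊢
      linarith
    have iG := cG.intervalIntegrable_Icc
    have iG2 : IntervalIntegrable (fun x => G x ^ 2) volume (-1) 1 :=
      ContinuousOn.intervalIntegrable_Icc (by fun_prop)
    rw [intervalIntegral.integral_add (iG.const_mul _) (iG2.const_mul _),
      intervalIntegral.integral_const_mul, intervalIntegral.integral_const_mul] at h1
    have h2 : 3 * (a * ‖β‖) * S ≤ 3 * (K * ε) * S ^ 2 := by nlinarith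
    have h3 : 0 ≤ K * ε := by positivity
    have h4 := mul_le_mul_of_nonneg_left hSS h3
    have h5 := mul_le_mul_of_nonneg_left hGG h3
    linarith
  have Bs := Es.trans (hbound _ hs.cont fun x => by simp only [hG]; linarith [norm_nonneg (φ x - ψ x)])
  have Bd := Ed.trans (hbound _ hd.cont fun x => by simp only [hG]; linarith [norm_nonneg (φ x + ψ x)])
  have hpc := integral_norm_sq_le_of_mean_zero hd hmean
  have hs1 : 0 ≤ ∫ x in (-1 : ℝ)..1, ‖φ₁ x + ψ₁ x‖ ^ 2 :=
    intervalIntegral.integral_nonneg (by norm_num) fun x _ => sq_nonneg _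
  set T := K * ε * (Ns + Nd) with hT
  have hT0 : 0 ≤ T := by positivity
  have hNsT : Ns ≤ 16 * T * (1 / (2 * γL)) := by
    rw [mul_one_div, le_div_iff₀ (by positivity)]
    nlinarith [mul_nonneg hμ.le hs1]
  have hNdT : Nd ≤ 16 * T * (4 / μ) := by
    rw [← mul_div_assoc, le_div_iff₀ hμ]
    nlinarith
  -- The energy estimates bound `Ns + Nd` by `16 T` times the bracket in `hsmall`, with Poincaré
  -- supplying the part for `Nd`. Smallness was imposed with `26 > 16`, so the two bounds are
  -- compatible only if everything vanishes.
  have hN : Ns + Nd ≤ 0 := by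
    have h1 : 26 * T * (1 / (2 * γL) + 4 / μ) ≤ Ns + Nd := by
      have := mul_le_mul_of_nonneg_right hsmall (by positivity : 0 ≤ Ns + Nd)
      rw [hT]
      linarith
    have h2 : 0 ≤ T * (1 / (2 * γL) + 4 / μ) := by positivity
    linarith
  refine ⟨fun x hx => ?_, ?_⟩
  swap
  · have hS2 : S = 0 := pow_eq_zero_iff two_ne_zero |>.1 (le_antisymm (by linarith) (sq_nonneg S))
    rw [hS2, mul_zero] at hβ
    exact norm_le_zero_iff.1 (nonpos_of_mul_nonpos_right hβ ha)
  have h1 := eq_zero_of_integral_sq hs.cont.norm (by linarith : Ns ≤ 0) x hx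
  have h2 := eq_zero_of_integral_sq hd.cont.norm (by linarith : Nd ≤ 0) x hx
  rw [norm_eq_zero] at h1 h2
  exact ⟨by linear_combination (h1 + h2) / 2, by linear_combination (h1 - h2) / 2⟩

/-- For weak shear, steady states close to the homogeneous one are linearly stable. -/
lemma exists_stable_nhds (hμ : 0 < μ) (hγN : 0 < γN) (hγL : 0 < γL) (hV : IsShearProfile V) :
    ∃ ε > 0, ∀ (A : ℝ) (P : ℝ → ℂ), |A| ≤ ε → IsSteadyState μ γN γL A V P →
      (∀ x ∈ Icc (-1 : ℝ) 1, ‖P x - (Real.sqrt (γL / γN) : ℝ)‖ ≤ ε) →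
        IsLinearlyStable μ γN γL A V P := by
  set a := Real.sqrt (γL / γN) with ha
  have ha0 : 0 < a := Real.sqrt_pos.2 (by positivity)
  have haL : γN * a ^ 2 = γL := by
    rw [Real.sq_sqrt (by positivity)]
    field_simp
  obtain ⟨C, hC0, hC⟩ := hV.exists_bound
  set M := 26 * (C + 9 * a * γN) * (1 / (2 * γL) + 4 / μ) with hM
  have hM0 : 0 < M := by positivity
  refine ⟨min (a / 2) (1 / M), by positivity, fun A P hA hP hPa => ?_⟩
  set ε := min (a / 2) (1 / M) with hε
  have hε0 : 0 ≤ ε := by positivity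
  have hεa : ε ≤ a / 2 := min_le_left _ _
  have hsmall : 26 * ((C + 9 * a * γN) * ε) * (1 / (2 * γL) + 4 / μ) ≤ 1 := by
    have h1 : ε ≤ 1 / M := min_le_right _ _
    rw [le_div_iff₀ hM0] at h1
    rw [hM] at h1
    linarith
  obtain ⟨P₁, P₂, hPN, hPe⟩ := hP
  have cP := hPN.cont
  have cPc : ContinuousOn (fun x => conj (P x)) (Icc (-1) 1) :=
    Complex.continuous_conj.comp_continuousOn cP
  have hI := norm_integral_add_conj cP ha0 hεa hPa
  have hIne : ∫ x in (-1 : ℝ)..1, (P x + conj (P x)) ≠ 0 := by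
    rw [← norm_pos_iff]
    linarith
  -- One statement serves both halves of stability: `c = 0` is the eigenvalue equation, and `z = 0`
  -- is the equation for a Jordan chain over the neutral mode.
  have key : ∀ (φ ψ φ₁ φ₂ ψ₁ ψ₂ : ℝ → ℂ) (z c : ℂ), H2NeumannWith φ φ₁ φ₂ →
      H2NeumannWith ψ ψ₁ ψ₂ → 0 ≤ z.re →
      (∀ᵐ x ∂volΩ, (μ : ℂ) * φ₂ x + ((γL : ℂ) - Complex.I * (A : ℂ) * (V x : ℂ)) * φ x
        - (γN : ℂ) * (2 * (‖P x‖ : ℂ) ^ 2 * φ x + P x ^ 2 * ψ x) = z * φ x + c * P x) →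
      (∀ᵐ x ∂volΩ, (μ : ℂ) * ψ₂ x + ((γL : ℂ) + Complex.I * (A : ℂ) * (V x : ℂ)) * ψ x
        - (γN : ℂ) * (2 * (‖P x‖ : ℂ) ^ 2 * ψ x + conj (P x) ^ 2 * φ x) =
          z * ψ x - c * conj (P x)) →
      ∃ α : ℂ, (∀ x ∈ Icc (-1 : ℝ) 1, φ x = α * P x ∧ ψ x = -(α * conj (P x))) ∧
        c + z * α = 0 := by
    intro φ ψ φ₁ φ₂ ψ₁ ψ₂ z c hφ hψ hz e1 e2
    -- Subtracting `α` times the neutral mode gives the difference zero mean. As that mode lies in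
    -- the kernel, the only effect on the equation is to replace `c` by `c + z * α`.
    set α := (∫ x in (-1 : ℝ)..1, (φ x - ψ x)) / ∫ x in (-1 : ℝ)..1, (P x + conj (P x)) with hα
    have hφ' := hφ.sub (hPN.const_mul α)
    have hψ' := hψ.add (hPN.map_conj.const_mul α)
    have hmean : ∫ x in (-1 : ℝ)..1, ((φ x - α * P x) - (ψ x + α * conj (P x))) = 0 := by
      have e : ∀ x, (φ x - α * P x) - (ψ x + α * conj (P x)) =
          (φ x - ψ x) - α * (P x + conj (P x)) := fun x => by ring
      simp only [e]
      rw [intervalIntegral.integral_sub (hφ.sub hψ).cont.intervalIntegrable_Icc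
        ((ContinuousOn.intervalIntegrable_Icc (f := fun x => P x + conj (P x))
          (cP.add cPc)).const_mul α), intervalIntegral.integral_const_mul, hα,
        div_mul_cancel₀ _ hIne, sub_self]
    have hnn : ∀ x, (‖P x‖ : ℂ) ^ 2 = P x * conj (P x) := fun x => by
      rw [Complex.mul_conj, Complex.normSq_eq_norm_sq, Complex.ofReal_pow]
    obtain ⟨h0, hβ⟩ := damped_modes_eq_zero hμ hγN hγL ha0 haL hC hC0 hε0 hεa hsmall hA cP hPa hφ' hψ' hz
      (β := c + z * α) (by
        filter_upwards [e1, hPe] with x h1 h2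
        linear_combination h1 + α * h2 + (γN : ℂ) * α * P x * hnn x)
      (by
        filter_upwards [e2, hPe] with x h1 h2
        have h3 := congrArg conj h2
        simp only [map_sub, map_add, map_mul, map_neg, map_pow, Complex.conj_ofReal, Complex.conj_I,
          map_zero] at h3
        linear_combination h1 - α * h3 - (γN : ℂ) * α * conj (P x) * hnn x) hmean
    exact ⟨α, fun x hx => ⟨by linear_combination (h0 x hx).1, by linear_combination (h0 x hx).2⟩, hβ⟩
  refine ⟨fun z hz hz0 => ?_, fun φ ψ c h => ?_⟩
  · by_contra! hre
    obtain ⟨φ, ψ, ⟨x₀, hx₀, hne⟩, φ₁, φ₂, ψ₁, ψ₂, hφ, hψ, e1, e2⟩ := hz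
    obtain ⟨α, hα, h0⟩ := key φ ψ φ₁ φ₂ ψ₁ ψ₂ z 0 hφ hψ hre (by simpa using e1) (by simpa using e2)
    rw [zero_add, mul_eq_zero, or_iff_right hz0] at h0
    simp [hα x₀ hx₀, h0] at hne
  · obtain ⟨φ₁, φ₂, ψ₁, ψ₂, hφ, hψ, e1, e2⟩ := h
    obtain ⟨α, hα, -⟩ := key φ ψ φ₁ φ₂ ψ₁ ψ₂ 0 c hφ hψ le_rfl (by simpa using e1)
      (by simpa [sub_eq_add_neg] using e2)
    exact ⟨α, hα⟩

end stability

/-! ### Weak shear -/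

section weak

variable {μ γN γL A : ℝ} {V : ℝ → ℝ}

/-- Bounding from both ends gives lengths `x + 1` and `1 - x`; the end values are opposite, so they
cancel in the average and no factor for the length remains. -/
lemma abs_flux_le (hV : MemLp V ⊤ volΩ) {C M : ℝ} (hC : ∀ᵐ x ∂volΩ, |V x| ≤ C) (hC0 : 0 ≤ C)
    {r : ℝ → ℝ} (hr : ContinuousOn r (Icc (-1) 1)) (hM : ∀ x ∈ Icc (-1 : ℝ) 1, |r x| ≤ M) {x : ℝ}
    (hx : x ∈ Icc (-1 : ℝ) 1) : |flux V r x| ≤ C * M ^ 2 := by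
  have hp := isPrim_flux hV hr
  have hb : ∀ᵐ x ∂volΩ, ‖V x * r x ^ 2‖ ≤ C * M ^ 2 := by
    filter_upwards [hC, ae_mem_Icc] with t ht htI
    rw [norm_mul, norm_pow]
    exact mul_le_mul ht (pow_le_pow_left₀ (abs_nonneg _) (hM t htI) 2) (by positivity) hC0
  have h1 := hp.norm_sub_le hb neg_one_mem_Icc' hx
  have h2 := hp.norm_sub_le hb one_mem_Icc' hx
  have h3 : flux V r (-1) = -flux V r 1 := by
    simp only [flux, intervalIntegral.integral_same]
    ring
  rw [Real.norm_eq_abs, abs_of_nonneg (by linarith [hx.1] : 0 ≤ x - -1), h3] at h1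
  rw [Real.norm_eq_abs, abs_of_nonpos (by linarith [hx.2] : x - 1 ≤ 0)] at h2
  rw [abs_le] at h1 h2 ⊢
  constructor <;> linarith

lemma abs_phase_le (hμ : 0 < μ) (hV : MemLp V ⊤ volΩ) {C a : ℝ} (hC : ∀ᵐ x ∂volΩ, |V x| ≤ C)
    (hC0 : 0 ≤ C) (ha : 0 < a) {r : ℝ → ℝ} (hr : ContinuousOn r (Icc (-1) 1))
    (hra : ∀ x ∈ Icc (-1 : ℝ) 1, |r x - a| < a / 2) {x : ℝ} (hx : x ∈ Icc (-1 : ℝ) 1) :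
    |phase μ A V r x| ≤ |A| * (18 * C / μ) := by
  have hlow : ∀ x ∈ Icc (-1 : ℝ) 1, a / 2 ≤ r x := fun x hx => by
    linarith [(abs_lt.1 (hra x hx)).1]
  have hup : ∀ x ∈ Icc (-1 : ℝ) 1, |r x| ≤ 3 / 2 * a := fun x hx => by
    rw [abs_of_nonneg (by linarith [hlow x hx])]
    linarith [(abs_lt.1 (hra x hx)).2]
  have hinv : ContinuousOn (fun x => (r x)⁻¹) (Icc (-1) 1) :=
    hr.inv₀ fun x hx => by linarith [hlow x hx]
  have hc : ContinuousOn (fun t => A / μ * (flux V r t * ((r t)⁻¹ * (r t)⁻¹))) (Icc (-1) 1) :=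
    continuousOn_const.mul ((isPrim_flux hV hr).continuousOn.mul (hinv.mul hinv))
  have hb : ∀ t ∈ Icc (-1 : ℝ) 1,
      ‖A / μ * (flux V r t * ((r t)⁻¹ * (r t)⁻¹))‖ ≤ |A| * (9 * C / μ) := by
    intro t ht
    have h1 := abs_flux_le hV hC hC0 hr hup ht
    have h0 : 0 < r t := by linarith [hlow t ht]
    have h2 : (r t)⁻¹ ≤ 2 / a := by
      rw [inv_le_comm₀ h0 (by positivity), inv_div]
      exact hlow t ht
    have h3 : (r t)⁻¹ * (r t)⁻¹ ≤ 2 / a * (2 / a) :=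
      mul_le_mul h2 h2 (by positivity) (by positivity)
    rw [norm_mul, norm_mul, norm_div, Real.norm_eq_abs, Real.norm_eq_abs, Real.norm_eq_abs,
      Real.norm_eq_abs, abs_of_pos hμ, abs_of_pos (by positivity : 0 < (r t)⁻¹ * (r t)⁻¹)]
    calc |A| / μ * (|flux V r t| * ((r t)⁻¹ * (r t)⁻¹))
        ≤ |A| / μ * (C * (3 / 2 * a) ^ 2 * (2 / a * (2 / a))) := by gcongr
      _ = |A| * (9 * C / μ) := by field_simp; ring
  have h1 := (IsPrim.of_integral hc.intervalIntegrable_Icc).norm_sub_le (ae_of_forall_Icc hb)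
    neg_one_mem_Icc' hx
  rw [intervalIntegral.integral_same, sub_zero, abs_of_nonneg (by linarith [hx.1] : 0 ≤ x - -1)] at h1
  refine h1.trans ?_
  have h2 : 0 ≤ |A| * (9 * C / μ) := by positivity
  rw [show |A| * (18 * C / μ) = |A| * (9 * C / μ) * 2 by ring]
  exact mul_le_mul_of_nonneg_left (by linarith [hx.2]) h2

lemma norm_polar_sub_le {r θ : ℝ → ℝ} {a x : ℝ} :
    ‖polar r θ x - (a : ℂ)‖ ≤ |r x| * |θ x| + |r x - a| := by
  have e : polar r θ x - (a : ℂ) =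
      (r x : ℂ) * (Complex.exp (Complex.I * (θ x : ℂ)) - 1) + ((r x - a : ℝ) : ℂ) := by
    rw [polar]
    push_cast
    ring
  rw [e]
  refine (norm_add_le _ _).trans (add_le_add ?_ (by rw [Complex.norm_real, Real.norm_eq_abs]))
  rw [norm_mul, Complex.norm_real]
  exact mul_le_mul_of_nonneg_left Real.norm_exp_I_mul_ofReal_sub_one_le (norm_nonneg _)

/-- The branch of stable steady states for weak shear. -/
theorem exists_stable_branch (hμ : 0 < μ) (hγN : 0 < γN) (hγL : 0 < γL) (hV : IsShearProfile V) :
    ∃ A₀ : ℝ, 0 < A₀ ∧ ∃ R θ : ℝ → ℝ → ℝ,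
      (∀ A ∈ Icc 0 A₀,
        IsSteadyState μ γN γL A V (polar (R A) (θ A)) ∧
        IsLinearlyStable μ γN γL A V (polar (R A) (θ A)) ∧
        MemH2Neumann (R A) ∧ MemH2Neumann (θ A) ∧
        (∀ x ∈ Icc (-1 : ℝ) 1, 0 < R A x) ∧
        (∀ x ∈ Icc (-1 : ℝ) 1, R A (-x) = R A x) ∧
        (∀ P : ℝ → ℂ, IsSteadyState μ γN γL A V P → ¬ IsLinearlyUnstable μ γN γL A V P →
          ∃ c : ℝ, ∀ x ∈ Icc (-1 : ℝ) 1,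
            P x = Complex.exp (Complex.I * (c : ℂ)) * polar (R A) (θ A) x)) ∧
      TendstoUniformlyOn R (fun _ => Real.sqrt (γL / γN)) (𝓝[≥] 0) (Icc (-1) 1) := by
  obtain ⟨ψ, hψ, δ, hδ, hamp, huniq⟩ := exists_amplitude_branch hμ hγN hγL hV.memLp
  obtain ⟨ε, hε, hstab⟩ := exists_stable_nhds hμ hγN hγL hV
  obtain ⟨C, hC0, hC⟩ := hV.exists_bound
  set a := Real.sqrt (γL / γN) with ha
  have ha0 : 0 < a := Real.sqrt_pos.2 (by positivity)
  obtain ⟨δ₁, hδ₁, hψ₁⟩ := hψ (min (min δ (a / 2)) (ε / 2)) (by positivity)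
  obtain ⟨A₁, hA₁, hclose⟩ := exists_norm_close_of_not_unstable hμ hγN hγL hV
    (ε := min δ (a / 2)) (by positivity)
  set K := 3 / 2 * a * (18 * C / μ) with hK
  have hK0 : 0 ≤ K := by positivity
  -- The halves provide strict inequalities on the closed range of `A`; the last term keeps the
  -- phase contribution to `‖P - a‖` below `ε / 2`.
  refine ⟨min (min (δ / 2) (δ₁ / 2)) (min (min ε A₁) (ε / (2 * (K + 1)))), by positivity,
    fun A => (ψ A).ext, fun A => phase μ A V (ψ A).ext, fun A hA => ?_, ?_⟩
  · have hAabs : |A| = A := abs_of_nonneg hA.1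
    have hAδ : |A| < δ := by
      have := hA.2.trans ((min_le_left _ _).trans (min_le_left _ _))
      linarith
    have hAδ₁ : |A| < δ₁ := by
      have := hA.2.trans ((min_le_left _ _).trans (min_le_right _ _))
      linarith
    have hAε : |A| ≤ ε := by
      rw [hAabs]
      exact hA.2.trans ((min_le_right _ _).trans ((min_le_left _ _).trans (min_le_left _ _)))
    have hAA₁ : |A| ≤ A₁ := by
      rw [hAabs]
      exact hA.2.trans ((min_le_right _ _).trans ((min_le_left _ _).trans (min_le_right _ _)))
    have hAK : |A| * K ≤ ε / 2 := by
      have h1 : |A| ≤ ε / (2 * (K + 1)) := by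
        rw [hAabs]
        exact hA.2.trans ((min_le_right _ _).trans (min_le_right _ _))
      rw [le_div_iff₀ (by positivity)] at h1
      nlinarith [abs_nonneg A]
    have hr := hψ₁ A hAδ₁
    have hrδ : ∀ x ∈ Icc (-1 : ℝ) 1, |(ψ A).ext x - a| < δ := fun x hx =>
      (hr x hx).trans_le ((min_le_left _ _).trans (min_le_left _ _))
    have hra : ∀ x ∈ Icc (-1 : ℝ) 1, |(ψ A).ext x - a| < a / 2 := fun x hx =>
      (hr x hx).trans_le ((min_le_left _ _).trans (min_le_right _ _))
    have hrε : ∀ x ∈ Icc (-1 : ℝ) 1, |(ψ A).ext x - a| ≤ ε / 2 := fun x hx =>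
      (hr x hx).le.trans (min_le_right _ _)
    have hampA := hamp A hAδ
    -- The reflected amplitude is another solution near `a`, so local uniqueness gives evenness.
    have heven : ∀ x ∈ Icc (-1 : ℝ) 1, (ψ A).ext (-x) = (ψ A).ext x :=
      huniq A _ hAδ (hampA.comp_neg hV) fun x hx => hrδ _ (neg_mem_Icc' hx)
    obtain ⟨hR, hθ, hsteady⟩ := hampA.isSteadyState hμ hV heven
    refine ⟨hsteady, hstab A _ hAε hsteady fun x hx => ?_, hR, hθ, hampA.1, heven,
      fun P hP hPu => ?_⟩
    · refine norm_polar_sub_le.trans ?_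
      have h1 := abs_phase_le (A := A) hμ hV.memLp hC hC0 ha0 (ψ A).continuous_ext.continuousOn
        hra hx
      have h2 : |(ψ A).ext x| ≤ 3 / 2 * a := by
        rw [abs_of_pos (hampA.1 x hx)]
        linarith [(abs_lt.1 (hra x hx)).2]
      have h3 : |(ψ A).ext x| * |phase μ A V (ψ A).ext x| ≤ 3 / 2 * a * (|A| * (18 * C / μ)) :=
        mul_le_mul h2 h1 (abs_nonneg _) (by positivity)
      have h4 := hrε x hx
      rw [hK] at hAK
      linarith
    -- Closeness to `a` within `a / 2` excludes zeros, so the modulus is an amplitude; closeness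
    -- within `δ` then places it on the branch.
    · have hn := hclose A hAA₁ P hP hPu
      have h0 : ∀ x ∈ Icc (-1 : ℝ) 1, P x ≠ 0 := fun x hx => by
        rw [← norm_pos_iff]
        linarith [(abs_lt.1 ((hn x hx).trans_le (min_le_right _ _))).1]
      obtain ⟨P₁, P₂, hPN, hPe⟩ := id hP
      obtain ⟨r₁, r₂, hrN, hre, -⟩ := exists_norm_amplitude hμ hV hPN (steady_second_deriv hμ hPe) h0
      have hPr := huniq A _ hAδ ⟨fun x hx => norm_pos_iff.2 (h0 x hx), r₁, r₂, hrN, hre⟩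
        fun x hx => (hn x hx).trans_le (min_le_left _ _)
      exact eq_phase_of_norm_eq hμ hV hP hsteady h0 fun x hx => by
        rw [norm_polar (hampA.1 x hx).le, hPr x hx]
  · rw [Metric.tendstoUniformlyOn_iff]
    intro η hη
    obtain ⟨δ₂, hδ₂, h⟩ := hψ η hη
    refine nhdsWithin_le_nhds (Metric.eventually_nhds_iff.2 ⟨δ₂, hδ₂, fun A hA x hx => ?_⟩)
    rw [dist_comm, Real.dist_eq]
    exact h A (by simpa using hA) x hx

end weak

theorem theorem1 (μ γN γL : ℝ) (hμ : 0 < μ) (hγN : 0 < γN) (hγL : 0 < γL)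
    (V : ℝ → ℝ) (hV : IsShearProfile V) :
    -- (a), steady states for weak shear
    (∃ A₀ : ℝ, 0 < A₀ ∧ ∃ R θ : ℝ → ℝ → ℝ,
      (∀ A ∈ Icc 0 A₀,
        IsSteadyState μ γN γL A V (polar (R A) (θ A)) ∧
        IsLinearlyStable μ γN γL A V (polar (R A) (θ A)) ∧
        MemH2Neumann (R A) ∧ MemH2Neumann (θ A) ∧
        (∀ x ∈ Icc (-1 : ℝ) 1, 0 < R A x) ∧
        (∀ x ∈ Icc (-1 : ℝ) 1, R A (-x) = R A x) ∧
        -- uniqueness, up to a constant phase: no other steady state avoids linear instability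
        (∀ P : ℝ → ℂ, IsSteadyState μ γN γL A V P → ¬ IsLinearlyUnstable μ γN γL A V P →
          ∃ c : ℝ, ∀ x ∈ Icc (-1 : ℝ) 1,
            P x = Complex.exp (Complex.I * (c : ℂ)) * polar (R A) (θ A) x)) ∧
      TendstoUniformlyOn R (fun _ => Real.sqrt (γL / γN)) (𝓝[≥] 0) (Icc (-1) 1)) ∧
    -- (a), first eigenvalues of the linearly unstable steady states without shear
    (∃ C : ℝ, 0 < C ∧ ∀ P : ℝ → ℂ, IsSteadyState μ γN γL 0 V P →
      IsLinearlyUnstable μ γN γL 0 V P →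
        ∃ lam : ℝ, IsFirstEigenvalue μ γN γL 0 V P lam ∧ C < lam) ∧
    -- (b), nonexistence for strong shear
    (∃ A₁ : ℝ, 0 < A₁ ∧ ∀ A : ℝ, A₁ ≤ A →
      ¬ ∃ R θ : ℝ → ℝ, IsSteadyState μ γN γL A V (polar R θ) ∧
        (∃ x ∈ Icc (-1 : ℝ) 1, R x ≠ 0) ∧
        (∀ x ∈ Icc (-1 : ℝ) 1, 0 ≤ R x) ∧
        (∀ x ∈ Icc (-1 : ℝ) 1, R (-x) = R x) ∧
        AntitoneOn R (Ioo (-1) 0) ∧ MonotoneOn R (Ioo 0 1)) := by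
  exact ⟨exists_stable_branch hμ hγN hγL hV, exists_gap_noshear hμ hγN hγL V,
    nonexistence_strong_shear hμ hγN hγL hV⟩
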